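/- Let $\mathbb{K}$ be a field of characteristic zero, $(X,\mathcal{O}_X)$ a topological space with a sheaf of commutative $\mathbb{K}$-algebras, and $\mathcal{L}$ a Lie algebroid over $(X,\mathcal{O}_X)$: a sheaf such that $(\mathcal{O}_X(U),\mathcal{L}(U))$ is a Lie--Rinehart algebra over $\mathbb{K}$ for every open $U$ and the restrictions are morphisms of Lie--Rinehart algebras. Assume that $\mathcal{L}$ is locally free of constant finite rank $r$. An $\mathcal{L}$-connection on $\mathcal{L}$ is a family of maps $\nabla:\mathcal{L}(U)\times\mathcal{L}(U)\to\mathcal{L}(U)$, compatible with restriction, $\mathcal{O}_X$-linear in the first and $\mathbb{K}$-linear in the second argument, with $\nabla_x(ay)=a\nabla_xy+x(a)y$. Let $\mathcal{U}(\mathcal{L})$ be the universal enveloping algebra, with its $\mathcal{O}_X$-coalgebra structure ($\mathcal{O}_X$ acting by left multiplication, $\Delta(a)=a\otimes1$, $\Delta(x)=x\otimes 1+1\otimes x$ for $a\in\mathcal{O}_X$, $x\in\mathcal{L}$, $\epsilon(D)=D(1)$), and let $\mathcal{J}(\mathcal{L})=\mathcal{H}om_{\mathcal{O}_X}(\mathcal{U}(\mathcal{L}),\mathcal{O}_X)$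 be the jet algebra, with product $(\phi\psi)(D)=\phi(D_{(1)})\psi(D_{(2)})$ and the $\mathcal{O}_{X_1}$-algebra structure $a\mapsto(D\mapsto a\,\epsilon(D))$. In the same way let $\widehat{\operatorname{Sym}}_{\mathcal{O}_X}(\mathcal{L}^\vee)=\mathcal{H}om_{\mathcal{O}_X}(\operatorname{Sym}_{\mathcal{O}_X}\mathcal{L},\mathcal{O}_X)$, with the product dual to the coproduct of $\operatorname{Sym}_{\mathcal{O}_X}\mathcal{L}$. (0) This is the degree completion of the sheaf of symmetric algebras of $\mathcal{L}^\vee=\mathcal{H}om_{\mathcal{O}_X}(\mathcal{L},\mathcal{O}_X)$: the canonical algebra morphism from the presheaf $U\mapsto\operatorname{Sym}_{\mathcal{O}_X(U)}(\mathcal{L}^\vee(U))$ is locally injective, and for every $n$ the restriction to $\operatorname{Sym}^n\mathcal{L}$ of a section of $\widehat{\operatorname{Sym}}(\mathcal{L}^\vee)$ comes locally from $\operatorname{Sym}^n(\mathcal{L}^\vee)$. (1) Let $\nabla$ be an $\mathcal{L}$-connection on $\mathcal{L}$. Put $(\nabla^{(2)}_x\phi)(D)=\phi(Dx)$, and let $D$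 be the degree one operator on $\mathcal{J}(\mathcal{L})$-valued symmetric forms on $\mathcal{L}$ $$(D\psi)(x_0,\dots,x_n)=\sum_{i=0}^n\Big(\nabla^{(2)}_{x_i}\big(\psi(x_0,\dots,\widehat{x_i},\dots,x_n)\big)-\sum_{j\ne i}\psi(x_0,\dots,\widehat{x_i},\dots,\nabla_{x_i}x_j,\dots,x_n)\Big).$$ Then $$j^{\rm PBW}_\nabla(\phi)=\sum_{n\ge0}\frac{D^n\phi}{n!}(1),\qquad\text{i.e. } j^{\rm PBW}_\nabla(\phi)(x_1\cdots x_n)=\frac1{n!}\big((D^n\phi)(x_1,\dots,x_n)\big)(1),$$ defines an $\mathcal{O}_{X_1}$-linear isomorphism of sheaves of algebras $j^{\rm PBW}_\nabla:\mathcal{J}(\mathcal{L})\to\widehat{\operatorname{Sym}}_{\mathcal{O}_X}(\mathcal{L}^\vee)$. (2) Conversely, any $\mathcal{O}_{X_1}$-linear isomorphism of sheaves of algebras $j:\mathcal{J}(\mathcal{L})\to\widehat{\operatorname{Sym}}_{\mathcal{O}_X}(\mathcal{L}^\vee)$ defines an $\mathcal{L}$-connection on $\mathcal{L}$: there is exactly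 one $\mathcal{L}$-connection $\nabla$ on $\mathcal{L}$ such that $j^{-1}(\alpha)(xy)=j^{-1}(\alpha)(\nabla_xy)$ for all local sections $\alpha$ of $\mathcal{L}^\vee$ and $x,y$ of $\mathcal{L}$, where $xy$ is the product in $\mathcal{U}(\mathcal{L})$. -/

import Mathlib

open CategoryTheory TopologicalSpace Opposite
open scoped TensorProduct

universe u

set_option linter.unusedSectionVars false

noncomputable section

namespace LieAlgebroidPBW

section Enveloping

variable (K R L : Type*) [CommRing K] [CommRing R] [Algebra K R] [LieRing L] [LieAlgebra K L]
  [Module R L] [LieRingModule L R] [LieRinehartRing R L] [LieRinehartAlgebra K R L]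

/-- The relations defining the universal enveloping algebra of a Lie-Rinehart algebra `(R, L)`
as a quotient of the tensor algebra of `R ⊕ L` over `K`. -/
inductive EnvRel : TensorAlgebra K (R × L) → TensorAlgebra K (R × L) → Prop
  | one : EnvRel (TensorAlgebra.ι K (1, 0)) 1
  | smul (r s : R) (x : L) :
      EnvRel (TensorAlgebra.ι K (r, 0) * TensorAlgebra.ι K (s, x))
        (TensorAlgebra.ι K (r * s, r • x))
  | lie (x y : L) :
      EnvRel (TensorAlgebra.ι K (0, x) * TensorAlgebra.ι K (0, y))
        (TensorAlgebra.ι K (0, y) * TensorAlgebra.ι K (0, x) + TensorAlgebra.ι K (0, ⁅x, y⁆))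
  | anchor (x : L) (r : R) :
      EnvRel (TensorAlgebra.ι K (0, x) * TensorAlgebra.ι K (r, 0))
        (TensorAlgebra.ι K (r, 0) * TensorAlgebra.ι K (0, x) + TensorAlgebra.ι K (⁅x, r⁆, 0))

/-- The universal enveloping algebra `U(L, R)` of a Lie-Rinehart algebra `(R, L)` over `K`. -/
def Env : Type _ := RingQuot (EnvRel K R L)

instance : Ring (Env K R L) := inferInstanceAs (Ring (RingQuot (EnvRel K R L)))
instance : Algebra K (Env K R L) := inferInstanceAs (Algebra K (RingQuot (EnvRel K R L)))

namespace Env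

variable {R L}

/-- The quotient map. -/
def mk : TensorAlgebra K (R × L) →ₐ[K] Env K R L := RingQuot.mkAlgHom K (EnvRel K R L)

lemma mk_rel {a b : TensorAlgebra K (R × L)} (h : EnvRel K R L a b) : mk K a = mk K b :=
  RingQuot.mkAlgHom_rel K h

/-- The canonical map `R ⊕ L → U(L, R)`. -/
def gen : R × L →ₗ[K] Env K R L := (mk K).toLinearMap ∘ₗ TensorAlgebra.ι K

lemma mk_ι (p : R × L) : mk K (TensorAlgebra.ι K p) = gen K p := rfl

lemma gen_one : gen K ((1, 0) : R × L) = 1 := by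
  simpa [mk_ι] using mk_rel K (EnvRel.one (K := K) (R := R) (L := L))

lemma gen_mul (r s : R) (x : L) :
    gen K ((r, 0) : R × L) * gen K (s, x) = gen K (r * s, r • x) := by
  simpa [mk_ι] using mk_rel K (EnvRel.smul (K := K) r s x)

lemma gen_lie (x y : L) :
    gen K ((0, x) : R × L) * gen K (0, y) = gen K (0, y) * gen K (0, x) + gen K (0, ⁅x, y⁆) := by
  simpa [mk_ι] using mk_rel K (EnvRel.lie (K := K) (R := R) x y)

lemma gen_anchor (x : L) (r : R) :
    gen K ((0, x) : R × L) * gen K (r, 0) = gen K (r, 0) * gen K (0, x) + gen K (⁅x, r⁆, 0) := by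
  simpa [mk_ι] using mk_rel K (EnvRel.anchor (K := K) x r)

/-- The `K`-algebra morphism `i_R : R → U(L, R)`. -/
def ofRing : R →+* Env K R L where
  toFun r := gen K (r, 0)
  map_one' := gen_one K
  map_mul' r s := by rw [gen_mul]; simp
  map_zero' := map_zero (gen K)
  map_add' r s := by rw [← map_add]; simp

/-- The map `i_L : L → U(L, R)`. -/
def ofLie : L →ₗ[K] Env K R L := gen K ∘ₗ LinearMap.inr K R L

lemma gen_eq (p : R × L) : gen K p = ofRing K p.1 + ofLie K p.2 := by
  change _ = gen K (p.1, 0) + gen K (0, p.2)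
  rw [← map_add]; simp

/-- `U(L, R)` as an `R`-module by left multiplication. -/
instance : Module R (Env K R L) := Module.compHom _ (ofRing K (R := R) (L := L))

lemma smul_def (r : R) (a : Env K R L) : r • a = ofRing K r * a := rfl

lemma smul_ofLie (r : R) (x : L) : r • (ofLie K x : Env K R L) = ofLie K (r • x) := by
  change gen K (r, 0) * gen K (0, x) = gen K (0, r • x)
  rw [gen_mul]; simp

lemma ofLie_mul_ofLie (x y : L) :
    (ofLie K x * ofLie K y : Env K R L) = ofLie K y * ofLie K x + ofLie K ⁅x, y⁆ := gen_lie K x y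

lemma ofLie_mul_ofRing (x : L) (r : R) :
    (ofLie K x * ofRing K r : Env K R L) = ofRing K r * ofLie K x + ofRing K ⁅x, r⁆ :=
  gen_anchor K x r

lemma ofLie_mul_smul (x : L) (r : R) (a : Env K R L) :
    ofLie K x * (r • a) = r • (ofLie K x * a) + ⁅x, r⁆ • a := by
  simp only [smul_def, ← mul_assoc, ofLie_mul_ofRing, add_mul]

instance : IsScalarTower R (Env K R L) (Env K R L) :=
  ⟨fun r a b => by simp only [smul_def, smul_eq_mul, mul_assoc]⟩

lemma ofRing_algebraMap (k : K) : (ofRing K (algebraMap K R k) : Env K R L) = algebraMap K _ k := by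
  change gen K (algebraMap K R k, 0) = _
  rw [Algebra.algebraMap_eq_smul_one, Algebra.algebraMap_eq_smul_one, ← gen_one, ← map_smul]
  simp

instance : IsScalarTower K R (Env K R L) :=
  ⟨fun k r a => by
    rw [Algebra.smul_def, smul_def, smul_def, map_mul, ofRing_algebraMap, mul_assoc,
      Algebra.smul_def]⟩

instance : SMulCommClass R K (Env K R L) :=
  ⟨fun r k a => by rw [smul_def, smul_def, mul_smul_comm]⟩

instance : SMulCommClass K R (Env K R L) := SMulCommClass.symm _ _ _

variable {K}

section lift

variable {A : Type*} [Ring A] [Algebra K A]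

/-- The universal property of `U(L, R)`. -/
def lift (f : R × L →ₗ[K] A) (h_one : f (1, 0) = 1)
    (h_smul : ∀ r s x, f (r, 0) * f (s, x) = f (r * s, r • x))
    (h_lie : ∀ x y, f (0, x) * f (0, y) = f (0, y) * f (0, x) + f (0, ⁅x, y⁆))
    (h_anchor : ∀ x r, f (0, x) * f (r, 0) = f (r, 0) * f (0, x) + f (⁅x, r⁆, 0)) :
    Env K R L →ₐ[K] A :=
  RingQuot.liftAlgHom K ⟨TensorAlgebra.lift K f, by
    intro a b h
    induction h with
    | one => simpa using h_one
    | smul r s x => simpa using h_smul r s x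
    | lie x y => simpa using h_lie x y
    | anchor x r => simpa using h_anchor x r⟩

@[simp] lemma lift_gen (f : R × L →ₗ[K] A) (h1 h2 h3 h4) (p : R × L) :
    lift f h1 h2 h3 h4 (gen K p) = f p := by
  change RingQuot.liftAlgHom K _ (RingQuot.mkAlgHom K _ _) = _
  simp

end lift

lemma induction_left {P : Env K R L → Prop} (one : P 1) (add : ∀ a b, P a → P b → P (a + b))
    (ring : ∀ (r : R) a, P a → P (ofRing K r * a)) (lie : ∀ (x : L) a, P a → P (ofLie K x * a))
    (a : Env K R L) : P a := by
  suffices H : ∀ t : TensorAlgebra K (R × L), ∀ b, P b →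
      P (mk K t * b) by
    obtain ⟨t, rfl⟩ := RingQuot.mkAlgHom_surjective K (EnvRel K R L) a
    change P (mk K t)
    simpa using H t 1 one
  intro t
  induction t using TensorAlgebra.induction with
  | algebraMap k =>
    intro b hb
    have := ring (algebraMap K R k) b hb
    rw [ofRing_algebraMap] at this
    rwa [AlgHom.commutes]
  | ι p =>
    intro b hb
    rw [mk_ι, gen_eq]
    have := add _ _ (ring p.1 b hb) (lie p.2 b hb)
    rwa [← add_mul] at this
  | mul s t hs ht =>
    intro b hb
    rw [map_mul, mul_assoc]
    exact hs _ (ht _ hb)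
  | add s t hs ht =>
    intro b hb
    rw [map_add, add_mul]
    exact add _ _ (hs _ hb) (ht _ hb)

section action

variable {M : Type*} [AddCommGroup M] [Module K M] [Module R M] [IsScalarTower K R M]

/-- A flat `L`-connection on an `R`-module `M` extends to an action of `U(L, R)`. -/
def act (nabla : L →ₗ[K] Module.End K M)
    (h_smul : ∀ (r : R) (x : L) (m : M), nabla (r • x) m = r • nabla x m)
    (h_leibniz : ∀ (x : L) (r : R) (m : M), nabla x (r • m) = r • nabla x m + ⁅x, r⁆ • m)
    (h_flat : ∀ (x y : L) (m : M),
      nabla x (nabla y m) = nabla y (nabla x m) + nabla ⁅x, y⁆ m) :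
    Env K R L →ₐ[K] Module.End K M :=
  lift (LinearMap.coprod (Algebra.lsmul K K M : R →ₐ[K] Module.End K M).toLinearMap nabla)
    (by ext m; simp)
    (by intro r s x; ext m; simp [h_smul])
    (by intro x y; ext m; simpa using h_flat x y m)
    (by intro x r; ext m; simpa using h_leibniz x r m)

variable (nabla : L →ₗ[K] Module.End K M)
  (h1 : ∀ (r : R) (x : L) (m : M), nabla (r • x) m = r • nabla x m)
  (h2 : ∀ (x : L) (r : R) (m : M), nabla x (r • m) = r • nabla x m + ⁅x, r⁆ • m)
  (h3 : ∀ (x y : L) (m : M), nabla x (nabla y m) = nabla y (nabla x m) + nabla ⁅x, y⁆ m)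

@[simp] lemma act_ofRing (r : R) (m : M) : act nabla h1 h2 h3 (ofRing K r) m = r • m := by
  change act nabla h1 h2 h3 (gen K (r, 0)) m = _
  simp [act]

@[simp] lemma act_ofLie (x : L) (m : M) : act nabla h1 h2 h3 (ofLie K x) m = nabla x m := by
  change act nabla h1 h2 h3 (gen K (0, x)) m = _
  simp [act]

lemma act_smul (r : R) (a : Env K R L) (m : M) :
    act nabla h1 h2 h3 (r • a) m = r • act nabla h1 h2 h3 a m := by
  simp [smul_def]

end action

section counit

variable (K R L) in
/-- The action of `U(L, R)` on `R` through the anchor. -/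
def onRing : Env K R L →ₐ[K] Module.End K R :=
  act (LieModule.toEnd K L R : L →ₗ[K] Module.End K R)
    (by intro r x m; simp) (by intro x r m; simp [mul_comm])
    (by intro x y m; simp)

lemma lie_one (x : L) : ⁅x, (1 : R)⁆ = 0 := by
  have h := LieRinehartRing.leibniz_mul_right x (1 : R) 1
  simpa using h

@[simp] lemma onRing_ofRing (r s : R) : onRing K R L (ofRing K r) s = r * s := by simp [onRing]

@[simp] lemma onRing_ofLie (x : L) (s : R) : onRing K R L (ofLie K x) s = ⁅x, s⁆ := by
  simp [onRing]

variable (K R L) in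
/-- The counit `D ↦ D(1)`. -/
def counit : Env K R L →ₗ[R] R where
  toFun a := onRing K R L a 1
  map_add' a b := by simp
  map_smul' r a := by simp [smul_def]

lemma counit_apply (a : Env K R L) : counit K R L a = onRing K R L a 1 := rfl

@[simp] lemma counit_one : counit K R L 1 = 1 := by simp [counit_apply]

lemma counit_ofLie_mul (x : L) (a : Env K R L) :
    counit K R L (ofLie K x * a) = ⁅x, counit K R L a⁆ := by simp [counit_apply]

end counit

section tensor

variable {M N P M' N' : Type*} [AddCommGroup M] [Module R M] [AddCommGroup N] [Module R N]
  [AddCommGroup P] [Module R P] [AddCommGroup M'] [Module R M'] [AddCommGroup N'] [Module R N']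

/-- The operator `p ⊗ 1 + 1 ⊗ q` on `M ⊗_R N`, for operators `p` and `q` which satisfy the Leibniz
identity over the same derivation `⁅x, -⁆` of `R`. -/
def tensorDer (x : L) (p : M →+ M) (q : N →+ N)
    (hp : ∀ (r : R) (m : M), p (r • m) = r • p m + ⁅x, r⁆ • m)
    (hq : ∀ (r : R) (n : N), q (r • n) = r • q n + ⁅x, r⁆ • n) : M ⊗[R] N →+ M ⊗[R] N :=
  TensorProduct.liftAddHom
    { toFun := fun m =>
        { toFun := fun n => p m ⊗ₜ n + m ⊗ₜ q n
          map_zero' := by simp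
          map_add' := fun a b => by simp only [map_add, TensorProduct.tmul_add]; abel }
      map_zero' := by ext; simp
      map_add' := fun a b => by
        ext n; simp only [map_add, TensorProduct.add_tmul, AddMonoidHom.coe_mk, ZeroHom.coe_mk,
          AddMonoidHom.add_apply]; abel }
    (fun r m n => by
      simp only [AddMonoidHom.coe_mk, ZeroHom.coe_mk, hp, hq, TensorProduct.add_tmul,
        TensorProduct.tmul_add, TensorProduct.smul_tmul]
      abel)

@[simp] lemma tensorDer_tmul (x : L) (p : M →+ M) (q : N →+ N) (hp) (hq) (m : M) (n : N) :
    tensorDer (R := R) x p q hp hq (m ⊗ₜ n) = p m ⊗ₜ n + m ⊗ₜ q n := rfl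

lemma tensorDer_smul (x : L) (p : M →+ M) (q : N →+ N) (hp) (hq) (r : R) (t : M ⊗[R] N) :
    tensorDer x p q hp hq (r • t) = r • tensorDer x p q hp hq t + ⁅x, r⁆ • t := by
  induction t with
  | zero => simp
  | tmul m n =>
    simp only [TensorProduct.smul_tmul', tensorDer_tmul, hp, TensorProduct.add_tmul, smul_add]
    abel
  | add a b ha hb => simp only [smul_add, map_add, ha, hb]; abel

/-- Left multiplication by `x ∈ L` on `U(L, R)`. -/
def mulLie (x : L) : Env K R L →+ Env K R L := AddMonoidHom.mulLeft (ofLie K x)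

@[simp] lemma mulLie_apply (x : L) (a : Env K R L) : mulLie x a = ofLie K x * a := rfl

lemma mulLie_smul (x : L) (r : R) (a : Env K R L) :
    mulLie x (r • a) = r • mulLie x a + ⁅x, r⁆ • a := ofLie_mul_smul K x r a

/-- The operator `x ⊗ 1 + 1 ⊗ x` on `U(L, R) ⊗_R U(L, R)`. -/
def lieTensor (x : L) : Env K R L ⊗[R] Env K R L →+ Env K R L ⊗[R] Env K R L :=
  tensorDer x (mulLie x) (mulLie x) (mulLie_smul x) (mulLie_smul x)

@[simp] lemma lieTensor_tmul (x : L) (a b : Env K R L) :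
    lieTensor x (a ⊗ₜ[R] b) = (ofLie K x * a) ⊗ₜ b + a ⊗ₜ (ofLie K x * b) := rfl

lemma lieTensor_smul (x : L) (r : R) (t : Env K R L ⊗[R] Env K R L) :
    lieTensor x (r • t) = r • lieTensor x t + ⁅x, r⁆ • t :=
  tensorDer_smul x (mulLie x) (mulLie x) (mulLie_smul x) (mulLie_smul x) r t

variable (K R L) in
/-- The operators `x ⊗ 1 + 1 ⊗ x`, as a `K`-linear function of `x ∈ L`. -/
def lieTensorHom : L →ₗ[K] Module.End K (Env K R L ⊗[R] Env K R L) :=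
  { toFun := fun x =>
      { lieTensor x with
        map_smul' := fun k t => by
          change lieTensor x (k • t) = k • lieTensor x t
          induction t with
          | zero => simp
          | tmul a b =>
            simp only [TensorProduct.smul_tmul', lieTensor_tmul, smul_add, mul_smul_comm]
          | add a b ha hb => simp only [smul_add, map_add, ha, hb] }
    map_add' := fun x y => by
      ext t
      change lieTensor (x + y) t = lieTensor x t + lieTensor y t
      induction t with
      | zero => simp
      | tmul a b =>
        simp only [lieTensor_tmul, map_add, add_mul, TensorProduct.add_tmul,
          TensorProduct.tmul_add]
        abel
      | add a b ha hb => simp only [map_add, ha, hb]; abel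
    map_smul' := fun k x => by
      ext t
      change lieTensor (k • x) t = k • lieTensor x t
      induction t with
      | zero => simp
      | tmul a b =>
        simp only [lieTensor_tmul, map_smul, smul_mul_assoc, TensorProduct.smul_tmul',
          smul_add, TensorProduct.tmul_smul]
      | add a b ha hb => simp only [smul_add, map_add, ha, hb] }

@[simp] lemma lieTensorHom_apply (x : L) (t : Env K R L ⊗[R] Env K R L) :
    lieTensorHom K R L x t = lieTensor x t := rfl

lemma lieTensorHom_smul_left (r : R) (x : L) (t : Env K R L ⊗[R] Env K R L) :
    lieTensorHom K R L (r • x) t = r • lieTensorHom K R L x t := by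
  simp only [lieTensorHom_apply]
  induction t with
  | zero => simp
  | tmul a b =>
    simp only [lieTensor_tmul, ← smul_ofLie, smul_mul_assoc, TensorProduct.smul_tmul',
      smul_add, TensorProduct.tmul_smul]
  | add a b ha hb => simp only [smul_add, map_add, ha, hb]

lemma lieTensorHom_smul (x : L) (r : R) (t : Env K R L ⊗[R] Env K R L) :
    lieTensorHom K R L x (r • t) = r • lieTensorHom K R L x t + ⁅x, r⁆ • t :=
  lieTensor_smul x r t

lemma lieTensorHom_flat (x y : L) (t : Env K R L ⊗[R] Env K R L) :
    lieTensorHom K R L x (lieTensorHom K R L y t) =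
      lieTensorHom K R L y (lieTensorHom K R L x t) + lieTensorHom K R L ⁅x, y⁆ t := by
  simp only [lieTensorHom_apply]
  induction t with
  | zero => simp
  | tmul a b =>
    have h : ∀ c : Env K R L, ofLie K x * (ofLie K y * c) =
        ofLie K y * (ofLie K x * c) + ofLie K ⁅x, y⁆ * c := fun c => by
      rw [← mul_assoc, ofLie_mul_ofLie, add_mul, mul_assoc]
    simp only [lieTensor_tmul, map_add, h, TensorProduct.add_tmul, TensorProduct.tmul_add]
    abel
  | add a b ha hb => simp only [map_add, ha, hb]; abel

variable (K R L) in
/-- The action of `U(L, R)` on `U(L, R) ⊗_R U(L, R)` with `x ∈ L` acting by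
`x ⊗ 1 + 1 ⊗ x`. -/
def onTensor : Env K R L →ₐ[K] Module.End K (Env K R L ⊗[R] Env K R L) :=
  act (lieTensorHom K R L) lieTensorHom_smul_left lieTensorHom_smul lieTensorHom_flat

@[simp] lemma onTensor_ofRing (r : R) (t : Env K R L ⊗[R] Env K R L) :
    onTensor K R L (ofRing K r) t = r • t := by simp [onTensor]

@[simp] lemma onTensor_ofLie (x : L) (t : Env K R L ⊗[R] Env K R L) :
    onTensor K R L (ofLie K x) t = lieTensor x t := by
  simp [onTensor]

variable (K R L) in
/-- The coproduct of `U(L, R)`: the map determined by `Δ(1) = 1 ⊗ 1`, `Δ(r D) = r Δ(D)` and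
`Δ(x D) = (x ⊗ 1 + 1 ⊗ x) Δ(D)`. -/
def comul : Env K R L →ₗ[R] Env K R L ⊗[R] Env K R L where
  toFun a := onTensor K R L a (1 ⊗ₜ 1)
  map_add' a b := by simp
  map_smul' r a := by simp [smul_def]

lemma comul_apply (a : Env K R L) : comul K R L a = onTensor K R L a (1 ⊗ₜ 1) := rfl

@[simp] lemma comul_one : comul K R L 1 = 1 ⊗ₜ 1 := by simp [comul_apply]

lemma comul_ofRing (r : R) : comul K R L (ofRing K r) = (ofRing K r) ⊗ₜ 1 := by
  simp [comul_apply, TensorProduct.smul_tmul', smul_def]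

lemma comul_ofLie (x : L) :
    comul K R L (ofLie K x) = (ofLie K x) ⊗ₜ 1 + 1 ⊗ₜ (ofLie K x) := by
  simp [comul_apply]

lemma comul_ofLie_mul (x : L) (a : Env K R L) :
    comul K R L (ofLie K x * a) = lieTensor x (comul K R L a) := by simp [comul_apply]

lemma linear_ext {f g : Env K R L →ₗ[R] M} (T : L → M →+ M) (h1 : f 1 = g 1)
    (hf : ∀ x a, f (ofLie K x * a) = T x (f a)) (hg : ∀ x a, g (ofLie K x * a) = T x (g a)) :
    f = g := by
  ext a
  induction a using induction_left with
  | one => exact h1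
  | add a b ha hb => simp [ha, hb]
  | ring r a ha => rw [← smul_def, map_smul, map_smul, ha]
  | lie x a ha => rw [hf, hg, ha]

instance : Coalgebra R (Env K R L) where
  comul := comul K R L
  counit := counit K R L
  coassoc := by
    refine linear_ext (fun x => tensorDer x (mulLie x) (lieTensor x) (mulLie_smul x)
      (lieTensor_smul x)) (by simp) ?_ ?_
    · intro x a
      simp only [LinearMap.comp_apply, comul_ofLie_mul]
      generalize comul K R L a = t
      induction t with
      | zero => simp
      | tmul b c =>
        simp only [lieTensor_tmul, map_add, LinearMap.rTensor_tmul, comul_ofLie_mul]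
        generalize comul K R L b = s
        induction s with
        | zero => simp
        | tmul d e =>
          simp only [lieTensor_tmul, TensorProduct.add_tmul, map_add, LinearEquiv.coe_coe,
            TensorProduct.assoc_tmul]
          rw [tensorDer_tmul, lieTensor_tmul, TensorProduct.tmul_add, mulLie_apply, add_assoc]
        | add d e hd he =>
          simp only [map_add, TensorProduct.add_tmul] at hd he ⊢
          rw [← hd, ← he]; abel
      | add b c hb hc => simp only [map_add, hb, hc]
    · intro x a
      simp only [LinearMap.comp_apply, comul_ofLie_mul]
      generalize comul K R L a = t
      induction t with
      | zero => simp
      | tmul b c =>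
        simp only [lieTensor_tmul, map_add, LinearMap.lTensor_tmul, comul_ofLie_mul]
        rw [tensorDer_tmul, mulLie_apply]
      | add b c hb hc => simp only [map_add, hb, hc]
  rTensor_counit_comp_comul := by
    refine linear_ext (fun x => tensorDer x (LieModule.toEnd K L R x).toAddMonoidHom (mulLie x)
      (by intro r m; simp [mul_comm]) (mulLie_smul x)) (by simp) ?_ ?_
    · intro x a
      simp only [LinearMap.comp_apply, comul_ofLie_mul]
      generalize comul K R L a = t
      induction t with
      | zero => simp
      | tmul b c =>
        simp only [lieTensor_tmul, map_add, LinearMap.rTensor_tmul, counit_ofLie_mul,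
          tensorDer_tmul, mulLie_apply]
        rfl
      | add b c hb hc => simp only [map_add, hb, hc]
    · intro x a
      simp [lie_one]
  lTensor_counit_comp_comul := by
    refine linear_ext (fun x => tensorDer x (mulLie x) (LieModule.toEnd K L R x).toAddMonoidHom
      (mulLie_smul x) (by intro r m; simp [mul_comm])) (by simp) ?_ ?_
    · intro x a
      simp only [LinearMap.comp_apply, comul_ofLie_mul]
      generalize comul K R L a = t
      induction t with
      | zero => simp
      | tmul b c =>
        simp only [lieTensor_tmul, map_add, LinearMap.lTensor_tmul, counit_ofLie_mul,
          tensorDer_tmul, mulLie_apply]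
        rfl
      | add b c hb hc => simp only [map_add, hb, hc]
    · intro x a
      simp [lie_one]

lemma coalgebra_comul (a : Env K R L) : Coalgebra.comul (R := R) a = comul K R L a := rfl

lemma coalgebra_counit (a : Env K R L) : Coalgebra.counit (R := R) a = counit K R L a := rfl

instance : Coalgebra.IsCocomm R (Env K R L) where
  comm_comp_comul := by
    refine linear_ext (fun x => lieTensor x) (by simp [coalgebra_comul]) ?_ ?_
    · intro x a
      simp only [LinearMap.comp_apply, coalgebra_comul, comul_ofLie_mul]
      generalize comul K R L a = t
      induction t with
      | zero => simp
      | tmul b c =>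
        simp [add_comm]
      | add b c hb hc => simp only [map_add, hb, hc]
    · intro x a
      exact comul_ofLie_mul x a

end tensor

section map

variable {R₁ L₁ R₂ L₂ : Type*} [CommRing R₁] [Algebra K R₁] [LieRing L₁] [LieAlgebra K L₁]
  [Module R₁ L₁] [LieRingModule L₁ R₁] [LieRinehartRing R₁ L₁] [LieRinehartAlgebra K R₁ L₁]
  [CommRing R₂] [Algebra K R₂] [LieRing L₂] [LieAlgebra K L₂]
  [Module R₂ L₂] [LieRingModule L₂ R₂] [LieRinehartRing R₂ L₂] [LieRinehartAlgebra K R₂ L₂]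
  {σ : R₁ →ₐ[K] R₂}

/-- The algebra morphism `U(L₁, R₁) → U(L₂, R₂)` induced by a morphism of Lie-Rinehart algebras. -/
def mapAlg (f : LieRinehartAlgebra.Hom σ L₁ L₂) : Env K R₁ L₁ →ₐ[K] Env K R₂ L₂ :=
  lift (gen K ∘ₗ LinearMap.prodMap σ.toLinearMap (f.toLieHom : L₁ →ₗ[K] L₂))
    (by simp [gen_one])
    (by intro r s x; simp [gen_mul, f.map_smul_apply])
    (by intro x y; simpa using gen_lie K (R := R₂) (f x) (f y))
    (by intro x r; simp [gen_anchor, f.apply_lie])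

@[simp] lemma mapAlg_ofRing (f : LieRinehartAlgebra.Hom σ L₁ L₂) (r : R₁) :
    mapAlg f (ofRing K r) = ofRing K (σ r) := by
  change mapAlg f (gen K (r, 0)) = gen K (σ r, 0)
  simp [mapAlg]

@[simp] lemma mapAlg_ofLie (f : LieRinehartAlgebra.Hom σ L₁ L₂) (x : L₁) :
    mapAlg f (ofLie K x) = ofLie K (f x) := by
  change mapAlg f (gen K (0, x)) = gen K (0, f x)
  simp [mapAlg]

/-- The morphism `U(L₁, R₁) → U(L₂, R₂)` as a semilinear map. -/
def map (f : LieRinehartAlgebra.Hom σ L₁ L₂) :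
    Env K R₁ L₁ →ₛₗ[(σ : R₁ →+* R₂)] Env K R₂ L₂ where
  toFun := mapAlg f
  map_add' a b := map_add _ a b
  map_smul' r a := by simp [smul_def]

lemma map_apply (f : LieRinehartAlgebra.Hom σ L₁ L₂) (a : Env K R₁ L₁) :
    map f a = mapAlg f a := rfl

lemma comul_map (f : LieRinehartAlgebra.Hom σ L₁ L₂) (a : Env K R₁ L₁) :
    Coalgebra.comul (R := R₂) (map f a) =
      TensorProduct.map (map f) (map f) (Coalgebra.comul (R := R₁) a) := by
  simp only [coalgebra_comul, map_apply]
  induction a using induction_left with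
  | one => simp [map_apply]
  | add a b ha hb => simp [ha, hb]
  | ring r a ha =>
    rw [map_mul, mapAlg_ofRing, ← smul_def, ← smul_def, map_smul, ha, map_smul,
      LinearMap.map_smulₛₗ]
    rfl
  | lie x a ha =>
    rw [map_mul, mapAlg_ofLie, comul_ofLie_mul, comul_ofLie_mul, ha]
    generalize comul K R₁ L₁ a = t
    induction t with
    | zero => simp
    | tmul b c => simp [map_apply]
    | add b c hb hc => simp only [_root_.map_add, hb, hc]

lemma counit_map (f : LieRinehartAlgebra.Hom σ L₁ L₂) (a : Env K R₁ L₁) :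
    Coalgebra.counit (R := R₂) (map f a) = σ (Coalgebra.counit (R := R₁) a) := by
  simp only [coalgebra_counit, map_apply]
  induction a using induction_left with
  | one => simp
  | add a b ha hb => simp [ha, hb]
  | ring r a ha =>
    rw [map_mul, mapAlg_ofRing, ← smul_def, ← smul_def, map_smul, ha, map_smul]
    simp
  | lie x a ha =>
    rw [map_mul, mapAlg_ofLie, counit_ofLie_mul, counit_ofLie_mul, ha, f.apply_lie]

end map

end Env
end Enveloping

section Symmetric

variable {R₁ R₂ M₁ M₂ : Type*} [CommRing R₁] [CommRing R₂] [AddCommGroup M₁] [AddCommGroup M₂]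
  [Module R₁ M₁] [Module R₂ M₂] {σ : R₁ →+* R₂}

/-- The ring morphism `Sym_{R₁} M₁ → Sym_{R₂} M₂` induced by a semilinear map `M₁ → M₂`. -/
def symMapRing (f : M₁ →ₛₗ[σ] M₂) : SymmetricAlgebra R₁ M₁ →+* SymmetricAlgebra R₂ M₂ :=
  letI : Algebra R₁ (SymmetricAlgebra R₂ M₂) :=
    ((algebraMap R₂ (SymmetricAlgebra R₂ M₂)).comp σ).toAlgebra
  (SymmetricAlgebra.lift
    { toFun := fun m => SymmetricAlgebra.ι R₂ M₂ (f m)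
      map_add' := fun a b => by simp
      map_smul' := fun r a => by
        rw [LinearMap.map_smulₛₗ, map_smul, Algebra.smul_def, Algebra.smul_def]
        rfl } : SymmetricAlgebra R₁ M₁ →ₐ[R₁] SymmetricAlgebra R₂ M₂).toRingHom

@[simp] lemma symMapRing_ι (f : M₁ →ₛₗ[σ] M₂) (m : M₁) :
    symMapRing f (SymmetricAlgebra.ι R₁ M₁ m) = SymmetricAlgebra.ι R₂ M₂ (f m) := by
  let _ : Algebra R₁ (SymmetricAlgebra R₂ M₂) :=
    ((algebraMap R₂ (SymmetricAlgebra R₂ M₂)).comp σ).toAlgebra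
  exact SymmetricAlgebra.lift_ι_apply _ _

@[simp] lemma symMapRing_algebraMap (f : M₁ →ₛₗ[σ] M₂) (r : R₁) :
    symMapRing f (algebraMap R₁ _ r) = algebraMap R₂ _ (σ r) := by
  let _ : Algebra R₁ (SymmetricAlgebra R₂ M₂) :=
    ((algebraMap R₂ (SymmetricAlgebra R₂ M₂)).comp σ).toAlgebra
  exact AlgHom.commutes _ r

/-- The morphism `Sym_{R₁} M₁ → Sym_{R₂} M₂` as a semilinear map. -/
def symMap (f : M₁ →ₛₗ[σ] M₂) : SymmetricAlgebra R₁ M₁ →ₛₗ[σ] SymmetricAlgebra R₂ M₂ where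
  toFun := symMapRing f
  map_add' a b := map_add _ a b
  map_smul' r a := by
    rw [Algebra.smul_def, map_mul, symMapRing_algebraMap, ← Algebra.smul_def]

lemma symMap_apply (f : M₁ →ₛₗ[σ] M₂) (a : SymmetricAlgebra R₁ M₁) :
    symMap f a = symMapRing f a := rfl

lemma tensor_map_mul (f : M₁ →ₛₗ[σ] M₂)
    (s t : SymmetricAlgebra R₁ M₁ ⊗[R₁] SymmetricAlgebra R₁ M₁) :
    TensorProduct.map (symMap f) (symMap f) (s * t) =
      TensorProduct.map (symMap f) (symMap f) s * TensorProduct.map (symMap f) (symMap f) t := by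
  induction s with
  | zero => simp
  | tmul a b =>
    induction t with
    | zero => simp
    | tmul c d => simp [symMap_apply]
    | add c d hc hd => simp only [mul_add, _root_.map_add, hc, hd]
  | add a b ha hb => simp only [add_mul, _root_.map_add, ha, hb]

lemma comul_symMap (f : M₁ →ₛₗ[σ] M₂) (a : SymmetricAlgebra R₁ M₁) :
    Coalgebra.comul (R := R₂) (symMap f a) =
      TensorProduct.map (symMap f) (symMap f) (Coalgebra.comul (R := R₁) a) := by
  induction a using SymmetricAlgebra.induction with
  | algebraMap r =>
    simp [symMap_apply, Algebra.TensorProduct.algebraMap_apply]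
  | ι x => simp [symMap_apply]
  | mul a b ha hb =>
    rw [Bialgebra.comul_mul, tensor_map_mul, ← ha, ← hb, ← Bialgebra.comul_mul]
    simp [symMap_apply]
  | add a b ha hb => simp [ha, hb]

lemma counit_symMap (f : M₁ →ₛₗ[σ] M₂) (a : SymmetricAlgebra R₁ M₁) :
    Coalgebra.counit (R := R₂) (symMap f a) = σ (Coalgebra.counit (R := R₁) a) := by
  rw [symMap_apply]
  induction a using SymmetricAlgebra.induction with
  | algebraMap r => simp
  | ι x => simp
  | mul a b ha hb => rw [map_mul, Bialgebra.counit_mul, Bialgebra.counit_mul, ha, hb, map_mul]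
  | add a b ha hb => simp [ha, hb]

end Symmetric
section Sheaves

variable {K : Type u} [Field K] {X : TopCat.{u}}

section RingedSpace

variable (O : TopCat.Sheaf (CommAlgCat.{u} K) X)

/-- The `K`-algebra `O(U)` of sections over `U` of a sheaf of commutative `K`-algebras. -/
abbrev Sec (U : Opens X) : Type u := O.presheaf.obj (op U)

variable {U V W : Opens X}

/-- The restriction morphism `O(U) → O(V)`. -/
def res (h : V ≤ U) : Sec O U →ₐ[K] Sec O V := (O.presheaf.map (homOfLE h).op).hom

/-- The restriction morphism `O(U) → O(V)` as a ring morphism. -/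
abbrev resRing (h : V ≤ U) : Sec O U →+* Sec O V := (res O h : Sec O U →+* Sec O V)

@[simp] lemma res_refl (a : Sec O U) : res O le_rfl a = a := by
  change (O.presheaf.map (𝟙 (op U))).hom a = a
  rw [O.presheaf.map_id]; rfl

@[simp] lemma res_res (h : V ≤ U) (h' : W ≤ V) (a : Sec O U) :
    res O h' (res O h a) = res O (h'.trans h) a := by
  change _ = (O.presheaf.map ((homOfLE h).op ≫ (homOfLE h').op)).hom a
  rw [O.presheaf.map_comp]; rfl

/-- A presheaf of cocommutative `O`-coalgebras. -/
structure CoalgPresheaf where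
  obj : Opens X → Type u
  [addCommGroup : ∀ U, AddCommGroup (obj U)]
  [module : ∀ U, Module (Sec O U) (obj U)]
  [coalgebra : ∀ U, Coalgebra (Sec O U) (obj U)]
  [isCocomm : ∀ U, Coalgebra.IsCocomm (Sec O U) (obj U)]
  map : ∀ {U V : Opens X} (h : V ≤ U), obj U →ₛₗ[resRing O h] obj V
  map_refl : ∀ {U : Opens X} (c : obj U), map le_rfl c = c
  map_map : ∀ {U V W : Opens X} (h : V ≤ U) (h' : W ≤ V) (c : obj U),
    map h' (map h c) = map (h'.trans h) c
  comul_map : ∀ {U V : Opens X} (h : V ≤ U) (c : obj U),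
    Coalgebra.comul (R := Sec O V) (map h c) =
      TensorProduct.map (map h) (map h) (Coalgebra.comul (R := Sec O U) c)
  counit_map : ∀ {U V : Opens X} (h : V ≤ U) (c : obj U),
    Coalgebra.counit (R := Sec O V) (map h c) = res O h (Coalgebra.counit (R := Sec O U) c)

attribute [instance] CoalgPresheaf.addCommGroup CoalgPresheaf.module CoalgPresheaf.coalgebra
  CoalgPresheaf.isCocomm

end RingedSpace

namespace CoalgPresheaf

variable {O : TopCat.Sheaf (CommAlgCat.{u} K) X} (C : CoalgPresheaf O) {U V W : Opens X}

/-- The sections over `W` of the sheaf `Hom_O(C, O)`: families of linear maps `C(V) → O(V)`, for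
`V ⊆ W` open, which are compatible with restriction. They form a commutative ring for the product
`(s t)(c) = s(c₁) t(c₂)` dual to the coproduct of `C`, with the counit as unit. (`WithConv` is a
synonym for the module of linear maps, carrying the convolution product.) -/
def dualSubring (W : Opens X) :
    Subring (∀ V : {V : Opens X // V ≤ W}, WithConv (C.obj V.1 →ₗ[Sec O V.1] Sec O V.1)) where
  carrier := {s | ∀ (U V : Opens X) (hU : U ≤ W) (h : V ≤ U) (c : C.obj U),
    s ⟨V, h.trans hU⟩ (C.map h c) = res O h (s ⟨U, hU⟩ c)}
  zero_mem' := by intro U V hU h c; simp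
  one_mem' := by intro U V hU h c; simp [C.counit_map]
  add_mem' := by
    intro s t hs ht U V hU h c
    have h1 := hs U V hU h c
    have h2 := ht U V hU h c
    simp only [Pi.add_apply, WithConv.ofConv_add, LinearMap.add_apply, map_add] at h1 h2 ⊢
    rw [h1, h2]
  neg_mem' := by
    intro s hs U V hU h c
    have h1 := hs U V hU h c
    simp only [Pi.neg_apply, WithConv.ofConv_neg, LinearMap.neg_apply, map_neg] at h1 ⊢
    rw [h1]
  mul_mem' := by
    intro s t hs ht U V hU h c
    simp only [Pi.mul_apply, LinearMap.convMul_apply, C.comul_map]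
    generalize Coalgebra.comul (R := Sec O U) c = x
    induction x with
    | zero => simp
    | tmul a b =>
      simp only [TensorProduct.map_tmul, LinearMap.mul'_apply, map_mul]
      rw [← hs U V hU h a, ← ht U V hU h b]
    | add a b ha hb => simp only [map_add, ha, hb]

/-- The commutative ring of sections over `W` of the sheaf `Hom_O(C, O)`. -/
abbrev Dual (W : Opens X) : Type u := C.dualSubring W

variable {C}

/-- The value `s(c) ∈ O(V)` of a section `s` of `Hom_O(C, O)` over `W` at `c ∈ C(V)`. -/
def Dual.eval (s : C.Dual W) (h : V ≤ W) : C.obj V →ₗ[Sec O V] Sec O V := (s.1 ⟨V, h⟩).ofConv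

lemma Dual.eval_map (s : C.Dual W) (hU : U ≤ W) (h : V ≤ U) (c : C.obj U) :
    s.eval (h.trans hU) (C.map h c) = res O h (s.eval hU c) := s.2 U V hU h c

lemma Dual.ext {s t : C.Dual W}
    (H : ∀ (V : Opens X) (h : V ≤ W) (c : C.obj V), s.eval h c = t.eval h c) : s = t := by
  apply Subtype.ext
  funext V
  apply WithConv.ext
  exact LinearMap.ext (H V.1 V.2)

variable (C)

/-- The restriction morphism of the sheaf `Hom_O(C, O)`. -/
def dualRes (h : V ≤ W) : C.Dual W →+* C.Dual V where
  toFun s := ⟨fun U => s.1 ⟨U.1, U.2.trans h⟩, fun U U' hU h' c => s.2 U U' (hU.trans h) h' c⟩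
  map_one' := rfl
  map_mul' _ _ := rfl
  map_zero' := rfl
  map_add' _ _ := rfl

/-- The structure morphism `O(W) → Hom_O(C, O)(W)`, `r ↦ (c ↦ r ε(c))`. -/
def dualUnit (W : Opens X) : Sec O W →+* C.Dual W where
  toFun r := ⟨fun V => algebraMap (Sec O V.1) _ (res O V.2 r), by
    intro U V hU h c
    simp [C.counit_map]⟩
  map_one' := by ext; simp
  map_mul' _ _ := by ext; simp
  map_zero' := by ext; simp
  map_add' _ _ := by ext; simp

instance (W : Opens X) : Algebra (Sec O W) (C.Dual W) := (C.dualUnit W).toAlgebra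

lemma eval_smul (r : Sec O W) (s : C.Dual W) (h : V ≤ W) (c : C.obj V) :
    (r • s).eval h c = res O h r * s.eval h c := by
  rw [Algebra.smul_def]
  change ((algebraMap (Sec O V) (WithConv (C.obj V →ₗ[Sec O V] Sec O V)) (res O h r)) *
    s.1 ⟨V, h⟩) c = _
  rw [← Algebra.smul_def]
  rfl

end CoalgPresheaf

/-- An `O`-linear isomorphism of sheaves of algebras from `Hom_O(C, O)` to `Hom_O(C', O)`. -/
structure DualIso {O : TopCat.Sheaf (CommAlgCat.{u} K) X} (C C' : CoalgPresheaf O) where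
  equiv : ∀ W : Opens X, C.Dual W ≃ₐ[Sec O W] C'.Dual W
  equiv_res : ∀ {V W : Opens X} (h : V ≤ W) (s : C.Dual W),
    equiv V (C.dualRes h s) = C'.dualRes h (equiv W s)

/-- A Lie algebroid over `(X, O)`: a sheaf `L` such that `(O(U), L(U))` is a Lie-Rinehart algebra
over `K` for every open `U`, whose restriction maps are morphisms of Lie-Rinehart algebras. The
anchor `ρ(x)(a)` is written `⁅x, a⁆`. -/
structure LieAlgebroid (O : TopCat.Sheaf (CommAlgCat.{u} K) X) where
  sheaf : TopCat.Sheaf (Type u) X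
  [lieRing : ∀ U : Opens X, LieRing (sheaf.presheaf.obj (op U))]
  [lieAlgebra : ∀ U : Opens X, LieAlgebra K (sheaf.presheaf.obj (op U))]
  [module : ∀ U : Opens X, Module (Sec O U) (sheaf.presheaf.obj (op U))]
  [lieRingModule : ∀ U : Opens X, LieRingModule (sheaf.presheaf.obj (op U)) (Sec O U)]
  [lieRinehartRing : ∀ U : Opens X, LieRinehartRing (Sec O U) (sheaf.presheaf.obj (op U))]
  [lieRinehartAlgebra : ∀ U : Opens X,
    LieRinehartAlgebra K (Sec O U) (sheaf.presheaf.obj (op U))]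
  map_add : ∀ {U V : Opens X} (h : V ≤ U) (x y : sheaf.presheaf.obj (op U)),
    sheaf.presheaf.map (homOfLE h).op (x + y) =
      sheaf.presheaf.map (homOfLE h).op x + sheaf.presheaf.map (homOfLE h).op y
  map_smul : ∀ {U V : Opens X} (h : V ≤ U) (a : Sec O U) (x : sheaf.presheaf.obj (op U)),
    sheaf.presheaf.map (homOfLE h).op (a • x) =
      res O h a • sheaf.presheaf.map (homOfLE h).op x
  map_lie : ∀ {U V : Opens X} (h : V ≤ U) (x y : sheaf.presheaf.obj (op U)),
    sheaf.presheaf.map (homOfLE h).op ⁅x, y⁆ =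
      ⁅sheaf.presheaf.map (homOfLE h).op x, sheaf.presheaf.map (homOfLE h).op y⁆
  map_anchor : ∀ {U V : Opens X} (h : V ≤ U) (x : sheaf.presheaf.obj (op U)) (a : Sec O U),
    res O h ⁅x, a⁆ = ⁅sheaf.presheaf.map (homOfLE h).op x, res O h a⁆

attribute [instance] LieAlgebroid.lieRing LieAlgebroid.lieAlgebra LieAlgebroid.module
  LieAlgebroid.lieRingModule LieAlgebroid.lieRinehartRing LieAlgebroid.lieRinehartAlgebra

namespace LieAlgebroid

variable {O : TopCat.Sheaf (CommAlgCat.{u} K) X} (L : LieAlgebroid O) {U V W : Opens X}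

/-- The Lie-Rinehart algebra `L(U)` of sections over `U`. -/
abbrev Obj (U : Opens X) : Type u := L.sheaf.presheaf.obj (op U)

/-- The restriction `L(U) → L(V)`, a morphism of Lie-Rinehart algebras. -/
def restrict (h : V ≤ U) : LieRinehartAlgebra.Hom (res O h) (L.Obj U) (L.Obj V) where
  toFun x := L.sheaf.presheaf.map (homOfLE h).op x
  map_add' := L.map_add h
  map_smul' k x := by
    have H := L.map_smul h (algebraMap K (Sec O U) k) x
    simpa [algebraMap_smul] using H
  map_lie' := L.map_lie h _ _
  map_smul_apply' := L.map_smul h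
  apply_lie' a x := L.map_anchor h x a

/-- The restriction `L(U) → L(V)` as a semilinear map. -/
def restrictₛₗ (h : V ≤ U) : L.Obj U →ₛₗ[resRing O h] L.Obj V where
  toFun := L.restrict h
  map_add' := L.map_add h
  map_smul' := L.map_smul h

@[simp] lemma restrictₛₗ_apply (h : V ≤ U) (x : L.Obj U) :
    L.restrictₛₗ h x = L.restrict h x := rfl

@[simp] lemma restrict_refl (x : L.Obj U) : L.restrict le_rfl x = x := by
  change L.sheaf.presheaf.map (𝟙 (op U)) x = x
  rw [L.sheaf.presheaf.map_id]; rfl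

@[simp] lemma restrict_restrict (h : V ≤ U) (h' : W ≤ V) (x : L.Obj U) :
    L.restrict h' (L.restrict h x) = L.restrict (h'.trans h) x := by
  change _ = L.sheaf.presheaf.map ((homOfLE h).op ≫ (homOfLE h').op) x
  rw [L.sheaf.presheaf.map_comp]; rfl

/-- `L` is locally free of constant rank `r`: every point has an open neighbourhood `U` with
sections `e₁, …, e_r ∈ L(U)` whose restrictions to every open `V ⊆ U` form a basis of `L(V)`. -/
def IsLocallyFreeOfRank (r : ℕ) : Prop :=
  ∀ p : X, ∃ U : Opens X, p ∈ U ∧ ∃ e : Fin r → L.Obj U, ∀ (V : Opens X) (h : V ≤ U),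
    LinearIndependent (Sec O V) (fun i => L.restrict h (e i)) ∧
      Submodule.span (Sec O V) (Set.range fun i => L.restrict h (e i)) = ⊤

/-- The presheaf `U ↦ U(L(U), O(U))` of universal enveloping algebras, as a presheaf of
coalgebras. -/
abbrev envCoalg : CoalgPresheaf O where
  obj U := Env K (Sec O U) (L.Obj U)
  map h := Env.map (L.restrict h)
  map_refl c := by
    rw [Env.map_apply]
    induction c using Env.induction_left with
    | one => simp
    | add a b ha hb => simp only [_root_.map_add, ha, hb]
    | ring r a ha => simp only [map_mul, Env.mapAlg_ofRing, res_refl, ha]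
    | lie x a ha => simp only [map_mul, Env.mapAlg_ofLie, restrict_refl, ha]
  map_map h h' c := by
    simp only [Env.map_apply]
    induction c using Env.induction_left with
    | one => simp
    | add a b ha hb => simp only [_root_.map_add, ha, hb]
    | ring r a ha => simp only [map_mul, Env.mapAlg_ofRing, res_res, ha]
    | lie x a ha => simp only [map_mul, Env.mapAlg_ofLie, restrict_restrict, ha]
  comul_map h c := Env.comul_map (L.restrict h) c
  counit_map h c := Env.counit_map (L.restrict h) c

/-- The presheaf `U ↦ Sym_{O(U)} L(U)` of symmetric algebras, as a presheaf of coalgebras. -/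
abbrev symCoalg : CoalgPresheaf O where
  obj U := SymmetricAlgebra (Sec O U) (L.Obj U)
  map h := symMap (L.restrictₛₗ h)
  map_refl c := by
    rw [symMap_apply]
    induction c using SymmetricAlgebra.induction with
    | algebraMap r => simp
    | ι x => simp
    | add a b ha hb => simp only [_root_.map_add, ha, hb]
    | mul a b ha hb => simp only [map_mul, ha, hb]
  map_map h h' c := by
    simp only [symMap_apply]
    induction c using SymmetricAlgebra.induction with
    | algebraMap r => simp
    | ι x => simp
    | add a b ha hb => simp only [_root_.map_add, ha, hb]
    | mul a b ha hb => simp only [map_mul, ha, hb]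
  comul_map h c := comul_symMap (L.restrictₛₗ h) c
  counit_map h c := counit_symMap (L.restrictₛₗ h) c

/-- The sections over `W` of the jet algebra `J(L) = Hom_O(U(L), O)`. -/
abbrev Jet (W : Opens X) : Type u := L.envCoalg.Dual W

/-- The sections over `W` of the completed symmetric algebra `Ŝym(L^∨) = Hom_O(Sym L, O)`. -/
abbrev SymHat (W : Opens X) : Type u := L.symCoalg.Dual W

/-- The value `φ(D) ∈ O(V)` of a jet `φ ∈ J(L)(W)` at `D ∈ U(L(V), O(V))`. -/
def jetEval (φ : L.Jet W) (h : V ≤ W) : Env K (Sec O V) (L.Obj V) →ₗ[Sec O V] Sec O V :=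
  CoalgPresheaf.Dual.eval φ h

/-- The value `s(c) ∈ O(V)` of `s ∈ Ŝym(L^∨)(W)` at `c ∈ Sym_{O(V)} L(V)`. -/
def symEval (s : L.SymHat W) (h : V ≤ W) :
    SymmetricAlgebra (Sec O V) (L.Obj V) →ₗ[Sec O V] Sec O V :=
  CoalgPresheaf.Dual.eval s h

section Forms

/-- The sections over `W` of `L^∨ = Hom_O(L, O)`. -/
def formSubgroup (W : Opens X) :
    AddSubgroup (∀ V : {V : Opens X // V ≤ W}, L.Obj V.1 →ₗ[Sec O V.1] Sec O V.1) where
  carrier := {α | ∀ (U V : Opens X) (hU : U ≤ W) (h : V ≤ U) (x : L.Obj U),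
    α ⟨V, h.trans hU⟩ (L.restrict h x) = res O h (α ⟨U, hU⟩ x)}
  zero_mem' := by intro U V hU h x; simp
  add_mem' := by
    intro α β hα hβ U V hU h x
    simp only [Pi.add_apply, LinearMap.add_apply, _root_.map_add, hα U V hU h x, hβ U V hU h x]
  neg_mem' := by
    intro α hα U V hU h x
    simp only [Pi.neg_apply, LinearMap.neg_apply, map_neg, hα U V hU h x]

/-- The sections over `W` of `L^∨ = Hom_O(L, O)`. -/
abbrev Form (W : Opens X) : Type u := L.formSubgroup W

instance (W : Opens X) : Module (Sec O W) (L.Form W) where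
  smul r α := ⟨fun V => res O V.2 r • α.1 V, by
    intro U V hU h x
    have H := α.2 U V hU h x
    simp only [LinearMap.smul_apply, smul_eq_mul, map_mul, res_res, H]⟩
  one_smul α := by
    apply Subtype.ext; funext V; change res O V.2 1 • α.1 V = α.1 V; simp
  mul_smul r s α := by
    apply Subtype.ext; funext V
    change res O V.2 (r * s) • α.1 V = res O V.2 r • res O V.2 s • α.1 V
    rw [map_mul, mul_smul]
  smul_zero r := by
    apply Subtype.ext; funext V; exact smul_zero (res O V.2 r)
  smul_add r α β := by
    apply Subtype.ext; funext V; exact smul_add (res O V.2 r) (α.1 V) (β.1 V)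
  add_smul r s α := by
    apply Subtype.ext; funext V
    change res O V.2 (r + s) • α.1 V = res O V.2 r • α.1 V + res O V.2 s • α.1 V
    rw [_root_.map_add, add_smul]
  zero_smul α := by
    apply Subtype.ext; funext V; change res O V.2 0 • α.1 V = 0; simp

/-- The restriction `L^∨(W) → L^∨(V)`. -/
def formRes (h : V ≤ W) : L.Form W →ₛₗ[resRing O h] L.Form V where
  toFun α := ⟨fun U => α.1 ⟨U.1, U.2.trans h⟩, fun U U' hU h' x => α.2 U U' (hU.trans h) h' x⟩
  map_add' _ _ := rfl
  map_smul' r α := by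
    apply Subtype.ext; funext U
    change res O (U.2.trans h) r • _ = res O U.2 (res O h r) • _
    rw [res_res]

end Forms

section Linear

variable {R M : Type*} [CommRing R] [AddCommGroup M] [Module R M]

/-- A linear form on `M`, extended to `Sym M` by zero in all degrees other than one. -/
def linExt (α : M →ₗ[R] R) : SymmetricAlgebra R M →ₗ[R] R :=
  TrivSqZeroExt.sndHom R R ∘ₗ
    (SymmetricAlgebra.lift (TrivSqZeroExt.inrHom R R ∘ₗ α) :
      SymmetricAlgebra R M →ₐ[R] TrivSqZeroExt R R).toLinearMap

lemma linExt_algebraMap (α : M →ₗ[R] R) (r : R) : linExt α (algebraMap R _ r) = 0 := by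
  simp [linExt, TrivSqZeroExt.algebraMap_eq_inl]

lemma linExt_ι (α : M →ₗ[R] R) (x : M) : linExt α (SymmetricAlgebra.ι R M x) = α x := by
  simp [linExt]

lemma linExt_mul (α : M →ₗ[R] R) (a b : SymmetricAlgebra R M) :
    linExt α (a * b) =
      Coalgebra.counit (R := R) a * linExt α b + Coalgebra.counit (R := R) b * linExt α a := by
  have h : ∀ c : SymmetricAlgebra R M,
      (SymmetricAlgebra.lift (TrivSqZeroExt.inrHom R R ∘ₗ α) c).fst =
        Coalgebra.counit (R := R) c := by
    intro c
    induction c using SymmetricAlgebra.induction with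
    | algebraMap r => simp [TrivSqZeroExt.algebraMap_eq_inl]
    | ι x => simp
    | add a b ha hb => simp [ha, hb]
    | mul a b ha hb => simp [ha, hb]
  simp [linExt, h, mul_comm]

end Linear

/-- The inclusion `L^∨ → Ŝym(L^∨)` of linear forms. -/
def linear (W : Opens X) : L.Form W →ₗ[Sec O W] L.SymHat W where
  toFun α := ⟨fun V => WithConv.toConv (linExt (α.1 V)), by
    intro U V hU h c
    change linExt _ (symMapRing (L.restrictₛₗ h) c) = res O h (linExt _ c)
    have hα := α.2 U V hU h
    induction c using SymmetricAlgebra.induction with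
    | algebraMap r => simp [linExt_algebraMap]
    | ι x => simp [linExt_ι, hα]
    | add a b ha hb => simp only [_root_.map_add, ha, hb]
    | mul a b ha hb =>
      have hc : ∀ c, Coalgebra.counit (R := Sec O V) (symMapRing (L.restrictₛₗ h) c) =
        res O h (Coalgebra.counit (R := Sec O U) c) := counit_symMap (L.restrictₛₗ h)
      simp only [map_mul, linExt_mul, _root_.map_add, ha, hb, hc]⟩
  map_add' α β := by
    apply CoalgPresheaf.Dual.ext
    intro V h c
    change linExt (α.1 ⟨V, h⟩ + β.1 ⟨V, h⟩) c = linExt (α.1 ⟨V, h⟩) c + linExt (β.1 ⟨V, h⟩) c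
    induction c using SymmetricAlgebra.induction with
    | algebraMap r => simp [linExt_algebraMap]
    | ι x => simp [linExt_ι]
    | add a b ha hb => simp only [_root_.map_add, ha, hb]; ring
    | mul a b ha hb => simp only [linExt_mul, ha, hb]; ring
  map_smul' r α := by
    apply CoalgPresheaf.Dual.ext
    intro V h c
    rw [RingHom.id_apply, CoalgPresheaf.eval_smul]
    change linExt (res O h r • α.1 ⟨V, h⟩) c = res O h r * linExt (α.1 ⟨V, h⟩) c
    induction c using SymmetricAlgebra.induction with
    | algebraMap r => simp [linExt_algebraMap]
    | ι x => simp [linExt_ι]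
    | add a b ha hb => simp only [_root_.map_add, ha, hb]; ring
    | mul a b ha hb => simp only [linExt_mul, ha, hb]; ring

/-- The canonical algebra morphism `Sym_{O(W)}(L^∨(W)) → Ŝym(L^∨)(W)`, which sends a product
`α₁ ⋯ α_n` of linear forms to the functional `x₁ ⋯ x_n ↦ ∑_σ ∏ α_i(x_σ(i))` on `Sym^n L`. -/
def symToHat (W : Opens X) : SymmetricAlgebra (Sec O W) (L.Form W) →ₐ[Sec O W] L.SymHat W :=
  SymmetricAlgebra.lift (L.linear W)

/-- The homogeneous part of degree `n` of a symmetric algebra. -/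
def symDegree (R M : Type*) [CommRing R] [AddCommGroup M] [Module R M] (n : ℕ) :
    Submodule R (SymmetricAlgebra R M) :=
  Submodule.span R (Set.range fun x : Fin n → M => ∏ i, SymmetricAlgebra.ι R M (x i))

/-- `Ŝym(L^∨) = Hom_O(Sym L, O)` is the completion with respect to the degree of the sheaf of
symmetric algebras of `L^∨`: the canonical morphism from the presheaf `W ↦ Sym_{O(W)}(L^∨(W))` is
locally injective, and in every degree `n` a section of `Ŝym(L^∨)` comes locally from
`Sym^n(L^∨)`. -/
def SymHatIsCompletion : Prop :=
  (∀ (W : Opens X) (q : SymmetricAlgebra (Sec O W) (L.Form W)), L.symToHat W q = 0 →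
    ∀ p ∈ W, ∃ (V : Opens X) (h : V ≤ W), p ∈ V ∧ symMapRing (L.formRes h) q = 0) ∧
  (∀ (W : Opens X) (s : L.SymHat W) (n : ℕ), ∀ p ∈ W, ∃ (V : Opens X) (h : V ≤ W), p ∈ V ∧
    ∃ q ∈ symDegree (Sec O V) (L.Form V) n, ∀ x : Fin n → L.Obj V,
      L.symEval (L.symToHat V q) le_rfl (∏ i, SymmetricAlgebra.ι _ _ (x i)) =
        L.symEval s h (∏ i, SymmetricAlgebra.ι _ _ (x i)))

/-- An `L`-connection on `L`. -/
@[ext]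
structure Connection where
  nabla : ∀ U : Opens X, L.Obj U →ₗ[Sec O U] (L.Obj U →ₗ[K] L.Obj U)
  leibniz : ∀ (U : Opens X) (x : L.Obj U) (a : Sec O U) (y : L.Obj U),
    nabla U x (a • y) = a • nabla U x y + ⁅x, a⁆ • y
  nabla_restrict : ∀ {U V : Opens X} (h : V ≤ U) (x y : L.Obj U),
    nabla V (L.restrict h x) (L.restrict h y) = L.restrict h (nabla U x y)

/-- The flat connection `∇⁽²⁾` on `J(L)`: `(∇⁽²⁾_x φ)(D) = φ(D x)`. -/
def nablaTwo (x : L.Obj W) (φ : L.Jet W) : L.Jet W :=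
  ⟨fun V => WithConv.toConv
    { toFun := fun D => L.jetEval φ V.2 (D * Env.ofLie K (L.restrict V.2 x))
      map_add' := fun D E => by
        rw [add_mul, _root_.map_add]
      map_smul' := fun r D => by
        rw [smul_mul_assoc, _root_.map_smul]; rfl }, by
    intro U V hU h D
    have H := φ.eval_map hU h
      (D * Env.ofLie K (L.restrict hU x) : Env K (Sec O U) (L.Obj U))
    change φ.eval _ (Env.mapAlg (L.restrict h) (D * Env.ofLie K (L.restrict hU x))) = _ at H
    rw [map_mul, Env.mapAlg_ofLie, restrict_restrict] at H
    exact H⟩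

variable {L}

namespace Connection

variable (nab : L.Connection)

/-- The operator `D` on `J(L) ⊗ Ŝym(L^∨)` obtained by symmetrizing the connection
`∇⁽²⁾ ⊗ 1 + 1 ⊗ ∇`. An element of degree `n` is regarded as a map
`(x₁, …, x_n) ↦ ψ(x₁ ⋯ x_n) ∈ J(L)`, and
`(D ψ)(x₀, …, x_n) = ∑_i ((∇⁽²⁾ ⊗ 1 + 1 ⊗ ∇)_{x_i} ψ)(x₀, …, x̂_i, …, x_n)`. -/
def symD {n : ℕ} (ψ : (Fin n → L.Obj W) → L.Jet W) (x : Fin (n + 1) → L.Obj W) : L.Jet W :=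
  ∑ i : Fin (n + 1),
    (L.nablaTwo (x i) (ψ fun j => x (i.succAbove j)) -
      ∑ j : Fin n, ψ (Function.update (fun j => x (i.succAbove j)) j
        (nab.nabla W (x i) (x (i.succAbove j)))))

/-- `D^n φ`, of degree `n`. -/
def iterD (φ : L.Jet W) : (n : ℕ) → (Fin n → L.Obj W) → L.Jet W
  | 0 => fun _ => φ
  | n + 1 => nab.symD (iterD φ n)

/-- The value on `x₁ ⋯ x_n ∈ Sym^n L(W)` of `∑_n (D^n φ / n!)(1)`. -/
def pbwCoeff (φ : L.Jet W) (n : ℕ) (x : Fin n → L.Obj W) : Sec O W :=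
  ((n.factorial : K)⁻¹) • L.jetEval (nab.iterD φ n x) le_rfl 1

end Connection

end LieAlgebroid

end Sheaves

end LieAlgebroidPBW

end

/-!
Write `R` for a ring of sections of `O` and `L` for the Lie-Rinehart algebra of sections of the Lie
algebroid over the same open set. A connection `∇` on `L` determines a map of coalgebras
`pbw : Sym L → U(L)`, and the isomorphism `j` of jets with the completed symmetric algebra is its
transpose. Everything rests on a Poincaré-Birkhoff-Witt theorem for `pbw`.

**The map.** Let `M` be an `R`-module with an `L`-connection `τ`. A linear map `f : Sym L → M` is
adapted (`ModuleConnection.IsAdapted`) if `(n + 1) f(xⁿ⁺¹) = (n + 1) (τ_x f(xⁿ) - f(∇_x xⁿ))`, in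
polarized form. Since positive integers are invertible, there is exactly one adapted map with a given
value at `1`. For `M = U(L)` with left multiplication this is `pbw`, and its recursion is the one for
`Dⁿ φ` (`LieAlgebroid.jetEval_iterD`), which gives the formula for `j`. Composites of adapted maps
with horizontal maps are adapted, and so is the tensor product of two adapted maps after the coproduct
of `Sym L`; hence uniqueness shows that `pbw` preserves coproducts and counits
(`ModuleConnection.comul_pbw`, `ModuleConnection.counit_pbw`).

**Surjectivity** holds over every open set: up to terms of lower degree, `pbw(x s)` is `x pbw(s)`
(`ModuleConnection.mul_pbw_sub_mem`).

**Injectivity** is proved for `L` free with basis `e_1, …, e_r`, by an action of `U(L)` on power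
series `R[[t_1, …, t_r]]` whose symbol is the one of constant coefficient operators. Vector fields
`E_j = e_j + ∂_j + (terms of higher order)`, where `e_j` acts on the coefficients through the anchor,
are constructed by solving the radial part of the equation `[E_i, E_j] = ∑ c_{ij}^l E_l` order by
order (`exists_radialGauge`). The full equation follows: the Bianchi identity contracted with the
coordinates shows that the lowest order term of the curvature is killed by the Euler derivation plus
`2` (`RadialGauge.w_eq_zero`). So `U(L)` acts, and the top degree part of an element of the kernel of
`pbw` pairs to zero with all power series (`ModuleConnection.pbw_injective`).

**Sheaves.** The kernel of `pbw` over an open set is locally zero, and functionals have values in a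
sheaf, so the transpose of `pbw` is bijective on functionals (`ConnectionOn.toHat_bijective`). It is
multiplicative because `pbw` is a map of coalgebras. Over a frame, `Hom(Sym L, O)` is the algebra of
power series in the dual linear forms, by division by the factorials; the symmetric algebra of `L^∨`
is the subalgebra of polynomials (`LieAlgebroid.symHatIsCompletion`).

**The converse.** Given an isomorphism `j`, the jets `j⁻¹(ε_i)` of the linear forms dual to a frame
must be shown to restrict to coordinates on `L`; then `∇_x y` is the section with the same coordinates
as `x y`. Note that `j` need not preserve the augmentations. But evaluation of jets at `1` carries
series without constant term into the Jacobson radical of `R`, as `1 + f` is invertible for such a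
series `f`. Modulo this radical, the chain rule makes the Jacobian of `(j⁻¹(ε_i))` against a frame
invertible, hence it is invertible (`isUnit_jacobian`). The local sections `∇_x y` glue by uniqueness,
and the Leibniz identity comes from `x a = a x + x(a)` in `U(L)`.
-/


noncomputable section

namespace LieAlgebroidPBW

/-! ### Derivations and polarization on the symmetric algebra -/

section SymmetricDerivation

variable {R M N : Type*} [CommRing R] [AddCommGroup M] [Module R M] [AddCommGroup N]
  [Module (SymmetricAlgebra R M) N]

/-- A derivation `d₀` of `R` with values in a `Sym M`-module `N`, together with an additive map
`f : M → N` which is semilinear over it, extends to a derivation `Sym M → N`. It is the second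
component of a ring morphism from `Sym M` to the square zero extension of `Sym M` by `N`. -/
lemma exists_symDer (d₀ : R →+ N)
    (h₀ : ∀ r s, d₀ (r * s) = algebraMap R (SymmetricAlgebra R M) r • d₀ s +
      algebraMap R (SymmetricAlgebra R M) s • d₀ r)
    (f : M →+ N)
    (hf : ∀ r x, f (r • x) = algebraMap R (SymmetricAlgebra R M) r • f x +
      SymmetricAlgebra.ι R M x • d₀ r) :
    ∃ D : SymmetricAlgebra R M →+ N, (∀ r, D (algebraMap R _ r) = d₀ r) ∧
      (∀ x, D (SymmetricAlgebra.ι R M x) = f x) ∧ ∀ a b, D (a * b) = a • D b + b • D a := by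
  let _ : Module (SymmetricAlgebra R M)ᵐᵒᵖ N :=
    Module.compHom N (RingEquiv.toOpposite (SymmetricAlgebra R M)).symm.toRingHom
  have _ : IsCentralScalar (SymmetricAlgebra R M) N := ⟨fun _ _ => rfl⟩
  have h_one : d₀ 1 = 0 := by simpa using h₀ 1 1
  let _ : Algebra R (TrivSqZeroExt (SymmetricAlgebra R M) N) := RingHom.toAlgebra
    (show R →+* TrivSqZeroExt (SymmetricAlgebra R M) N from
    { toFun := fun r => TrivSqZeroExt.inl (algebraMap R _ r) + TrivSqZeroExt.inr (d₀ r)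
      map_one' := by simp [h_one]
      map_mul' := fun r s => by
        ext <;> simp [h₀]
      map_zero' := by simp
      map_add' := fun r s => by
        ext <;> simp })
  let F : SymmetricAlgebra R M →ₐ[R] TrivSqZeroExt (SymmetricAlgebra R M) N :=
    SymmetricAlgebra.lift
      { toFun := fun x => TrivSqZeroExt.inl (SymmetricAlgebra.ι R M x) + TrivSqZeroExt.inr (f x)
        map_add' := fun x y => by ext <;> simp
        map_smul' := fun r x => by
          rw [Algebra.smul_def]
          change _ = (TrivSqZeroExt.inl (algebraMap R (SymmetricAlgebra R M) r) +
            TrivSqZeroExt.inr (d₀ r)) * (_ : TrivSqZeroExt (SymmetricAlgebra R M) N)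
          ext
          · simp [Algebra.smul_def]
          · simp [hf] }
  have F_ι : ∀ x, F (SymmetricAlgebra.ι R M x) =
      TrivSqZeroExt.inl (SymmetricAlgebra.ι R M x) + TrivSqZeroExt.inr (f x) :=
    SymmetricAlgebra.lift_ι_apply _
  have F_alg : ∀ r, F (algebraMap R _ r) =
      TrivSqZeroExt.inl (algebraMap R _ r) + TrivSqZeroExt.inr (d₀ r) := fun r => F.commutes r
  have F_fst : ∀ a, (F a).fst = a := by
    intro a
    induction a using SymmetricAlgebra.induction with
    | algebraMap r => simp [F_alg]
    | ι x => simp [F_ι]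
    | add a b ha hb => simp [ha, hb]
    | mul a b ha hb => simp [ha, hb]
  refine ⟨{ toFun := fun a => (F a).snd, map_zero' := by simp, map_add' := by simp },
    fun r => by simp [F_alg], fun x => by simp [F_ι], fun a b => ?_⟩
  simp [F_fst]

end SymmetricDerivation

section Polarization

variable (R M : Type*) [CommRing R] [AddCommGroup M] [Module R M]

/-- Existence of the polarization, as a derivation which vanishes on scalars. -/
lemma exists_polar : ∃ D : SymmetricAlgebra R M →+ SymmetricAlgebra R M ⊗[R] M,
    (∀ r, D (algebraMap R _ r) = 0) ∧ (∀ x, D (SymmetricAlgebra.ι R M x) = 1 ⊗ₜ x) ∧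
      ∀ a b, D (a * b) = a • D b + b • D a :=
  exists_symDer (N := SymmetricAlgebra R M ⊗[R] M) 0 (by simp)
    (TensorProduct.mk R (SymmetricAlgebra R M) M 1).toAddMonoidHom (by simp)

/-- The polarization `Sym M → Sym M ⊗ M`, the derivation with `x ↦ 1 ⊗ x`. It sends a product
`x₁ ⋯ x_n` to `∑ x₁ ⋯ x̂_i ⋯ x_n ⊗ x_i`. -/
def polar : SymmetricAlgebra R M →ₗ[R] SymmetricAlgebra R M ⊗[R] M :=
  { (exists_polar R M).choose with
    map_smul' := fun r a => by
      obtain ⟨h1, -, h3⟩ := (exists_polar R M).choose_spec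
      change (exists_polar R M).choose (r • a) = r • (exists_polar R M).choose a
      rw [Algebra.smul_def, h3, h1]
      simp }

variable {R M}

@[simp] lemma polar_algebraMap (r : R) : polar R M (algebraMap R _ r) = 0 :=
  (exists_polar R M).choose_spec.1 r

@[simp] lemma polar_one : polar R M 1 = 0 := by
  simpa using polar_algebraMap (M := M) (1 : R)

@[simp] lemma polar_ι (x : M) : polar R M (SymmetricAlgebra.ι R M x) = 1 ⊗ₜ x :=
  (exists_polar R M).choose_spec.2.1 x

lemma polar_mul (a b : SymmetricAlgebra R M) :
    polar R M (a * b) = a • polar R M b + b • polar R M a :=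
  (exists_polar R M).choose_spec.2.2 a b

variable (R M) in
/-- The multiplication `Sym M ⊗ M → Sym M`. -/
def symMul : SymmetricAlgebra R M ⊗[R] M →ₗ[R] SymmetricAlgebra R M :=
  TensorProduct.lift (LinearMap.compl₂ (LinearMap.mul R _) (SymmetricAlgebra.ι R M))

@[simp] lemma symMul_tmul (a : SymmetricAlgebra R M) (x : M) :
    symMul R M (a ⊗ₜ x) = a * SymmetricAlgebra.ι R M x := rfl

lemma symMul_smul (a : SymmetricAlgebra R M) (t : SymmetricAlgebra R M ⊗[R] M) :
    symMul R M (a • t) = a * symMul R M t := by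
  induction t with
  | zero => simp
  | tmul b x => simp [TensorProduct.smul_tmul', mul_assoc]
  | add s t hs ht => simp only [smul_add, map_add, hs, ht, mul_add]

variable (R M) in
/-- The homogeneous part of degree `n` of the symmetric algebra, as the `n`-th power of the
submodule of generators. -/
def symPart (n : ℕ) : Submodule R (SymmetricAlgebra R M) :=
  (LinearMap.range (SymmetricAlgebra.ι R M)) ^ n

lemma one_mem_symPart : (1 : SymmetricAlgebra R M) ∈ symPart R M 0 := by
  rw [symPart, pow_zero]; exact Submodule.one_le.mp le_rfl

lemma ι_mul_mem_symPart (x : M) {n : ℕ} {a : SymmetricAlgebra R M} (ha : a ∈ symPart R M n) :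
    SymmetricAlgebra.ι R M x * a ∈ symPart R M (n + 1) := by
  rw [symPart, pow_succ']
  exact Submodule.mul_mem_mul (LinearMap.mem_range_self _ x) ha

lemma mul_mem_symPart {m n : ℕ} {a b : SymmetricAlgebra R M} (ha : a ∈ symPart R M m)
    (hb : b ∈ symPart R M n) : a * b ∈ symPart R M (m + n) := by
  rw [symPart, pow_add]
  exact Submodule.mul_mem_mul ha hb

lemma symPart_induction {p : ℕ → SymmetricAlgebra R M → Prop}
    (one : p 0 1) (smul : ∀ n (r : R) a, p n a → p n (r • a))
    (add : ∀ n a b, p n a → p n b → p n (a + b))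
    (mul : ∀ n x a, a ∈ symPart R M n → p n a → p (n + 1) (SymmetricAlgebra.ι R M x * a))
    {n : ℕ} {a : SymmetricAlgebra R M} (ha : a ∈ symPart R M n) : p n a := by
  induction n generalizing a with
  | zero =>
    rw [symPart, pow_zero] at ha
    obtain ⟨r, rfl⟩ := Submodule.mem_one.mp ha
    rw [Algebra.algebraMap_eq_smul_one]
    exact smul 0 r 1 one
  | succ n ih =>
    rw [symPart, pow_succ'] at ha
    induction ha using Submodule.mul_induction_on' with
    | mem_mul_mem y hy b hb =>
      obtain ⟨x, rfl⟩ := hy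
      exact mul n x b hb (ih hb)
    | add b _ c _ hb hc => exact add _ _ _ hb hc

/-- The homogeneous parts span the symmetric algebra. -/
lemma sym_induction {p : SymmetricAlgebra R M → Prop}
    (part : ∀ n, ∀ a ∈ symPart R M n, p a) (add : ∀ a b, p a → p b → p (a + b))
    (a : SymmetricAlgebra R M) : p a := by
  have H : ∀ a, a ∈ ⨆ n, symPart R M n := by
    intro a
    induction a using SymmetricAlgebra.induction with
    | algebraMap r =>
      rw [Algebra.algebraMap_eq_smul_one]
      exact Submodule.smul_mem _ _ (Submodule.mem_iSup_of_mem 0 one_mem_symPart)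
    | ι x =>
      refine Submodule.mem_iSup_of_mem 1 ?_
      simpa using ι_mul_mem_symPart x (one_mem_symPart (R := R))
    | add a b ha hb => exact add_mem ha hb
    | mul a b ha hb =>
      induction ha using Submodule.iSup_induction' with
      | mem m a ha =>
        induction hb using Submodule.iSup_induction' with
        | mem n b hb => exact Submodule.mem_iSup_of_mem _ (mul_mem_symPart ha hb)
        | zero => simp
        | add b c _ _ hb hc => rw [mul_add]; exact add_mem hb hc
      | zero => simp
      | add b c _ _ hb hc => rw [add_mul]; exact add_mem hb hc
  induction H a using Submodule.iSup_induction' with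
  | mem n a ha => exact part n a ha
  | zero => exact part 0 0 (zero_mem _)
  | add a b _ _ ha hb => exact add _ _ ha hb

/-- A linear map on `Sym M ⊗ M` which vanishes on `Sym^n M ⊗ M` kills the polarization of
`Sym^{n+1} M`. -/
lemma polar_ext {N : Type*} [AddCommGroup N] (f g : SymmetricAlgebra R M ⊗[R] M →+ N) {n : ℕ}
    (h : ∀ s ∈ symPart R M n, ∀ x : M, f (s ⊗ₜ x) = g (s ⊗ₜ x)) {a : SymmetricAlgebra R M}
    (ha : a ∈ symPart R M (n + 1)) : f (polar R M a) = g (polar R M a) := by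
  suffices H : polar R M a ∈ AddSubgroup.closure
      {t : SymmetricAlgebra R M ⊗[R] M | ∃ s ∈ symPart R M n, ∃ x, t = s ⊗ₜ x} by
    generalize polar R M a = t at H
    induction H using AddSubgroup.closure_induction with
    | mem t ht => obtain ⟨s, hs, x, rfl⟩ := ht; exact h s hs x
    | zero => simp
    | add s t _ _ hs ht => rw [map_add, map_add, hs, ht]
    | neg s _ hs => rw [map_neg, map_neg, hs]
  have key : ∀ {m : ℕ} {a : SymmetricAlgebra R M}, a ∈ symPart R M m → ∀ n, m = n + 1 →
      polar R M a ∈ AddSubgroup.closure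
        {t : SymmetricAlgebra R M ⊗[R] M | ∃ s ∈ symPart R M n, ∃ x, t = s ⊗ₜ x} := by
    intro m a ha
    refine symPart_induction (p := fun m a => ∀ n, m = n + 1 → polar R M a ∈ AddSubgroup.closure
        {t : SymmetricAlgebra R M ⊗[R] M | ∃ s ∈ symPart R M n, ∃ x, t = s ⊗ₜ x})
      ?_ ?_ ?_ ?_ ha
    · intro n hn; omega
    · intro m r a ha n hn
      rw [map_smul]
      have := ha n hn
      generalize polar R M a = t at this
      induction this using AddSubgroup.closure_induction with
      | mem t ht =>
        obtain ⟨s, hs, x, rfl⟩ := ht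
        exact AddSubgroup.subset_closure ⟨r • s, Submodule.smul_mem _ _ hs, x, rfl⟩
      | zero => simp
      | add s t _ _ hs ht => rw [smul_add]; exact add_mem hs ht
      | neg s _ hs => rw [smul_neg]; exact neg_mem hs
    · intro m a b ha hb n hn; rw [map_add]; exact add_mem (ha n hn) (hb n hn)
    · intro m x a ha ih n hn
      obtain rfl : n = m := by omega
      rw [polar_mul, polar_ι]
      refine add_mem ?_ (AddSubgroup.subset_closure ⟨a, ha, x, ?_⟩)
      · cases n with
        | zero =>
          obtain ⟨r, rfl⟩ := Submodule.mem_one.mp (by simpa [symPart] using ha)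
          simp
        | succ n =>
          have := ih n rfl
          generalize polar R M a = t at this
          induction this using AddSubgroup.closure_induction with
          | mem t ht =>
            obtain ⟨s, hs, y, rfl⟩ := ht
            exact AddSubgroup.subset_closure ⟨_, ι_mul_mem_symPart x hs, y, rfl⟩
          | zero => simp
          | add s t _ _ hs ht => rw [smul_add]; exact add_mem hs ht
          | neg s _ hs => rw [smul_neg]; exact neg_mem hs
      · simp [TensorProduct.smul_tmul']
  exact key ha n rfl

/-- Euler's identity: multiplication after polarization is multiplication by the degree. -/
lemma symMul_polar {n : ℕ} {a : SymmetricAlgebra R M} (ha : a ∈ symPart R M n) :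
    symMul R M (polar R M a) = (n : R) • a := by
  refine symPart_induction (p := fun n a => symMul R M (polar R M a) = (n : R) • a)
    ?_ ?_ ?_ ?_ ha
  · simp
  · intro n r a ha; rw [map_smul, map_smul, ha, smul_comm]
  · intro n a b ha hb; rw [map_add, map_add, ha, hb, smul_add]
  · intro n x a _ ha
    rw [polar_mul, polar_ι, map_add, symMul_smul, symMul_smul, ha, symMul_tmul]
    push_cast
    simp only [Algebra.smul_def, map_add, map_one, map_natCast]
    ring

lemma polar_prod {n : ℕ} (x : Fin (n + 1) → M) :
    polar R M (∏ i, SymmetricAlgebra.ι R M (x i)) =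
      ∑ i, (∏ j, SymmetricAlgebra.ι R M (x (i.succAbove j))) ⊗ₜ x i := by
  have key : ∀ (s : Finset (Fin (n + 1))), polar R M (∏ i ∈ s, SymmetricAlgebra.ι R M (x i)) =
      ∑ i ∈ s, (∏ j ∈ s.erase i, SymmetricAlgebra.ι R M (x j)) ⊗ₜ x i := by
    intro s
    induction s using Finset.induction_on with
    | empty => simp
    | insert a s ha ih =>
      rw [Finset.prod_insert ha, polar_mul, ih, polar_ι, Finset.sum_insert ha,
        Finset.erase_insert ha, Finset.smul_sum, add_comm, TensorProduct.smul_tmul',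
        smul_eq_mul, mul_one]
      congr 1
      refine Finset.sum_congr rfl fun i hi => ?_
      have hia : i ≠ a := fun h => ha (h ▸ hi)
      rw [Finset.erase_insert_of_ne hia.symm, Finset.prod_insert (by simp [ha])]
      rfl
  rw [key]
  refine Finset.sum_congr rfl fun i _ => ?_
  congr 1
  rw [← Finset.compl_singleton, ← Fin.image_succAbove_univ, Finset.prod_image]
  exact fun a _ b _ h => Fin.succAbove_right_injective h

lemma prod_ι_mem_symPart {n : ℕ} (x : Fin n → M) :
    ∏ i, SymmetricAlgebra.ι R M (x i) ∈ symPart R M n := by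
  induction n with
  | zero => simpa using one_mem_symPart
  | succ n ih => rw [Fin.prod_univ_succ]; exact ι_mul_mem_symPart _ (ih _)

end Polarization

/-! ### Connections and adapted maps -/

section ModuleConnection

/-- An `L`-connection on an `R`-module `M`, for a Lie-Rinehart algebra `(R, L)`: the operators
`op x = ∇_x` are additive, and satisfy the Leibniz identity over the anchor. -/
structure ModuleConnection (R L M : Type*) [CommRing R] [LieRing L] [Module R L]
    [LieRingModule L R] [LieRinehartRing R L] [AddCommGroup M] [Module R M] where
  op : L →ₗ[R] (M →+ M)
  leibniz : ∀ (x : L) (r : R) (m : M), op x (r • m) = r • op x m + ⁅x, r⁆ • m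

variable {R L : Type*} [CommRing R] [LieRing L] [Module R L]
    [LieRingModule L R] [LieRinehartRing R L]

lemma lie_ring_one (x : L) : ⁅x, (1 : R)⁆ = 0 := by
  simpa using LieRinehartRing.leibniz_mul_right x (1 : R) 1

namespace ModuleConnection

variable (nab : ModuleConnection R L L)

lemma exists_cov (x : L) : ∃ D : SymmetricAlgebra R L →+ SymmetricAlgebra R L,
    (∀ r, D (algebraMap R _ r) = algebraMap R _ ⁅x, r⁆) ∧
    (∀ y, D (SymmetricAlgebra.ι R L y) = SymmetricAlgebra.ι R L (nab.op x y)) ∧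
      ∀ a b, D (a * b) = a * D b + b * D a :=
  exists_symDer (N := SymmetricAlgebra R L)
    { toFun := fun r => algebraMap R _ ⁅x, r⁆, map_zero' := by simp, map_add' := by simp }
    (by intro r s; simp; ring)
    { toFun := fun y => SymmetricAlgebra.ι R L (nab.op x y), map_zero' := by simp
      map_add' := by simp }
    (by
      intro r y
      simp only [AddMonoidHom.coe_mk, ZeroHom.coe_mk, nab.leibniz, map_add, map_smul, smul_eq_mul,
        Algebra.smul_def]
      ring)

/-- The covariant derivative `∇_x` on `Sym L`, the derivation over `⁅x, -⁆` extending `∇_x`. -/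
def cov (x : L) : SymmetricAlgebra R L →+ SymmetricAlgebra R L := (nab.exists_cov x).choose

lemma cov_algebraMap (x : L) (r : R) :
    nab.cov x (algebraMap R _ r) = algebraMap R _ ⁅x, r⁆ := (nab.exists_cov x).choose_spec.1 r

@[simp] lemma cov_ι (x y : L) :
    nab.cov x (SymmetricAlgebra.ι R L y) = SymmetricAlgebra.ι R L (nab.op x y) :=
  (nab.exists_cov x).choose_spec.2.1 y

lemma cov_mul (x : L) (a b : SymmetricAlgebra R L) :
    nab.cov x (a * b) = a * nab.cov x b + b * nab.cov x a :=
  (nab.exists_cov x).choose_spec.2.2 a b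

@[simp] lemma cov_one (x : L) : nab.cov x 1 = 0 := by
  simpa [lie_ring_one] using nab.cov_algebraMap x 1

lemma cov_smul (x : L) (r : R) (a : SymmetricAlgebra R L) :
    nab.cov x (r • a) = r • nab.cov x a + ⁅x, r⁆ • a := by
  rw [Algebra.smul_def, cov_mul, cov_algebraMap, Algebra.smul_def, Algebra.smul_def, mul_comm a]

lemma cov_add_left (x y : L) (a : SymmetricAlgebra R L) :
    nab.cov (x + y) a = nab.cov x a + nab.cov y a := by
  induction a using SymmetricAlgebra.induction with
  | algebraMap r => simp [cov_algebraMap]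
  | ι z => simp
  | add a b ha hb => simp only [map_add, ha, hb]; abel
  | mul a b ha hb => simp only [cov_mul, ha, hb]; ring

lemma cov_smul_left (r : R) (x : L) (a : SymmetricAlgebra R L) :
    nab.cov (r • x) a = r • nab.cov x a := by
  induction a using SymmetricAlgebra.induction with
  | algebraMap s => simp [cov_algebraMap, Algebra.smul_def]
  | ι z => simp
  | add a b ha hb => simp only [map_add, ha, hb, smul_add]
  | mul a b ha hb => simp only [cov_mul, ha, hb, smul_add, mul_smul_comm]

lemma cov_mem_symPart (x : L) {n : ℕ} {a : SymmetricAlgebra R L} (ha : a ∈ symPart R L n) :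
    nab.cov x a ∈ symPart R L n := by
  refine symPart_induction (p := fun n a => a ∈ symPart R L n ∧ nab.cov x a ∈ symPart R L n)
    ?_ ?_ ?_ ?_ ha |>.2
  · simpa using one_mem_symPart
  · intro n r a ha
    rw [cov_smul]
    exact ⟨Submodule.smul_mem _ _ ha.1,
      add_mem (Submodule.smul_mem _ _ ha.2) (Submodule.smul_mem _ _ ha.1)⟩
  · intro n a b ha hb
    rw [map_add]
    exact ⟨add_mem ha.1 hb.1, add_mem ha.2 hb.2⟩
  · intro n y a _ ha
    rw [cov_mul, cov_ι, mul_comm a]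
    exact ⟨ι_mul_mem_symPart y ha.1, add_mem (ι_mul_mem_symPart y ha.2) (ι_mul_mem_symPart _ ha.1)⟩

lemma cov_prod (x : L) {n : ℕ} (y : Fin n → L) :
    nab.cov x (∏ j, SymmetricAlgebra.ι R L (y j)) =
      ∑ j, ∏ i, SymmetricAlgebra.ι R L (Function.update y j (nab.op x (y j)) i) := by
  have key : ∀ s : Finset (Fin n), nab.cov x (∏ j ∈ s, SymmetricAlgebra.ι R L (y j)) =
      ∑ j ∈ s, ∏ i ∈ s, SymmetricAlgebra.ι R L (Function.update y j (nab.op x (y j)) i) := by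
    intro s
    induction s using Finset.induction_on with
    | empty => simp
    | insert a s ha ih =>
      rw [Finset.prod_insert ha, cov_mul, ih, cov_ι, Finset.sum_insert ha, add_comm,
        Finset.prod_insert ha, Function.update_self, mul_comm, Finset.mul_sum]
      congr 1
      · congr 1
        refine Finset.prod_congr rfl fun i hi => ?_
        rw [Function.update_of_ne (ne_of_mem_of_not_mem hi ha)]
      · refine Finset.sum_congr rfl fun j hj => ?_
        rw [Finset.prod_insert ha, Function.update_of_ne (ne_of_mem_of_not_mem hj ha).symm]
  exact key Finset.univ

variable {M M' : Type*} [AddCommGroup M] [Module R M] [AddCommGroup M'] [Module R M']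
  (τ : ModuleConnection R L M) (τ' : ModuleConnection R L M')

/-- The covariant differential `s ⊗ x ↦ τ_x (f s) - f (∇_x s)` of a linear map `f : Sym L → M`. -/
def covDiff (f : SymmetricAlgebra R L →ₗ[R] M) : SymmetricAlgebra R L ⊗[R] L →ₗ[R] M :=
  TensorProduct.lift <| LinearMap.mk₂ R (fun s x => τ.op x (f s) - f (nab.cov x s))
    (fun s t x => by simp only [map_add]; abel)
    (fun r s x => by
      simp only [map_smul, τ.leibniz, cov_smul, map_add, smul_sub]; abel)
    (fun s x y => by simp only [map_add, AddMonoidHom.add_apply, cov_add_left]; abel)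
    (fun r s x => by simp only [map_smul, cov_smul_left, smul_sub]; rfl)

@[simp] lemma covDiff_tmul (f : SymmetricAlgebra R L →ₗ[R] M) (s : SymmetricAlgebra R L) (x : L) :
    nab.covDiff τ f (s ⊗ₜ x) = τ.op x (f s) - f (nab.cov x s) := rfl

/-- A linear map `f : Sym L → M` such that multiplication by `x ∈ L` in `Sym L` corresponds to the
covariant differential of `f`, up to symmetrization: `n f(xⁿ) = n (τ_x f(xⁿ⁻¹) - f(∇_x xⁿ⁻¹))`. -/
def IsAdapted (f : SymmetricAlgebra R L →ₗ[R] M) : Prop :=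
  ∀ s, f (symMul R L (polar R L s)) = nab.covDiff τ f (polar R L s)

variable {nab τ τ'}

lemma IsAdapted.comp {f : SymmetricAlgebra R L →ₗ[R] M} (hf : nab.IsAdapted τ f) (g : M →ₗ[R] M')
    (hg : ∀ x m, g (τ.op x m) = τ'.op x (g m)) : nab.IsAdapted τ' (g ∘ₗ f) := by
  intro s
  rw [LinearMap.comp_apply, hf s]
  generalize polar R L s = t
  induction t with
  | zero => simp
  | tmul s x => simp [hg]
  | add s t hs ht => simp only [map_add, hs, ht]

variable (nab τ)

/-- The degree `n` part of the adapted map with value `m` at `1`, multiplied by `n!`. -/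
def covIter (m : M) : ℕ → (SymmetricAlgebra R L →ₗ[R] M)
  | 0 => LinearMap.toSpanSingleton R M m ∘ₗ Coalgebra.counit
  | n + 1 => nab.covDiff τ (covIter m n) ∘ₗ polar R L

lemma covIter_zero_one (m : M) : nab.covIter τ m 0 1 = m := by simp [covIter]

lemma covIter_succ (m : M) (n : ℕ) (s : SymmetricAlgebra R L) :
    nab.covIter τ m (n + 1) s = nab.covDiff τ (nab.covIter τ m n) (polar R L s) := rfl

/-- The recursion of `covIter` on products of elements of `L`; this is the shape of the operator `D`
on symmetric forms. -/
lemma covIter_succ_prod (m : M) {n : ℕ} (x : Fin (n + 1) → L) :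
    nab.covIter τ m (n + 1) (∏ i, SymmetricAlgebra.ι R L (x i)) =
      ∑ i, (τ.op (x i) (nab.covIter τ m n (∏ j, SymmetricAlgebra.ι R L (x (i.succAbove j)))) -
        ∑ j, nab.covIter τ m n (∏ k, SymmetricAlgebra.ι R L
          (Function.update (fun j => x (i.succAbove j)) j
            (nab.op (x i) (x (i.succAbove j))) k))) := by
  rw [covIter_succ, polar_prod, map_sum]
  refine Finset.sum_congr rfl fun i _ => ?_
  rw [covDiff_tmul, cov_prod, map_sum]

lemma covIter_eq_zero (m : M) {n k : ℕ} (h : k ≠ n) {s : SymmetricAlgebra R L}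
    (hs : s ∈ symPart R L k) : nab.covIter τ m n s = 0 := by
  induction n generalizing k s with
  | zero =>
    refine symPart_induction (p := fun k s => k ≠ 0 → nab.covIter τ m 0 s = 0)
      (fun h => absurd rfl h) (fun n r a ha h => by rw [map_smul, ha h, smul_zero])
      (fun n a b ha hb h => by rw [map_add, ha h, hb h, add_zero]) ?_ hs h
    intro n x a _ _ _
    simp [covIter]
  | succ n ih =>
    cases k with
    | zero =>
      obtain ⟨r, rfl⟩ := Submodule.mem_one.mp (by simpa [symPart] using hs)
      rw [covIter_succ, polar_algebraMap, map_zero]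
    | succ k =>
      rw [covIter_succ]
      refine polar_ext (nab.covDiff τ (nab.covIter τ m n)).toAddMonoidHom 0 ?_ hs
      intro s hs x
      change nab.covDiff τ (nab.covIter τ m n) (s ⊗ₜ x) = 0
      rw [covDiff_tmul, ih (by omega) hs, ih (by omega) (nab.cov_mem_symPart x hs)]
      simp

section CharZero

lemma eq_of_natCast_smul (K : Type*) [Field K] [CharZero K] [Algebra K R] {n : ℕ} (hn : n ≠ 0)
    {a b : M} (h : (n : R) • a = (n : R) • b) : a = b := by
  have h2 : algebraMap K R (n : K)⁻¹ * (n : R) = 1 := by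
    rw [← map_natCast (algebraMap K R) n, ← map_mul, inv_mul_cancel₀ (Nat.cast_ne_zero.mpr hn),
      map_one]
  calc a = (algebraMap K R (n : K)⁻¹ * (n : R)) • a := by rw [h2, one_smul]
    _ = b := by rw [mul_smul, h, ← mul_smul, h2, one_smul]

/-- The anchor kills the rational scalars, as it kills `1`. -/
lemma lie_algebraMap_inv (K : Type*) [Field K] [CharZero K] [Algebra K R] (x : L) {n : ℕ}
    (hn : n ≠ 0) : ⁅x, algebraMap K R ((n : K)⁻¹)⁆ = 0 := by
  refine eq_of_natCast_smul (R := R) K hn ?_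
  rw [Nat.cast_smul_eq_nsmul, ← lie_nsmul, ← map_nsmul, nsmul_eq_mul,
    mul_inv_cancel₀ (Nat.cast_ne_zero.mpr hn), map_one, lie_ring_one, smul_zero]

/-- An adapted map is determined by its value at `1`: in degree `n + 1`, the product of the
polarization is multiplication by `n + 1`, which is invertible. -/
lemma IsAdapted.unique (K : Type*) [Field K] [CharZero K] [Algebra K R]
    {nab : ModuleConnection R L L} {τ : ModuleConnection R L M}
    {f g : SymmetricAlgebra R L →ₗ[R] M} (hf : nab.IsAdapted τ f)
    (hg : nab.IsAdapted τ g) (h : f 1 = g 1) : f = g := by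
  have key : ∀ n, ∀ s ∈ symPart R L n, f s = g s := by
    intro n
    induction n with
    | zero =>
      intro s hs
      obtain ⟨r, rfl⟩ := Submodule.mem_one.mp (by simpa [symPart] using hs)
      rw [Algebra.algebraMap_eq_smul_one, map_smul, map_smul, h]
    | succ n ih =>
      intro s hs
      have h1 := hf s
      have h2 := hg s
      rw [symMul_polar hs, map_smul] at h1 h2
      refine eq_of_natCast_smul (R := R) K (Nat.succ_ne_zero n) ?_
      rw [h1, h2]
      refine polar_ext (nab.covDiff τ f).toAddMonoidHom (nab.covDiff τ g).toAddMonoidHom ?_ hs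
      intro s hs x
      change nab.covDiff τ f (s ⊗ₜ x) = nab.covDiff τ g (s ⊗ₜ x)
      rw [covDiff_tmul, covDiff_tmul, ih s hs, ih _ (nab.cov_mem_symPart x hs)]
  ext s
  induction s using sym_induction with
  | part n s hs => exact key n s hs
  | add a b ha hb => rw [map_add, map_add, ha, hb]

variable (K : Type*) [Field K] [CharZero K] [Algebra K R]

/-- The terms of the sum defining `adaptedMap`. -/
def adaptedTerm (m : M) (n : ℕ) : SymmetricAlgebra R L →ₗ[R] M :=
  algebraMap K R ((n.factorial : K)⁻¹) • nab.covIter τ m n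

lemma adaptedTerm_eq_zero (m : M) {n k : ℕ} (h : k ≠ n) {s : SymmetricAlgebra R L}
    (hs : s ∈ symPart R L k) : nab.adaptedTerm τ K m n s = 0 := by
  rw [adaptedTerm, LinearMap.smul_apply, nab.covIter_eq_zero τ m h hs, smul_zero]

lemma adaptedTerm_finite (m : M) (s : SymmetricAlgebra R L) :
    (Function.support fun n => nab.adaptedTerm τ K m n s).Finite := by
  induction s using sym_induction with
  | part k s hs =>
    refine (Set.finite_singleton k).subset fun n hn => ?_
    by_contra h
    exact hn (nab.adaptedTerm_eq_zero τ K m (fun e => h e.symm) hs)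
  | add a b ha hb =>
    refine (ha.union hb).subset fun n hn => ?_
    by_contra h
    simp only [Set.mem_union, Function.mem_support, not_or, not_not] at h
    exact hn (by simp only [map_add, h.1, h.2, add_zero])

/-- The adapted map `Sym L → M` with value `m` at `1`. The sum is finite on every element, as the
term of index `n` vanishes outside degree `n`. -/
def adaptedMap (m : M) : SymmetricAlgebra R L →ₗ[R] M where
  toFun s := ∑ᶠ n, nab.adaptedTerm τ K m n s
  map_add' a b := by
    rw [← finsum_add_distrib (nab.adaptedTerm_finite τ K m a) (nab.adaptedTerm_finite τ K m b)]
    exact finsum_congr fun n => map_add _ _ _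
  map_smul' r a := by
    rw [RingHom.id_apply, smul_finsum' r (nab.adaptedTerm_finite τ K m a)]
    exact finsum_congr fun n => map_smul _ _ _

lemma adaptedMap_apply (m : M) {n : ℕ} {s : SymmetricAlgebra R L} (hs : s ∈ symPart R L n) :
    nab.adaptedMap τ K m s = algebraMap K R ((n.factorial : K)⁻¹) • nab.covIter τ m n s :=
  finsum_eq_single _ n fun _ h => nab.adaptedTerm_eq_zero τ K m h.symm hs

@[simp] lemma adaptedMap_one (m : M) : nab.adaptedMap τ K m 1 = m := by
  rw [nab.adaptedMap_apply τ K m one_mem_symPart, covIter_zero_one]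
  simp

lemma isAdapted_adaptedMap (m : M) : nab.IsAdapted τ (nab.adaptedMap τ K m) := by
  intro s
  induction s using sym_induction with
  | part k s hs =>
    cases k with
    | zero =>
      obtain ⟨r, rfl⟩ := Submodule.mem_one.mp (by simpa [symPart] using hs)
      simp
    | succ n =>
      rw [symMul_polar hs, map_smul, nab.adaptedMap_apply τ K m hs, covIter_succ, smul_smul]
      have hn : ((n + 1 : ℕ) : R) * algebraMap K R (((n + 1).factorial : K)⁻¹) =
          algebraMap K R ((n.factorial : K)⁻¹) := by
        rw [← map_natCast (algebraMap K R), ← map_mul, Nat.factorial_succ, Nat.cast_mul, mul_inv,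
          mul_inv_cancel_left₀ (Nat.cast_ne_zero.mpr (Nat.succ_ne_zero n))]
      rw [hn]
      refine polar_ext (algebraMap K R ((n.factorial : K)⁻¹) •
        nab.covDiff τ (nab.covIter τ m n)).toAddMonoidHom
        (nab.covDiff τ (nab.adaptedMap τ K m)).toAddMonoidHom ?_ hs
      intro s hs x
      change algebraMap K R ((n.factorial : K)⁻¹) • nab.covDiff τ (nab.covIter τ m n) (s ⊗ₜ x) =
        nab.covDiff τ (nab.adaptedMap τ K m) (s ⊗ₜ x)
      have h0 := lie_algebraMap_inv (R := R) K x (Nat.factorial_ne_zero n)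
      rw [covDiff_tmul, covDiff_tmul, nab.adaptedMap_apply τ K m hs,
        nab.adaptedMap_apply τ K m (nab.cov_mem_symPart x hs), τ.leibniz, h0, zero_smul, add_zero,
        smul_sub]
  | add a b ha hb => simp only [map_add, ha, hb]

end CharZero

end ModuleConnection

end ModuleConnection

/-! ### Tensor products of connections and the coproduct -/

section TensorConnection

variable {R L : Type*} [CommRing R] [LieRing L] [Module R L]
    [LieRingModule L R] [LieRinehartRing R L]
  {M M' : Type*} [AddCommGroup M] [Module R M] [AddCommGroup M'] [Module R M']

section polarComul

variable {N : Type*} [AddCommGroup N] [Module R N]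

/-- Polarization of the first factor of `Sym N ⊗ Sym N`. -/
def polarLeft : SymmetricAlgebra R N ⊗[R] SymmetricAlgebra R N →ₗ[R]
    (SymmetricAlgebra R N ⊗[R] SymmetricAlgebra R N) ⊗[R] N :=
  (TensorProduct.rightComm R (SymmetricAlgebra R N) N (SymmetricAlgebra R N)).toLinearMap ∘ₗ
    (polar R N).rTensor _

/-- Polarization of the second factor of `Sym N ⊗ Sym N`. -/
def polarRight : SymmetricAlgebra R N ⊗[R] SymmetricAlgebra R N →ₗ[R]
    (SymmetricAlgebra R N ⊗[R] SymmetricAlgebra R N) ⊗[R] N :=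
  (TensorProduct.assoc R (SymmetricAlgebra R N) (SymmetricAlgebra R N) N).symm.toLinearMap ∘ₗ
    (polar R N).lTensor _

lemma rightComm_smul (a b : SymmetricAlgebra R N) (t : SymmetricAlgebra R N ⊗[R] N)
    (c : SymmetricAlgebra R N) :
    TensorProduct.rightComm R (SymmetricAlgebra R N) N (SymmetricAlgebra R N)
        ((a • t) ⊗ₜ (b * c)) =
      (a ⊗ₜ[R] b : SymmetricAlgebra R N ⊗[R] SymmetricAlgebra R N) •
        TensorProduct.rightComm R (SymmetricAlgebra R N) N (SymmetricAlgebra R N) (t ⊗ₜ c) := by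
  induction t with
  | zero => simp
  | tmul s x => simp [TensorProduct.smul_tmul']
  | add s t hs ht => simp only [smul_add, TensorProduct.add_tmul, map_add, hs, ht]

lemma assoc_symm_smul (a b : SymmetricAlgebra R N) (t : SymmetricAlgebra R N ⊗[R] N)
    (c : SymmetricAlgebra R N) :
    (TensorProduct.assoc R (SymmetricAlgebra R N) (SymmetricAlgebra R N) N).symm
        ((b * c) ⊗ₜ (a • t)) =
      (b ⊗ₜ[R] a : SymmetricAlgebra R N ⊗[R] SymmetricAlgebra R N) •
        (TensorProduct.assoc R (SymmetricAlgebra R N) (SymmetricAlgebra R N) N).symm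
          (c ⊗ₜ t) := by
  induction t with
  | zero => simp
  | tmul s x => simp [TensorProduct.smul_tmul']
  | add s t hs ht => simp only [smul_add, TensorProduct.tmul_add, map_add, hs, ht]

lemma polarLeft_mul (u v : SymmetricAlgebra R N ⊗[R] SymmetricAlgebra R N) :
    polarLeft (u * v) = u • polarLeft v + v • polarLeft u := by
  induction u with
  | zero =>
    rw [zero_mul, map_zero, smul_zero, add_zero]
    exact (TensorProduct.zero_smul _).symm
  | add u w hu hw => rw [add_mul, map_add, hu, hw, map_add, smul_add, add_smul]; abel
  | tmul a b =>
    induction v with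
    | zero =>
      rw [mul_zero, map_zero, smul_zero, zero_add]
      exact (TensorProduct.zero_smul _).symm
    | add u w hu hw => rw [mul_add, map_add, hu, hw, map_add, smul_add, add_smul]; abel
    | tmul c d =>
      simp only [polarLeft, Algebra.TensorProduct.tmul_mul_tmul, LinearMap.comp_apply,
        LinearMap.rTensor_tmul, polar_mul, LinearEquiv.coe_coe]
      rw [TensorProduct.add_tmul, map_add, rightComm_smul, mul_comm b d, rightComm_smul]

lemma polarRight_mul (u v : SymmetricAlgebra R N ⊗[R] SymmetricAlgebra R N) :
    polarRight (u * v) = u • polarRight v + v • polarRight u := by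
  induction u with
  | zero =>
    rw [zero_mul, map_zero, smul_zero, add_zero]
    exact (TensorProduct.zero_smul _).symm
  | add u w hu hw => rw [add_mul, map_add, hu, hw, map_add, smul_add, add_smul]; abel
  | tmul a b =>
    induction v with
    | zero =>
      rw [mul_zero, map_zero, smul_zero, zero_add]
      exact (TensorProduct.zero_smul _).symm
    | add u w hu hw => rw [mul_add, map_add, hu, hw, map_add, smul_add, add_smul]; abel
    | tmul c d =>
      simp only [polarRight, Algebra.TensorProduct.tmul_mul_tmul, LinearMap.comp_apply,
        LinearMap.lTensor_tmul, polar_mul, LinearEquiv.coe_coe]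
      rw [TensorProduct.tmul_add, map_add, assoc_symm_smul, mul_comm a c, assoc_symm_smul]

lemma rTensor_comul_smul (a : SymmetricAlgebra R N) (t : SymmetricAlgebra R N ⊗[R] N) :
    (Coalgebra.comul (R := R) (A := SymmetricAlgebra R N)).rTensor N (a • t) =
      Coalgebra.comul (R := R) a •
        (Coalgebra.comul (R := R) (A := SymmetricAlgebra R N)).rTensor N t := by
  induction t with
  | zero => simp
  | tmul s x => simp [TensorProduct.smul_tmul']
  | add s t hs ht => simp only [smul_add, map_add, hs, ht]

lemma comul_polar_left (s : SymmetricAlgebra R N) :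
    (Coalgebra.comul (R := R) (A := SymmetricAlgebra R N)).rTensor N (polar R N s) =
      polarLeft (Coalgebra.comul (R := R) s) := by
  induction s using SymmetricAlgebra.induction with
  | algebraMap r => simp [polarLeft, Algebra.TensorProduct.algebraMap_apply]
  | ι x => simp [polarLeft, Algebra.TensorProduct.one_def]
  | add a b ha hb => simp only [map_add, ha, hb]
  | mul a b ha hb =>
    rw [polar_mul, map_add, rTensor_comul_smul, rTensor_comul_smul, ha, hb, Bialgebra.comul_mul,
      polarLeft_mul]

lemma comul_polar_right (s : SymmetricAlgebra R N) :
    (Coalgebra.comul (R := R) (A := SymmetricAlgebra R N)).rTensor N (polar R N s) =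
      polarRight (Coalgebra.comul (R := R) s) := by
  induction s using SymmetricAlgebra.induction with
  | algebraMap r => simp [polarRight, Algebra.TensorProduct.algebraMap_apply]
  | ι x => simp [polarRight, Algebra.TensorProduct.one_def]
  | add a b ha hb => simp only [map_add, ha, hb]
  | mul a b ha hb =>
    rw [polar_mul, map_add, rTensor_comul_smul, rTensor_comul_smul, ha, hb, Bialgebra.comul_mul,
      polarRight_mul]

end polarComul

namespace ModuleConnection

variable {nab : ModuleConnection R L L} (τ : ModuleConnection R L M) (τ' : ModuleConnection R L M')

/-- The tensor product connection `τ ⊗ 1 + 1 ⊗ τ'`. -/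
def tensor : ModuleConnection R L (M ⊗[R] M') where
  op :=
    { toFun := fun x => Env.tensorDer x (τ.op x) (τ'.op x) (τ.leibniz x) (τ'.leibniz x)
      map_add' := fun x y => by
        ext t
        induction t with
        | zero => simp only [map_zero]
        | tmul m n =>
          rw [AddMonoidHom.add_apply]
          simp only [Env.tensorDer_tmul, map_add, AddMonoidHom.add_apply, TensorProduct.add_tmul,
            TensorProduct.tmul_add]
          abel
        | add s t hs ht =>
          exact (map_add _ _ _).trans ((congrArg₂ (· + ·) hs ht).trans (map_add _ _ _).symm)
      map_smul' := fun r x => by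
        ext t
        induction t with
        | zero => simp only [map_zero]
        | tmul m n =>
          change (τ.op (r • x) m) ⊗ₜ n + m ⊗ₜ (τ'.op (r • x) n) =
            r • (τ.op x m ⊗ₜ[R] n + m ⊗ₜ[R] τ'.op x n)
          rw [map_smul, map_smul, smul_add]
          exact congrArg₂ (· + ·) (TensorProduct.smul_tmul' r _ n).symm
            (TensorProduct.tmul_smul r m _)
        | add s t hs ht =>
          exact (map_add _ _ _).trans ((congrArg₂ (· + ·) hs ht).trans (map_add _ _ _).symm) }
  leibniz x r t := Env.tensorDer_smul x (τ.op x) (τ'.op x) (τ.leibniz x) (τ'.leibniz x) r t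

@[simp] lemma tensor_tmul (x : L) (m : M) (n : M') :
    (τ.tensor τ').op x (m ⊗ₜ n) = τ.op x m ⊗ₜ n + m ⊗ₜ τ'.op x n := rfl

variable (nab) in
/-- The operator `∇_x ⊗ 1 + 1 ⊗ ∇_x` on `Sym L ⊗ Sym L`. -/
def covTensor (x : L) : SymmetricAlgebra R L ⊗[R] SymmetricAlgebra R L →+
    SymmetricAlgebra R L ⊗[R] SymmetricAlgebra R L :=
  Env.tensorDer (R := R) (M := SymmetricAlgebra R L) (N := SymmetricAlgebra R L) x
    (nab.cov x) (nab.cov x) (nab.cov_smul x) (nab.cov_smul x)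

variable (nab) in
@[simp] lemma covTensor_tmul (x : L) (a b : SymmetricAlgebra R L) :
    nab.covTensor x (a ⊗ₜ b) = nab.cov x a ⊗ₜ b + a ⊗ₜ nab.cov x b := rfl

variable (nab) in
lemma covTensor_mul (x : L) (u v : SymmetricAlgebra R L ⊗[R] SymmetricAlgebra R L) :
    nab.covTensor x (u * v) = u * nab.covTensor x v + v * nab.covTensor x u := by
  induction u with
  | zero => rw [zero_mul, map_zero, mul_zero, zero_mul, zero_add]
  | add u w hu hw => rw [add_mul, map_add, hu, hw, map_add, mul_add, add_mul]; abel
  | tmul a b =>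
    induction v with
    | zero => rw [zero_mul, mul_zero, map_zero, mul_zero, zero_add]
    | add u w hu hw => rw [mul_add, map_add, hu, hw, map_add, mul_add, add_mul]; abel
    | tmul c d =>
      rw [Algebra.TensorProduct.tmul_mul_tmul, covTensor_tmul, covTensor_tmul, covTensor_tmul,
        cov_mul, cov_mul, TensorProduct.add_tmul, TensorProduct.tmul_add, mul_add, mul_add]
      simp only [Algebra.TensorProduct.tmul_mul_tmul]
      rw [mul_comm d b, mul_comm c a]
      abel

variable (nab) in
lemma comul_cov (x : L) (s : SymmetricAlgebra R L) :
    Coalgebra.comul (R := R) (nab.cov x s) = nab.covTensor x (Coalgebra.comul (R := R) s) := by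
  induction s using SymmetricAlgebra.induction with
  | algebraMap r => simp [cov_algebraMap, Algebra.TensorProduct.algebraMap_apply]
  | ι y => simp
  | add a b ha hb => simp only [map_add, ha, hb]
  | mul a b ha hb => rw [cov_mul, Bialgebra.comul_mul, covTensor_mul, map_add, Bialgebra.comul_mul,
      Bialgebra.comul_mul, ha, hb]

variable {τ τ'}

/-- The tensor product of adapted maps, composed with the coproduct of `Sym L`, is adapted: the
multiplication, the polarization and the covariant derivatives are compatible with the coproduct. -/
lemma IsAdapted.tensor {f : SymmetricAlgebra R L →ₗ[R] M} {g : SymmetricAlgebra R L →ₗ[R] M'}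
    (hf : nab.IsAdapted τ f) (hg : nab.IsAdapted τ' g) :
    nab.IsAdapted (τ.tensor τ') (TensorProduct.map f g ∘ₗ Coalgebra.comul (R := R)) := by
  -- the operators `(a ⊗ b) ⊗ x ↦ φ (a ⊗ x) ⊗ g b + f a ⊗ ψ (b ⊗ x)`
  let A : (SymmetricAlgebra R L ⊗[R] L →ₗ[R] M) → (SymmetricAlgebra R L ⊗[R] L →ₗ[R] M') →
      (SymmetricAlgebra R L ⊗[R] SymmetricAlgebra R L) ⊗[R] L →ₗ[R] M ⊗[R] M' := fun φ ψ =>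
    TensorProduct.map φ g ∘ₗ (TensorProduct.rightComm R (SymmetricAlgebra R L) L
      (SymmetricAlgebra R L)).symm.toLinearMap +
    TensorProduct.map f ψ ∘ₗ (TensorProduct.assoc R (SymmetricAlgebra R L)
      (SymmetricAlgebra R L) L).toLinearMap
  have A_tmul : ∀ φ ψ a b x, A φ ψ ((a ⊗ₜ b) ⊗ₜ x) = φ (a ⊗ₜ x) ⊗ₜ g b + f a ⊗ₜ ψ (b ⊗ₜ x) :=
    fun φ ψ a b x => rfl
  have A_polar : ∀ φ ψ s, A φ ψ ((Coalgebra.comul (R := R)).rTensor L (polar R L s)) =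
      TensorProduct.map (φ ∘ₗ polar R L) g (Coalgebra.comul (R := R) s) +
      TensorProduct.map f (ψ ∘ₗ polar R L) (Coalgebra.comul (R := R) s) := by
    intro φ ψ s
    rw [LinearMap.add_apply]
    congr 1
    · rw [comul_polar_left]
      simp only [polarLeft, LinearMap.comp_apply, LinearEquiv.coe_coe, LinearEquiv.symm_apply_apply]
      generalize Coalgebra.comul (R := R) s = w
      induction w with
      | zero => simp
      | tmul a b => simp
      | add u v hu hv => simp only [map_add, hu, hv]
    · rw [comul_polar_right]
      simp only [polarRight, LinearMap.comp_apply, LinearEquiv.coe_coe,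
        LinearEquiv.apply_symm_apply]
      generalize Coalgebra.comul (R := R) s = w
      induction w with
      | zero => simp
      | tmul a b => simp
      | add u v hu hv => simp only [map_add, hu, hv]
  have h1 : ∀ t, (TensorProduct.map f g ∘ₗ Coalgebra.comul (R := R)) (symMul R L t) =
      A (f ∘ₗ symMul R L) (g ∘ₗ symMul R L) ((Coalgebra.comul (R := R)).rTensor L t) := by
    intro t
    induction t with
    | zero => simp
    | add s t hs ht => simp only [map_add, hs, ht]
    | tmul s x =>
      rw [symMul_tmul, LinearMap.comp_apply, Bialgebra.comul_mul, SymmetricAlgebra.comul_ι,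
        LinearMap.rTensor_tmul]
      generalize Coalgebra.comul (R := R) s = w
      induction w with
      | zero => simp
      | tmul a b => simp [A_tmul, mul_add]
      | add u v hu hv => simp only [map_add, add_mul, TensorProduct.add_tmul, hu, hv]
  have h2 : ∀ t, nab.covDiff (τ.tensor τ') (TensorProduct.map f g ∘ₗ Coalgebra.comul (R := R)) t =
      A (nab.covDiff τ f) (nab.covDiff τ' g) ((Coalgebra.comul (R := R)).rTensor L t) := by
    intro t
    induction t with
    | zero => simp
    | add s t hs ht => simp only [map_add, hs, ht]
    | tmul s x =>
      rw [covDiff_tmul, LinearMap.comp_apply, LinearMap.comp_apply, comul_cov,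
        LinearMap.rTensor_tmul]
      generalize Coalgebra.comul (R := R) s = w
      induction w with
      | zero => simp
      | tmul a b =>
        simp only [A_tmul, TensorProduct.map_tmul, tensor_tmul, covTensor_tmul, map_add,
          covDiff_tmul, TensorProduct.sub_tmul, TensorProduct.tmul_sub]
        abel
      | add u v hu hv =>
        simp only [map_add, TensorProduct.add_tmul] at hu hv ⊢
        rw [← hu, ← hv]
        abel
  intro s
  rw [h1, h2, A_polar, A_polar]
  have e1 : (f ∘ₗ symMul R L) ∘ₗ polar R L = nab.covDiff τ f ∘ₗ polar R L := LinearMap.ext hf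
  have e2 : (g ∘ₗ symMul R L) ∘ₗ polar R L = nab.covDiff τ' g ∘ₗ polar R L := LinearMap.ext hg
  rw [e1, e2]

variable (R L) in
/-- The connection on `R` given by the anchor. -/
def unit : ModuleConnection R L R where
  op :=
    { toFun := fun x =>
        { toFun := fun r => ⁅x, r⁆
          map_zero' := by simp
          map_add' := by simp }
      map_add' := fun x y => by ext; simp
      map_smul' := fun r x => by ext; simp }
  leibniz x r s := by simp [mul_comm]

@[simp] lemma unit_op (x : L) (r : R) : (unit R L).op x r = ⁅x, r⁆ := rfl

lemma isAdapted_counit : nab.IsAdapted (unit R L) (Coalgebra.counit (R := R)) := by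
  have h1 : ∀ t, Coalgebra.counit (R := R) (symMul R L t) = 0 := by
    intro t
    induction t with
    | zero => simp
    | add s t hs ht => simp only [map_add, hs, ht, add_zero]
    | tmul s x => simp
  have h2 : ∀ x s, Coalgebra.counit (R := R) (nab.cov x s) = ⁅x, Coalgebra.counit (R := R) s⁆ := by
    intro x s
    induction s using SymmetricAlgebra.induction with
    | algebraMap r => simp [cov_algebraMap]
    | ι y => simp
    | add a b ha hb => simp only [map_add, ha, hb, lie_add]
    | mul a b ha hb => simp [cov_mul, ha, hb, mul_comm]
  intro s
  rw [h1]
  generalize polar R L s = t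
  induction t with
  | zero => simp
  | add s t hs ht => rw [map_add, ← hs, ← ht, add_zero]
  | tmul s x => simp [h2]

end ModuleConnection

end TensorConnection

/-! ### The Poincaré-Birkhoff-Witt map -/

section Filtration

variable {R N : Type*} [CommRing R] [AddCommGroup N] [Module R N]

variable (R N) in
/-- The elements of degree at most `n` of the symmetric algebra. -/
def symLE (n : ℕ) : Submodule R (SymmetricAlgebra R N) := ⨆ k ≤ n, symPart R N k

lemma symPart_le_symLE {k n : ℕ} (h : k ≤ n) : symPart R N k ≤ symLE R N n :=
  le_biSup (fun k => symPart R N k) h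

lemma symLE_mono {m n : ℕ} (h : m ≤ n) : symLE R N m ≤ symLE R N n :=
  iSup₂_le fun _ hk => symPart_le_symLE (hk.trans h)

lemma symLE_succ (n : ℕ) : symLE R N (n + 1) = symLE R N n ⊔ symPart R N (n + 1) := by
  refine le_antisymm (iSup₂_le fun k hk => ?_)
    (sup_le (symLE_mono (Nat.le_succ n)) (symPart_le_symLE le_rfl))
  rcases hk.lt_or_eq with h | rfl
  · exact le_sup_of_le_left (symPart_le_symLE (Nat.lt_succ_iff.mp h))
  · exact le_sup_right

lemma symLE_zero : symLE R N 0 = symPart R N 0 :=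
  le_antisymm (iSup₂_le fun k hk => by rw [Nat.le_zero.mp hk]) (symPart_le_symLE le_rfl)

lemma exists_mem_symLE (s : SymmetricAlgebra R N) : ∃ n, s ∈ symLE R N n := by
  induction s using sym_induction with
  | part n a ha => exact ⟨n, symPart_le_symLE le_rfl ha⟩
  | add a b ha hb =>
    obtain ⟨m, hm⟩ := ha
    obtain ⟨n, hn⟩ := hb
    exact ⟨max m n, add_mem (symLE_mono (le_max_left m n) hm) (symLE_mono (le_max_right m n) hn)⟩

lemma symLE_induction {n : ℕ} {p : SymmetricAlgebra R N → Prop}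
    (part : ∀ k ≤ n, ∀ a ∈ symPart R N k, p a) (add : ∀ a b, p a → p b → p (a + b))
    {a : SymmetricAlgebra R N} (ha : a ∈ symLE R N n) : p a := by
  induction n generalizing a with
  | zero => rw [symLE_zero] at ha; exact part 0 le_rfl a ha
  | succ n ih =>
    rw [symLE_succ] at ha
    obtain ⟨b, hb, c, hc, rfl⟩ := Submodule.mem_sup.mp ha
    exact add _ _ (ih (fun k hk => part k (hk.trans (Nat.le_succ n))) hb) (part _ le_rfl c hc)

end Filtration

section PBW

variable {K : Type*} {R L : Type*} [Field K] [CommRing R] [Algebra K R] [LieRing L] [LieAlgebra K L]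
  [Module R L] [LieRingModule L R] [LieRinehartRing R L] [LieRinehartAlgebra K R L]

variable (K R L) in
/-- The connection on `U(L, R)` given by left multiplication. -/
def envConnection : ModuleConnection R L (Env K R L) where
  op :=
    { toFun := fun x => Env.mulLie x
      map_add' := fun x y => by ext a; simp [add_mul]
      map_smul' := fun r x => by
        ext a
        change Env.ofLie K (r • x) * a = r • (Env.ofLie K x * a)
        rw [← Env.smul_ofLie, smul_mul_assoc] }
  leibniz x r a := Env.mulLie_smul x r a

@[simp] lemma envConnection_op (x : L) (a : Env K R L) :
    (envConnection K R L).op x a = Env.ofLie K x * a := rfl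

variable [CharZero K]

namespace ModuleConnection

variable (nab : ModuleConnection R L L)

variable (K) in
/-- The Poincaré-Birkhoff-Witt map `Sym L → U(L, R)` of a connection. -/
def pbw : SymmetricAlgebra R L →ₗ[R] Env K R L := nab.adaptedMap (envConnection K R L) K 1

@[simp] lemma pbw_one : nab.pbw K 1 = 1 := nab.adaptedMap_one (envConnection K R L) K 1

lemma isAdapted_pbw : nab.IsAdapted (envConnection K R L) (nab.pbw K) :=
  nab.isAdapted_adaptedMap (envConnection K R L) K 1

lemma comul_pbw (s : SymmetricAlgebra R L) :
    Coalgebra.comul (R := R) (nab.pbw K s) =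
      TensorProduct.map (nab.pbw K) (nab.pbw K) (Coalgebra.comul (R := R) s) := by
  have h1 : nab.IsAdapted ((envConnection K R L).tensor (envConnection K R L))
      (Coalgebra.comul (R := R) ∘ₗ nab.pbw K) :=
    nab.isAdapted_pbw.comp _ fun x m => Env.comul_ofLie_mul x m
  have h2 := (nab.isAdapted_pbw (K := K)).tensor (nab.isAdapted_pbw (K := K))
  have h3 := h1.unique K h2 (by
    simp only [LinearMap.comp_apply, pbw_one, Bialgebra.comul_one, Algebra.TensorProduct.one_def,
      TensorProduct.map_tmul]
    exact Env.comul_one)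
  exact congrArg (fun f => f s) h3

lemma counit_pbw (s : SymmetricAlgebra R L) :
    Coalgebra.counit (R := R) (nab.pbw K s) = Coalgebra.counit (R := R) s := by
  have h1 : nab.IsAdapted (unit R L) (Coalgebra.counit (R := R) ∘ₗ nab.pbw K) :=
    nab.isAdapted_pbw.comp _ fun x m => Env.counit_ofLie_mul x m
  have h3 := h1.unique K nab.isAdapted_counit (by
    rw [LinearMap.comp_apply, pbw_one, Bialgebra.counit_one]
    exact Env.counit_one)
  exact congrArg (fun f => f s) h3

variable (K) in
/-- The image of the elements of degree at most `n` under the Poincaré-Birkhoff-Witt map. -/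
def pbwLE (n : ℕ) : Submodule R (Env K R L) := (symLE R L n).map (nab.pbw K)

lemma pbw_mem_pbwLE {k n : ℕ} (h : k ≤ n) {s : SymmetricAlgebra R L} (hs : s ∈ symPart R L k) :
    nab.pbw K s ∈ nab.pbwLE K n :=
  Submodule.mem_map_of_mem (symPart_le_symLE h hs)

lemma pbwLE_mono {m n : ℕ} (h : m ≤ n) : nab.pbwLE K m ≤ nab.pbwLE K n :=
  Submodule.map_mono (symLE_mono h)

/-- Left multiplication by `x ∈ L` on `U(L, R)` and on `Sym L` correspond to each other up to terms
of lower degree. By induction on the degree: `(n + 1) x s` is the product of the polarization of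
`x s`, and there `y x` may be replaced with `x y` because `[y, x] ∈ L` has degree one. -/
lemma mul_pbw_sub_mem {n : ℕ} {s : SymmetricAlgebra R L} (hs : s ∈ symPart R L n) (x : L) :
    Env.ofLie K x * nab.pbw K s - nab.pbw K (SymmetricAlgebra.ι R L x * s) ∈ nab.pbwLE K n := by
  induction n using Nat.strong_induction_on generalizing s x with
  | _ n ih =>
  -- left multiplication by elements of `L` raises the filtration by one
  have mul_mem : ∀ m < n, ∀ D ∈ nab.pbwLE K m, ∀ y : L,
      Env.ofLie K y * D ∈ nab.pbwLE K (m + 1) := by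
    rintro m hm D ⟨s, hs, rfl⟩ y
    refine symLE_induction (n := m) (p := fun s => Env.ofLie K y * nab.pbw K s ∈
      nab.pbwLE K (m + 1)) (fun k hk a ha => ?_) (fun a b ha hb => ?_) hs
    · have h := add_mem (nab.pbwLE_mono (by omega) (ih k (by omega) ha y))
        (nab.pbw_mem_pbwLE (K := K) (show k + 1 ≤ m + 1 by omega) (ι_mul_mem_symPart y ha))
      rwa [sub_add_cancel] at h
    · simp only [map_add, mul_add]
      exact add_mem ha hb
  -- modulo lower degree, the covariant differential of `x s'` is `x` times the product of `s'`
  have key : nab.covDiff (envConnection K R L) (nab.pbw K)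
        (SymmetricAlgebra.ι R L x • polar R L s) -
      Env.ofLie K x * nab.pbw K (symMul R L (polar R L s)) ∈ nab.pbwLE K n := by
    cases n with
    | zero =>
      obtain ⟨r, rfl⟩ := Submodule.mem_one.mp (by simpa [symPart] using hs)
      simp
    | succ m =>
      let f : SymmetricAlgebra R L ⊗[R] L →+ Env K R L ⧸ nab.pbwLE K (m + 1) :=
        { toFun := fun t => (nab.pbwLE K (m + 1)).mkQ (nab.covDiff (envConnection K R L)
            (nab.pbw K) (SymmetricAlgebra.ι R L x • t))
          map_zero' := by simp
          map_add' := fun a b => by simp only [smul_add, map_add] }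
      let g : SymmetricAlgebra R L ⊗[R] L →+ Env K R L ⧸ nab.pbwLE K (m + 1) :=
        { toFun := fun t => (nab.pbwLE K (m + 1)).mkQ
            (Env.ofLie K x * nab.pbw K (symMul R L t))
          map_zero' := by simp
          map_add' := fun a b => by simp only [map_add, mul_add] }
      rw [← Submodule.Quotient.eq]
      refine polar_ext f g ?_ hs
      intro s hs y
      change Submodule.Quotient.mk (nab.covDiff (envConnection K R L) (nab.pbw K)
        (SymmetricAlgebra.ι R L x • (s ⊗ₜ y))) = Submodule.Quotient.mk
          (Env.ofLie K x * nab.pbw K (symMul R L (s ⊗ₜ y)))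
      rw [Submodule.Quotient.eq, TensorProduct.smul_tmul', covDiff_tmul, symMul_tmul, smul_eq_mul,
        envConnection_op, mul_comm s]
      have h1 := mul_mem m (by omega) _ (ih m (by omega) hs x) y
      have h2 := mul_mem m (by omega) _ (ih m (by omega) hs y) x
      have h3 := mul_mem m (by omega) _ (nab.pbw_mem_pbwLE (K := K) le_rfl hs) ⁅y, x⁆
      have h4 := nab.pbw_mem_pbwLE (K := K) le_rfl (nab.cov_mem_symPart y (ι_mul_mem_symPart x hs))
      have h5 := sub_mem (add_mem (sub_mem h2 h1) h3) h4
      have e : Env.ofLie K y * (Env.ofLie K x * nab.pbw K s) =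
          Env.ofLie K x * (Env.ofLie K y * nab.pbw K s) + Env.ofLie K ⁅y, x⁆ * nab.pbw K s := by
        rw [← mul_assoc, Env.ofLie_mul_ofLie, add_mul, mul_assoc]
      rw [mul_sub, mul_sub, e] at h5
      convert h5 using 1
      abel
  have h := nab.isAdapted_pbw (K := K) (SymmetricAlgebra.ι R L x * s)
  rw [symMul_polar (ι_mul_mem_symPart x hs), polar_mul, polar_ι, map_add,
    TensorProduct.smul_tmul', smul_eq_mul, mul_one, covDiff_tmul, envConnection_op] at h
  rw [symMul_polar hs] at key
  have h6 := sub_mem (nab.pbw_mem_pbwLE (K := K) le_rfl (nab.cov_mem_symPart x hs)) key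
  have h7 : ((n + 1 : ℕ) : R) • (Env.ofLie K x * nab.pbw K s -
      nab.pbw K (SymmetricAlgebra.ι R L x * s)) ∈ nab.pbwLE K n := by
    convert h6 using 1
    rw [smul_sub, ← map_smul, h, map_smul (nab.pbw K) (n : R) s, Nat.cast_smul_eq_nsmul,
      Nat.cast_smul_eq_nsmul, mul_smul_comm, succ_nsmul]
    abel
  have h8 := Submodule.smul_mem _ (algebraMap K R ((n + 1 : ℕ) : K)⁻¹) h7
  rwa [smul_smul, ← map_natCast (algebraMap K R), ← map_mul, inv_mul_cancel₀
    (Nat.cast_ne_zero.mpr (Nat.succ_ne_zero n)), map_one, one_smul] at h8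

/-- The Poincaré-Birkhoff-Witt map is surjective. -/
lemma pbw_surjective : Function.Surjective (nab.pbw K) := by
  intro D
  induction D using Env.induction_left with
  | one => exact ⟨1, nab.pbw_one⟩
  | add a b ha hb =>
    obtain ⟨s, rfl⟩ := ha
    obtain ⟨t, rfl⟩ := hb
    exact ⟨s + t, map_add _ _ _⟩
  | ring r a ha =>
    obtain ⟨s, rfl⟩ := ha
    exact ⟨r • s, by rw [map_smul, Env.smul_def]⟩
  | lie x a ha =>
    obtain ⟨s, rfl⟩ := ha
    induction s using sym_induction with
    | part n s hs =>
      obtain ⟨t, -, ht⟩ := nab.mul_pbw_sub_mem (K := K) hs x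
      exact ⟨t + SymmetricAlgebra.ι R L x * s, by rw [map_add, ht, sub_add_cancel]⟩
    | add s t hs ht =>
      obtain ⟨a, ha⟩ := hs
      obtain ⟨b, hb⟩ := ht
      exact ⟨a + b, by rw [map_add, map_add, mul_add, ha, hb]⟩

end ModuleConnection

end PBW

/-! ### Power series: order, derivations and fixed points -/

section PowerSeries

open MvPowerSeries

variable {σ R : Type*} [CommRing R]

variable (σ R) in
/-- The ideal of power series all of whose terms have degree at least `k`. -/
def ordIdeal (k : ℕ) : Ideal (MvPowerSeries σ R) where
  carrier := {f | ∀ m : σ →₀ ℕ, m.degree < k → coeff m f = 0}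
  add_mem' := fun hf hg m hm => by rw [map_add, hf m hm, hg m hm, add_zero]
  zero_mem' := fun m _ => map_zero _
  smul_mem' := fun g f hf m hm => by
    classical
    rw [smul_eq_mul, coeff_mul]
    refine Finset.sum_eq_zero fun p hp => ?_
    have h : p.2.degree < k := by
      rw [← Finset.HasAntidiagonal.mem_antidiagonal.mp hp, map_add] at hm
      omega
    rw [hf p.2 h, mul_zero]

lemma ordIdeal_anti {j k : ℕ} (h : j ≤ k) : ordIdeal σ R k ≤ ordIdeal σ R j :=
  fun _ hf m hm => hf m (hm.trans_le h)

lemma mem_ordIdeal_zero (f : MvPowerSeries σ R) : f ∈ ordIdeal σ R 0 :=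
  fun _ hm => absurd hm (Nat.not_lt_zero _)

lemma mul_mem_ordIdeal {j k : ℕ} {f g : MvPowerSeries σ R} (hf : f ∈ ordIdeal σ R j)
    (hg : g ∈ ordIdeal σ R k) : f * g ∈ ordIdeal σ R (j + k) := by
  classical
  intro m hm
  rw [coeff_mul]
  refine Finset.sum_eq_zero fun p hp => ?_
  rw [← Finset.HasAntidiagonal.mem_antidiagonal.mp hp, map_add] at hm
  by_cases h : p.1.degree < j
  · rw [hf p.1 h, zero_mul]
  · rw [hg p.2 (by omega), mul_zero]

lemma X_mem_ordIdeal (i : σ) : (X i : MvPowerSeries σ R) ∈ ordIdeal σ R 1 := by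
  intro m hm
  have h0 : m = 0 := (Finsupp.degree_eq_zero_iff m).mp (Nat.lt_one_iff.mp hm)
  subst h0
  exact constantCoeff_X i

lemma eq_zero_of_mem_ordIdeal {f : MvPowerSeries σ R} (hf : ∀ k, f ∈ ordIdeal σ R k) : f = 0 :=
  MvPowerSeries.ext fun m => hf (m.degree + 1) m (Nat.lt_succ_self _)

lemma pderiv_mem_ordIdeal {k : ℕ} {f : MvPowerSeries σ R} (hf : f ∈ ordIdeal σ R (k + 1))
    (i : σ) : pderiv R i f ∈ ordIdeal σ R k := by
  intro m hm
  rw [coeff_pderiv, hf _ (by rw [map_add, Finsupp.degree_single]; omega), zero_mul]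

/-- A map on families of power series which raises the order of differences has a fixed point, the
limit of its iterates at zero. -/
lemma exists_fixedPoint {ι : Type*} (Ψ : (ι → MvPowerSeries σ R) → (ι → MvPowerSeries σ R))
    (h1 : ∀ a, (∀ i, a i ∈ ordIdeal σ R 1) → ∀ i, Ψ a i ∈ ordIdeal σ R 1)
    (h2 : ∀ k a b, (∀ i, a i ∈ ordIdeal σ R 1) → (∀ i, b i ∈ ordIdeal σ R 1) →
      (∀ i, a i - b i ∈ ordIdeal σ R k) → ∀ i, Ψ a i - Ψ b i ∈ ordIdeal σ R (k + 1)) :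
    ∃ a, (∀ i, a i ∈ ordIdeal σ R 1) ∧ Ψ a = a := by
  -- `u n` is correct up to order `n`, so that the coefficients of degree `n` are those of `u n`
  let u : ℕ → ι → MvPowerSeries σ R := fun n => Ψ^[n] 0
  have u_succ : ∀ n, u (n + 1) = Ψ (u n) := fun n => Function.iterate_succ_apply' Ψ n 0
  have u_mem : ∀ n i, u n i ∈ ordIdeal σ R 1 := by
    intro n
    induction n with
    | zero => intro i; exact zero_mem _
    | succ n ih => rw [u_succ]; exact h1 _ ih
  have u_sub : ∀ n i, u (n + 1) i - u n i ∈ ordIdeal σ R (n + 1) := by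
    intro n
    induction n with
    | zero => intro i; exact sub_mem (u_mem 1 i) (u_mem 0 i)
    | succ n ih =>
      rw [u_succ (n + 1), u_succ n]
      exact h2 (n + 1) _ _ (by rw [← u_succ]; exact u_mem _) (u_mem n) (by rw [← u_succ]; exact ih)
  have u_sub' : ∀ n k i, u (n + k) i - u n i ∈ ordIdeal σ R (n + 1) := by
    intro n k i
    induction k with
    | zero => rw [add_zero, sub_self]; exact zero_mem _
    | succ k ih =>
      rw [← sub_add_sub_cancel (u (n + (k + 1)) i) (u (n + k) i)]
      exact add_mem (ordIdeal_anti (by omega) (u_sub (n + k) i)) ih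
  let a : ι → MvPowerSeries σ R := fun i m => coeff m (u m.degree i)
  have a_sub : ∀ n i, a i - u n i ∈ ordIdeal σ R (n + 1) := by
    intro n i m hm
    have h := u_sub' m.degree (n - m.degree) i m (Nat.lt_succ_self _)
    rw [Nat.add_sub_cancel' (Nat.lt_succ_iff.mp hm), map_sub, sub_eq_zero] at h
    rw [map_sub, h]
    exact sub_self _
  have a_mem : ∀ i, a i ∈ ordIdeal σ R 1 := fun i => by
    have h := add_mem (a_sub 0 i) (u_mem 0 i)
    rwa [sub_add_cancel] at h
  refine ⟨a, a_mem, funext fun i => ?_⟩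
  refine sub_eq_zero.mp (eq_zero_of_mem_ordIdeal fun k => ?_)
  have h3 := h2 (k + 1) _ _ a_mem (u_mem k) (a_sub k) i
  have h4 := sub_mem h3 (a_sub (k + 1) i)
  rw [u_succ] at h4
  rw [sub_sub_sub_cancel_right] at h4
  exact ordIdeal_anti (by omega) h4

variable {K : Type*} [Field K] [Algebra K R]

variable (σ) in
/-- The action of a derivation of `R` on the coefficients of power series. -/
def coeffDer (d : Derivation K R R) : Derivation K (MvPowerSeries σ R) (MvPowerSeries σ R) :=
  Derivation.mk'
    { toFun := fun f m => d (coeff m f)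
      map_add' := fun f g => by ext m; exact map_add d _ _
      map_smul' := fun k f => by ext m; exact d.map_smul k _ }
    (fun f g => by
      classical
      ext m
      change d (coeff m (f * g)) = coeff m
        (f * (show MvPowerSeries σ R from fun m => d (coeff m g)) +
        g * (show MvPowerSeries σ R from fun m => d (coeff m f)))
      rw [mul_comm g, map_add, coeff_mul, coeff_mul, coeff_mul, map_sum, ← Finset.sum_add_distrib]
      refine Finset.sum_congr rfl fun p _ => ?_
      rw [d.leibniz]
      change _ = coeff p.1 f * d (coeff p.2 g) + d (coeff p.1 f) * coeff p.2 g
      simp only [smul_eq_mul]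
      ring)

@[simp] lemma coeff_coeffDer (d : Derivation K R R) (f : MvPowerSeries σ R) (m : σ →₀ ℕ) :
    coeff m (coeffDer σ d f) = d (coeff m f) := rfl

lemma coeffDer_mem_ordIdeal (d : Derivation K R R) {k : ℕ} {f : MvPowerSeries σ R}
    (hf : f ∈ ordIdeal σ R k) : coeffDer σ d f ∈ ordIdeal σ R k := by
  intro m hm
  rw [coeff_coeffDer, hf m hm, map_zero]

@[simp] lemma coeffDer_C (d : Derivation K R R) (a : R) :
    coeffDer σ d (C a) = C (d a) := by
  classical
  ext m
  rw [coeff_coeffDer, coeff_C, coeff_C]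
  split_ifs <;> simp

@[simp] lemma coeffDer_X (d : Derivation K R R) (i : σ) :
    coeffDer σ d (X i) = 0 := by
  classical
  ext m
  rw [coeff_coeffDer, coeff_X]
  split_ifs <;> simp

variable [Fintype σ]

/-- The Euler derivation, multiplication by the degree. -/
lemma coeff_sum_X_mul_pderiv (f : MvPowerSeries σ R) (m : σ →₀ ℕ) :
    coeff m (∑ i, X i * pderiv R i f) = (m.degree : R) * coeff m f := by
  classical
  have h : ∀ i, coeff m (X i * pderiv R i f) = (m i : R) * coeff m f := by
    intro i
    by_cases hi : m i = 0
    · rw [hi, Nat.cast_zero, zero_mul]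
      rw [X, coeff_monomial_mul, if_neg]
      intro h
      have := h i
      simp [hi] at this
    · have hm : Finsupp.single i 1 + (m - Finsupp.single i 1) = m := by
        refine add_tsub_cancel_of_le ?_
        simpa [Finsupp.single_le_iff] using Nat.one_le_iff_ne_zero.mpr hi
      rw [← hm, X, coeff_add_monomial_mul, coeff_pderiv, add_comm (m - _), hm, one_mul]
      have e : ((m - Finsupp.single i 1 : σ →₀ ℕ) i : R) + 1 = (m i : R) := by
        rw [Finsupp.tsub_apply, Finsupp.single_eq_same]
        exact_mod_cast congrArg (Nat.cast (R := R))
          (Nat.sub_add_cancel (Nat.one_le_iff_ne_zero.mpr hi))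
      rw [e, mul_comm]
  rw [map_sum, Finset.sum_congr rfl fun i _ => h i, ← Finset.sum_mul, Finsupp.degree_eq_sum]
  push_cast
  rfl

/-- If the sum of the Euler derivation and of multiplication by `j` raises the order of `f`, then
`f` has a higher order. -/
lemma mem_ordIdeal_succ_of_euler (K : Type*) [Field K] [CharZero K] [Algebra K R]
    {k j : ℕ} (hkj : k + j ≠ 0) {f : MvPowerSeries σ R}
    (hf : f ∈ ordIdeal σ R k)
    (h : (∑ i, X i * pderiv R i f) + (j : MvPowerSeries σ R) * f ∈ ordIdeal σ R (k + 1)) :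
    f ∈ ordIdeal σ R (k + 1) := by
  intro m hm
  by_cases hk : m.degree < k
  · exact hf m hk
  · have hmk : m.degree = k := by omega
    have h1 := h m hm
    rw [map_add, coeff_sum_X_mul_pderiv, ← map_natCast (C (σ := σ) (R := R)), coeff_C_mul,
      ← add_mul, hmk] at h1
    refine ModuleConnection.eq_of_natCast_smul (R := R) K hkj ?_
    rw [smul_zero, smul_eq_mul, Nat.cast_add, h1]

end PowerSeries

/-! ### Radial gauges -/

section RadialGauge

open MvPowerSeries Module

variable {K R L σ : Type*} [Field K] [CommRing R] [Algebra K R] [LieRing L] [LieAlgebra K L]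
  [Module R L] [LieRingModule L R] [LieRinehartRing R L] [LieRinehartAlgebra K R L]
  [Fintype σ] [DecidableEq σ] (e : Basis σ R L)

/-- The structure functions of a basis, `⁅e_i, e_j⁆ = ∑_l c_{ij}^l e_l`. -/
def strConst (i j l : σ) : R := e.repr ⁅e i, e j⁆ l

lemma strConst_anti (i j l : σ) : strConst e i j l = - strConst e j i l := by
  rw [strConst, ← lie_skew, map_neg]; rfl

lemma sum_strConst (i j : σ) : ∑ l, strConst e i j l • e l = ⁅e i, e j⁆ := e.sum_repr _

lemma repr_lie_lie (i j k m : σ) : e.repr ⁅e i, ⁅e j, e k⁆⁆ m =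
    ⁅e i, strConst e j k m⁆ + ∑ l, strConst e j k l * strConst e i l m := by
  rw [← sum_strConst e j k, lie_sum, map_sum, Finsupp.finsetSum_apply]
  simp only [LieRinehartRing.leibniz_smul_right, map_add, map_smul, Finsupp.add_apply,
    Finsupp.smul_apply, smul_eq_mul, Basis.repr_self, Finset.sum_add_distrib]
  rw [add_comm]
  congr 1
  simp [Finsupp.single_apply]

/-- The Jacobi identity in terms of structure functions. -/
lemma strConst_jacobi (i j k m : σ) :
    (⁅e i, strConst e j k m⁆ + ∑ l, strConst e j k l * strConst e i l m) +
    (⁅e j, strConst e k i m⁆ + ∑ l, strConst e k i l * strConst e j l m) +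
    (⁅e k, strConst e i j m⁆ + ∑ l, strConst e i j l * strConst e k l m) = 0 := by
  rw [← repr_lie_lie, ← repr_lie_lie, ← repr_lie_lie, ← Finsupp.add_apply, ← Finsupp.add_apply,
    ← map_add, ← map_add, lie_jacobi, map_zero]
  rfl

variable (K) in
/-- The derivation `⁅x, -⁆` of `R`, acting on the coefficients of power series. -/
def anchorDer (x : L) : Derivation K (MvPowerSeries σ R) (MvPowerSeries σ R) :=
  coeffDer σ (LieRinehartAlgebra.anchor K R L x)

@[simp] lemma anchorDer_C (x : L) (a : R) :
    anchorDer (σ := σ) K x (C a) = C ⁅x, a⁆ := coeffDer_C _ _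

@[simp] lemma anchorDer_X (x : L) (i : σ) :
    anchorDer (R := R) K x (X i) = 0 := coeffDer_X _ _

lemma anchorDer_mem (x : L) {k : ℕ} {f : MvPowerSeries σ R} (hf : f ∈ ordIdeal σ R k) :
    anchorDer K x f ∈ ordIdeal σ R k := coeffDer_mem_ordIdeal _ hf

variable (K R) in
/-- The partial derivative, as a `K`-linear derivation. -/
def partialDer (i : σ) : Derivation K (MvPowerSeries σ R) (MvPowerSeries σ R) :=
  (pderiv R i).restrictScalars K

@[simp] lemma partialDer_apply (i : σ) (f : MvPowerSeries σ R) :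
    partialDer K R i f = pderiv R i f := rfl

variable (K) in
/-- The coefficients `a_{jk}`, of positive order, of the vector fields
`E_j = ⁅e_j, -⁆ + ∂_j + ∑_k a_{jk} ∂_k` on the formal neighbourhood of the zero section of `L`. They
solve a radial differential equation, which expresses that `∑ t_j E_j` is the Euler vector field up
to the anchor, and that the relation `⁅E_i, E_j⁆ = ∑_l c_{ij}^l E_l` holds after contraction with
`∑ t_i`. -/
structure RadialGauge where
  a : σ → σ → MvPowerSeries σ R
  a_mem : ∀ j k, a j k ∈ ordIdeal σ R 1
  radial : ∀ j k, (∑ i, X i * pderiv R i (a j k)) + a j k =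
    (∑ l, (∑ i, X i * C (strConst e i j l)) * ((if l = k then 1 else 0) + a l k)) -
      (∑ i, a j i * a i k) - ∑ i, X i * anchorDer K (e i) (a j k)

/-- The radial equation determines the coefficients recursively in the order: its left hand side is
`(N + 1) a_{jk}` for the Euler derivation `N`, and its right hand side raises the order of
differences. -/
lemma exists_radialGauge [CharZero K] : Nonempty (RadialGauge K e) := by
  -- the inverse of `N + 1`, for the Euler derivation `N`
  let inv : MvPowerSeries σ R → MvPowerSeries σ R := fun f m =>
    algebraMap K R (((m.degree + 1 : ℕ) : K)⁻¹) * coeff m f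
  have inv_coeff : ∀ f m, coeff m (inv f) =
      algebraMap K R (((m.degree + 1 : ℕ) : K)⁻¹) * coeff m f := fun f m => rfl
  have inv_sub : ∀ f g, inv f - inv g = inv (f - g) := fun f g => by
    ext m
    rw [map_sub, inv_coeff, inv_coeff, inv_coeff, map_sub, mul_sub]
  have inv_mem : ∀ {k f}, f ∈ ordIdeal σ R k → inv f ∈ ordIdeal σ R k := fun hf m hm => by
    rw [inv_coeff, hf m hm, mul_zero]
  have inv_eq : ∀ f, (∑ i, X i * pderiv R i (inv f)) + inv f = f := fun f => by
    ext m
    rw [map_add, coeff_sum_X_mul_pderiv, inv_coeff, ← mul_assoc, ← add_mul]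
    have h : (m.degree : R) * algebraMap K R (((m.degree + 1 : ℕ) : K)⁻¹) +
        algebraMap K R (((m.degree + 1 : ℕ) : K)⁻¹) = 1 := by
      rw [← add_one_mul, ← Nat.cast_succ, ← map_natCast (algebraMap K R), ← map_mul,
        mul_inv_cancel₀ (Nat.cast_ne_zero.mpr (Nat.succ_ne_zero _)), map_one]
    rw [h, one_mul]
  let Φ : (σ × σ → MvPowerSeries σ R) → σ × σ → MvPowerSeries σ R := fun a p =>
    (∑ l, (∑ i, X i * C (strConst e i p.1 l)) * ((if l = p.2 then 1 else 0) + a (l, p.2))) -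
      (∑ i, a (p.1, i) * a (i, p.2)) - ∑ i, X i * anchorDer K (e i) (a p)
  have c_mem : ∀ j l, ∑ i, X i * C (strConst e i j l) ∈ ordIdeal σ R 1 := fun j l =>
    sum_mem fun i _ => Ideal.mul_mem_right _ _ (X_mem_ordIdeal i)
  have Φ_mem : ∀ a, (∀ p, a p ∈ ordIdeal σ R 1) → ∀ p, Φ a p ∈ ordIdeal σ R 1 := by
    intro a ha p
    refine sub_mem (sub_mem (sum_mem fun l _ => Ideal.mul_mem_right _ _ (c_mem _ _))
      (sum_mem fun i _ => Ideal.mul_mem_right _ _ (ha _)))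
      (sum_mem fun i _ => Ideal.mul_mem_right _ _ (X_mem_ordIdeal i))
  have Φ_sub : ∀ k a b, (∀ p, a p ∈ ordIdeal σ R 1) → (∀ p, b p ∈ ordIdeal σ R 1) →
      (∀ p, a p - b p ∈ ordIdeal σ R k) → ∀ p, Φ a p - Φ b p ∈ ordIdeal σ R (k + 1) := by
    intro k a b ha hb hab p
    have e1 : Φ a p - Φ b p =
        (∑ l, (∑ i, X i * C (strConst e i p.1 l)) * (a (l, p.2) - b (l, p.2))) -
        (∑ i, (a (p.1, i) * (a (i, p.2) - b (i, p.2)) + (b (i, p.2) * (a (p.1, i) - b (p.1, i)))))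
        - ∑ i, X i * anchorDer K (e i) (a p - b p) := by
      simp only [Φ, map_sub, mul_sub, Finset.sum_sub_distrib, mul_add, Finset.sum_add_distrib]
      have h1 : ∑ i, b (i, p.2) * b (p.1, i) = ∑ i, b (p.1, i) * b (i, p.2) :=
        Finset.sum_congr rfl fun i _ => mul_comm _ _
      have h2 : ∑ i, b (i, p.2) * a (p.1, i) = ∑ i, a (p.1, i) * b (i, p.2) :=
        Finset.sum_congr rfl fun i _ => mul_comm _ _
      rw [h1, h2]
      ring
    rw [e1, add_comm k 1]
    refine sub_mem (sub_mem (sum_mem fun l _ => mul_mem_ordIdeal (c_mem _ _) (hab _))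
      (sum_mem fun i _ => add_mem (mul_mem_ordIdeal (ha _) (hab _))
        (mul_mem_ordIdeal (hb _) (hab _))))
      (sum_mem fun i _ => mul_mem_ordIdeal (X_mem_ordIdeal i) (anchorDer_mem _ (hab _)))
  obtain ⟨a, ha, haeq⟩ := exists_fixedPoint (fun a p => inv (Φ a p))
    (fun a ha p => inv_mem (Φ_mem a ha p))
    (fun k a b ha hb hab p => by rw [inv_sub]; exact inv_mem (Φ_sub k a b ha hb hab p))
  refine ⟨⟨fun j k => a (j, k), fun j k => ha _, fun j k => ?_⟩⟩
  have h := inv_eq (Φ a (j, k))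
  have h2 : inv (Φ a (j, k)) = a (j, k) := congrFun haeq (j, k)
  rw [h2] at h
  exact h

end RadialGauge

section RadialGauge

open MvPowerSeries Module

variable {K R L σ : Type*} [Field K] [CommRing R] [Algebra K R] [LieRing L] [LieAlgebra K L]
  [Module R L] [LieRingModule L R] [LieRinehartRing R L] [LieRinehartAlgebra K R L]
  [Fintype σ] [DecidableEq σ] {e : Basis σ R L}

lemma eq_zero_of_add_self (K : Type*) [Field K] [CharZero K] [Algebra K R]
    {f : MvPowerSeries σ R} (h : f + f = 0) : f = 0 := by
  refine ModuleConnection.eq_of_natCast_smul (R := R) K two_ne_zero ?_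
  rw [smul_zero, Nat.cast_smul_eq_nsmul, two_nsmul, h]

namespace RadialGauge

variable (G : RadialGauge K e)

/-- The components `E_j(t_k)` of the vector fields of a radial gauge. -/
def A (j k : σ) : MvPowerSeries σ R := (if j = k then 1 else 0) + G.a j k

/-- The vector fields `E_j = ⁅e_j, -⁆ + ∑_k A_{jk} ∂_k` of a radial gauge. -/
def E (j : σ) : Derivation K (MvPowerSeries σ R) (MvPowerSeries σ R) :=
  anchorDer K (e j) + ∑ k, G.A j k • partialDer K R k

lemma E_apply (j : σ) (f : MvPowerSeries σ R) :
    G.E j f = anchorDer K (e j) f + ∑ k, G.A j k * pderiv R k f := by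
  rw [E, Derivation.add_apply]
  congr 1
  have h := map_sum (Derivation.coeFnAddMonoidHom :
    Derivation K (MvPowerSeries σ R) (MvPowerSeries σ R) →+ _)
    (fun k => G.A j k • partialDer K R k) Finset.univ
  have h2 := congrFun h f
  rw [Finset.sum_apply] at h2
  exact h2

lemma E_X (j k : σ) : G.E j (X k) = G.A j k := by
  rw [E_apply, anchorDer_X, zero_add]
  simp [pderiv_X, Pi.single_apply]

lemma E_C (j : σ) (a : R) : G.E j (C a) = C ⁅e j, a⁆ := by
  rw [E_apply, anchorDer_C]
  simp

lemma sum_A_mul (j : σ) (f : σ → MvPowerSeries σ R) :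
    ∑ k, G.A j k * f k = f j + ∑ k, G.a j k * f k := by
  simp [A, add_mul, Finset.sum_add_distrib]

lemma sum_mul_A (j : σ) (f : σ → MvPowerSeries σ R) :
    ∑ k, f k * G.A k j = f j + ∑ k, f k * G.a k j := by
  simp [A, mul_add, Finset.sum_add_distrib]

/-- The leading term of `E_j` is `∂_j`. -/
lemma E_sub_pderiv_mem (j : σ) {k : ℕ} {f : MvPowerSeries σ R} (hf : f ∈ ordIdeal σ R (k + 1)) :
    G.E j f - pderiv R j f ∈ ordIdeal σ R (k + 1) := by
  rw [E_apply, sum_A_mul, add_comm k 1]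
  rw [add_comm k 1] at hf
  have e1 : anchorDer K (e j) f + (pderiv R j f + ∑ k, G.a j k * pderiv R k f) - pderiv R j f =
    anchorDer K (e j) f + ∑ k, G.a j k * pderiv R k f := by ring
  rw [e1]
  refine add_mem (anchorDer_mem _ hf) (sum_mem fun i _ => mul_mem_ordIdeal (G.a_mem _ _) ?_)
  rw [add_comm] at hf
  exact pderiv_mem_ordIdeal hf i

variable [CharZero K]

/-- The gauge condition `∑ t_j a_{jk} = 0`. By the radial equation the Euler derivative of the left
hand side is a combination of the same expressions with coefficients of positive order, so that they
vanish to all orders. -/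
lemma sum_X_mul_a (k : σ) : ∑ j, X j * G.a j k = 0 := by
  -- the structure functions are antisymmetric, and so drop out of the contraction
  have hc : ∀ f : σ → MvPowerSeries σ R,
      ∑ j, X j * ∑ l, (∑ i, X i * C (strConst e i j l)) * f l = 0 := by
    intro f
    have h1 : ∑ j, X j * ∑ l, (∑ i, X i * C (strConst e i j l)) * f l =
        ∑ j, ∑ i, ∑ l, X j * X i * C (strConst e i j l) * f l := by
      refine Finset.sum_congr rfl fun j _ => ?_
      rw [Finset.sum_comm, Finset.mul_sum]
      refine Finset.sum_congr rfl fun l _ => ?_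
      rw [Finset.sum_mul, Finset.mul_sum]
      exact Finset.sum_congr rfl fun i _ => by ring
    refine eq_zero_of_add_self K ?_
    rw [h1]
    nth_rewrite 1 [Finset.sum_comm]
    rw [← Finset.sum_add_distrib]
    refine Finset.sum_eq_zero fun j _ => ?_
    rw [← Finset.sum_add_distrib]
    refine Finset.sum_eq_zero fun i _ => ?_
    rw [← Finset.sum_add_distrib]
    refine Finset.sum_eq_zero fun l _ => ?_
    rw [strConst_anti e j i, map_neg]
    ring
  have hN : ∀ k, ∑ i, X i * pderiv R i (∑ j, X j * G.a j k) =
      -(∑ i, (∑ j, X j * G.a j i) * G.a i k) -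
        ∑ i, X i * anchorDer K (e i) (∑ j, X j * G.a j k) := by
    intro k
    have h1 : ∀ i, pderiv R i (∑ j, X j * G.a j k) =
        G.a i k + ∑ j, X j * pderiv R i (G.a j k) := by
      intro i
      rw [map_sum, Finset.sum_congr rfl fun j _ => Derivation.leibniz _ _ _,
        Finset.sum_add_distrib, add_comm]
      congr 1
      simp [pderiv_X, Pi.single_apply]
    have h2 : ∀ i, anchorDer K (e i) (∑ j, X j * G.a j k) =
        ∑ j, X j * anchorDer K (e i) (G.a j k) := by
      intro i
      rw [map_sum]
      exact Finset.sum_congr rfl fun j _ => by rw [Derivation.leibniz, anchorDer_X]; simp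
    have h3 : ∑ i, X i * pderiv R i (∑ j, X j * G.a j k) =
        ∑ j, X j * ((∑ i, X i * pderiv R i (G.a j k)) + G.a j k) := by
      simp only [h1, mul_add, Finset.sum_add_distrib, Finset.mul_sum]
      rw [add_comm, Finset.sum_comm]
      congr 1
      exact Finset.sum_congr rfl fun j _ => Finset.sum_congr rfl fun i _ => by ring
    rw [h3]
    simp only [G.radial, mul_sub, Finset.sum_sub_distrib, hc, h2]
    have h4 : ∑ j, X j * ∑ i, G.a j i * G.a i k = ∑ i, (∑ j, X j * G.a j i) * G.a i k := by
      simp only [Finset.sum_mul, Finset.mul_sum]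
      rw [Finset.sum_comm]
      exact Finset.sum_congr rfl fun j _ => Finset.sum_congr rfl fun i _ => (mul_assoc _ _ _).symm
    have h5 : ∑ j, X j * ∑ i, X i * anchorDer K (e i) (G.a j k) =
        ∑ i, X i * ∑ j, X j * anchorDer K (e i) (G.a j k) := by
      simp only [Finset.mul_sum]
      rw [Finset.sum_comm]
      exact Finset.sum_congr rfl fun j _ => Finset.sum_congr rfl fun i _ => mul_left_comm _ _ _
    rw [zero_sub, h4, h5]
  have key : ∀ n k, ∑ j, X j * G.a j k ∈ ordIdeal σ R (n + 1) := by
    intro n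
    induction n with
    | zero => exact fun k => sum_mem fun j _ => Ideal.mul_mem_right _ _ (X_mem_ordIdeal j)
    | succ n ih =>
      intro k
      refine mem_ordIdeal_succ_of_euler (j := 0) K (by omega) (ih k) ?_
      rw [Nat.cast_zero, zero_mul, add_zero, hN k]
      refine sub_mem (neg_mem (sum_mem fun i _ => mul_mem_ordIdeal (ih i) (G.a_mem _ _)))
        (sum_mem fun i _ => ?_)
      rw [add_comm (n + 1) 1]
      exact mul_mem_ordIdeal (X_mem_ordIdeal i) (anchorDer_mem _ (ih k))
  exact eq_zero_of_mem_ordIdeal fun n => ordIdeal_anti (Nat.le_succ n) (key n k)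

lemma sum_X_mul_A (k : σ) : ∑ j, X j * G.A j k = X k := by
  rw [sum_mul_A, sum_X_mul_a, add_zero]

/-- Contraction of the vector fields with the coordinates gives the Euler vector field, up to the
anchor. -/
lemma sum_X_mul_E (f : MvPowerSeries σ R) :
    ∑ i, X i * G.E i f = (∑ i, X i * anchorDer K (e i) f) + ∑ i, X i * pderiv R i f := by
  simp only [E_apply, mul_add, Finset.sum_add_distrib, Finset.mul_sum]
  rw [Finset.sum_comm (s := Finset.univ) (t := Finset.univ)]
  congr 1
  refine Finset.sum_congr rfl fun k _ => ?_
  rw [← G.sum_X_mul_A k, Finset.sum_mul]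
  refine Finset.sum_congr rfl fun i _ => ?_
  rw [mul_assoc]

/-- The radial equation in terms of the components `A_{jk}`. -/
lemma sum_X_mul_E_A (j k : σ) : ∑ i, X i * G.E i (G.A j k) =
    G.A j k - (∑ i, G.A j i * G.A i k) +
      ∑ l, (∑ i, X i * C (strConst e i j l)) * G.A l k := by
  have hAa : ∀ i, G.E i (G.A j k) = G.E i (G.a j k) := by
    intro i
    rw [A, map_add]
    split_ifs <;> simp
  have h1 : ∑ i, X i * G.E i (G.A j k) = ∑ i, X i * G.E i (G.a j k) :=
    Finset.sum_congr rfl fun i _ => by rw [hAa]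
  have hr := G.radial j k
  have h2 : ∑ l, (∑ i, X i * C (strConst e i j l)) * ((if l = k then 1 else 0) + G.a l k) =
    ∑ l, (∑ i, X i * C (strConst e i j l)) * G.A l k := rfl
  rw [h2] at hr
  rw [h1, sum_X_mul_E, sum_A_mul, A]
  have h3 : ∑ i, G.a j i * G.A i k = G.a j k + ∑ i, G.a j i * G.a i k := sum_mul_A G k _
  rw [h3]
  linear_combination hr

end RadialGauge

end RadialGauge

/-! ### Flatness of radial gauges -/

section Flatness

open MvPowerSeries Module

variable {K R L σ : Type*} [Field K] [CommRing R] [Algebra K R] [LieRing L] [LieAlgebra K L]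
  [Module R L] [LieRingModule L R] [LieRinehartRing R L] [LieRinehartAlgebra K R L]
  [Fintype σ] [DecidableEq σ] {e : Basis σ R L}

lemma pderiv_comm (i j : σ) (f : MvPowerSeries σ R) :
    pderiv R i (pderiv R j f) = pderiv R j (pderiv R i f) := by
  ext m
  simp only [coeff_pderiv, Finsupp.add_apply, Nat.cast_add]
  rw [add_right_comm]
  by_cases h : i = j
  · subst h; ring
  · rw [Finsupp.single_eq_of_ne h, Finsupp.single_eq_of_ne (Ne.symm h)]
    push_cast
    ring

lemma anchorDer_pderiv (x : L) (i : σ) (f : MvPowerSeries σ R) :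
    anchorDer K x (pderiv R i f) = pderiv R i (anchorDer K x f) := by
  ext m
  rw [anchorDer, coeff_coeffDer, coeff_pderiv, coeff_pderiv, coeff_coeffDer]
  rw [Derivation.leibniz]
  have h : LieRinehartAlgebra.anchor K R L x ((m i : R) + 1) = 0 := by
    rw [← Nat.cast_succ]
    exact Derivation.map_natCast _ _
  rw [h, smul_zero, zero_add, smul_eq_mul, mul_comm]

lemma anchorDer_comm (j k : σ) (f : MvPowerSeries σ R) :
    anchorDer K (e j) (anchorDer K (e k) f) = anchorDer K (e k) (anchorDer K (e j) f) +
      ∑ l, C (strConst e j k l) * anchorDer K (e l) f := by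
  ext m
  simp only [map_add, map_sum, coeff_C_mul, anchorDer, coeff_coeffDer,
    LieRinehartAlgebra.anchor_apply]
  have h : ∀ a : R, ⁅⁅e j, e k⁆, a⁆ = ∑ l, strConst e j k l * ⁅e l, a⁆ := by
    intro a
    rw [← sum_strConst e j k, sum_lie]
    exact Finset.sum_congr rfl fun l _ => LieRinehartRing.lie_smul_eq_mul _ _ _
  rw [← h, lie_lie, add_sub_cancel]

namespace RadialGauge

variable (G : RadialGauge K e)

/-- The components of the curvature `⁅E_j, E_k⁆ - ∑_l c_{jk}^l E_l`. -/
def w (j k m : σ) : MvPowerSeries σ R :=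
  G.E j (G.A k m) - G.E k (G.A j m) - ∑ l, C (strConst e j k l) * G.A l m

lemma w_anti (j k m : σ) : G.w j k m = - G.w k j m := by
  have h : ∑ l, C (strConst e j k l) * G.A l m = -∑ l, C (strConst e k j l) * G.A l m := by
    rw [← Finset.sum_neg_distrib]
    exact Finset.sum_congr rfl fun l _ => by rw [strConst_anti, map_neg, neg_mul]
  rw [w, w, h]
  ring

/-- The curvature `⁅E_j, E_k⁆ - ∑_l c_{jk}^l E_l` has no component along `R`, since the anchor is a
morphism of Lie algebras: it is the vector field with components `w_{jk}`. -/
lemma comm_apply (j k : σ) (f : MvPowerSeries σ R) :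
    G.E j (G.E k f) = G.E k (G.E j f) + (∑ l, C (strConst e j k l) * G.E l f) +
      ∑ q, G.w j k q * pderiv R q f := by
  have h1 : ∀ j k, G.E j (G.E k f) = anchorDer K (e j) (anchorDer K (e k) f) +
      (∑ p, G.A j p * pderiv R p (anchorDer K (e k) f)) +
      ((∑ q, G.A k q * pderiv R q (anchorDer K (e j) f)) +
      (∑ q, ∑ p, G.A k q * (G.A j p * pderiv R p (pderiv R q f))) +
      ∑ q, pderiv R q f * G.E j (G.A k q)) := by
    intro j k
    have e1 : ∀ q, G.E j (G.A k q * pderiv R q f) = G.A k q * pderiv R q (anchorDer K (e j) f) +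
        (∑ p, G.A k q * (G.A j p * pderiv R p (pderiv R q f))) +
        pderiv R q f * G.E j (G.A k q) := fun q => by
      rw [Derivation.leibniz, smul_eq_mul, smul_eq_mul, G.E_apply j (pderiv R q f),
        anchorDer_pderiv, mul_add, Finset.mul_sum]
    rw [G.E_apply k f, map_add, map_sum, G.E_apply j (anchorDer K (e k) f),
      Finset.sum_congr rfl fun q _ => e1 q, Finset.sum_add_distrib, Finset.sum_add_distrib]
  have h2 : ∑ q, ∑ p, G.A k q * (G.A j p * pderiv R p (pderiv R q f)) =
      ∑ q, ∑ p, G.A j q * (G.A k p * pderiv R p (pderiv R q f)) := by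
    rw [Finset.sum_comm]
    refine Finset.sum_congr rfl fun q _ => Finset.sum_congr rfl fun p _ => ?_
    rw [pderiv_comm]
    ring
  have h3 : ∑ q, G.w j k q * pderiv R q f = (∑ q, pderiv R q f * G.E j (G.A k q)) -
      (∑ q, pderiv R q f * G.E k (G.A j q)) -
      ∑ q, ∑ l, C (strConst e j k l) * (G.A l q * pderiv R q f) := by
    rw [← Finset.sum_sub_distrib, ← Finset.sum_sub_distrib]
    refine Finset.sum_congr rfl fun q _ => ?_
    rw [w, sub_mul, sub_mul, Finset.sum_mul, mul_comm (pderiv R q f), mul_comm (pderiv R q f)]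
    congr 1
    exact Finset.sum_congr rfl fun l _ => mul_assoc _ _ _
  have h4 : ∑ l, C (strConst e j k l) * G.E l f =
      (∑ l, C (strConst e j k l) * anchorDer K (e l) f) +
      ∑ q, ∑ l, C (strConst e j k l) * (G.A l q * pderiv R q f) := by
    rw [Finset.sum_comm, ← Finset.sum_add_distrib]
    exact Finset.sum_congr rfl fun l _ => by rw [E_apply, mul_add, Finset.mul_sum]
  rw [h1 j k, h1 k j, anchorDer_comm, h2, h3, h4]
  generalize (∑ q, ∑ p, G.A j q * (G.A k p * pderiv R p (pderiv R q f))) = t1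
  generalize (∑ q, pderiv R q f * G.E j (G.A k q)) = t2
  generalize (∑ q, pderiv R q f * G.E k (G.A j q)) = t3
  generalize (∑ q, ∑ l, C (strConst e j k l) * (G.A l q * pderiv R q f)) = t4
  generalize (∑ l, C (strConst e j k l) * anchorDer K (e l) f) = t5
  abel

/-- The curvature as a vector field. -/
def curv (j k : σ) (f : MvPowerSeries σ R) : MvPowerSeries σ R := ∑ q, G.w j k q * pderiv R q f

lemma curv_eq (j k : σ) (f : MvPowerSeries σ R) :
    G.curv j k f = G.E j (G.E k f) - G.E k (G.E j f) - ∑ l, C (strConst e j k l) * G.E l f := by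
  rw [comm_apply, curv]
  ring

lemma curv_X (j k m : σ) : G.curv j k (X m) = G.w j k m := by
  simp [curv, pderiv_X, Pi.single_apply]

/-- The second Bianchi identity, a consequence of the Jacobi identity in `L`. -/
lemma bianchi (i j k : σ) (f : MvPowerSeries σ R) :
    (G.E i (G.curv j k f) - G.curv j k (G.E i f) + ∑ l, C (strConst e j k l) * G.curv i l f) +
    (G.E j (G.curv k i f) - G.curv k i (G.E j f) + ∑ l, C (strConst e k i l) * G.curv j l f) +
    (G.E k (G.curv i j f) - G.curv i j (G.E k f) + ∑ l, C (strConst e i j l) * G.curv k l f) =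
      0 := by
  have h : ∀ i j k, G.E i (G.curv j k f) - G.curv j k (G.E i f) +
      ∑ l, C (strConst e j k l) * G.curv i l f =
      G.E i (G.E j (G.E k f)) - G.E i (G.E k (G.E j f)) - G.E j (G.E k (G.E i f)) +
        G.E k (G.E j (G.E i f)) -
        ∑ m, C (⁅e i, strConst e j k m⁆ + ∑ l, strConst e j k l * strConst e i l m) * G.E m f := by
    intro i j k
    have h1 : ∑ m, C (⁅e i, strConst e j k m⁆ + ∑ l, strConst e j k l * strConst e i l m) *
        G.E m f = (∑ m, C ⁅e i, strConst e j k m⁆ * G.E m f) +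
          ∑ l, C (strConst e j k l) * ∑ m, C (strConst e i l m) * G.E m f := by
      simp only [map_add, map_sum, map_mul, add_mul, Finset.sum_add_distrib, Finset.sum_mul,
        Finset.mul_sum]
      rw [Finset.sum_comm]
      simp only [mul_assoc]
    rw [h1]
    simp only [curv_eq, map_sub, map_sum, Derivation.leibniz, E_C, smul_eq_mul, mul_sub,
      Finset.sum_sub_distrib, Finset.sum_add_distrib]
    have h2 : ∑ l, G.E l f * C ⁅e i, strConst e j k l⁆ = ∑ l, C ⁅e i, strConst e j k l⁆ * G.E l f :=
      Finset.sum_congr rfl fun l _ => mul_comm _ _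
    rw [h2]
    ring
  rw [h, h, h]
  have h3 : (∑ m, C (⁅e i, strConst e j k m⁆ + ∑ l, strConst e j k l * strConst e i l m) * G.E m f)
      + (∑ m, C (⁅e j, strConst e k i m⁆ + ∑ l, strConst e k i l * strConst e j l m) * G.E m f)
      + (∑ m, C (⁅e k, strConst e i j m⁆ + ∑ l, strConst e i j l * strConst e k l m) * G.E m f)
      = 0 := by
    rw [← Finset.sum_add_distrib, ← Finset.sum_add_distrib]
    refine Finset.sum_eq_zero fun m _ => ?_
    rw [← add_mul, ← add_mul, ← map_add, ← map_add, strConst_jacobi, map_zero, zero_mul]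
  linear_combination -h3

variable [CharZero K]

/-- The curvature of a radial gauge vanishes after contraction with the coordinates. -/
lemma sum_X_mul_w (k m : σ) : ∑ j, X j * G.w j k m = 0 := by
  have h1 : ∑ j, X j * G.E k (G.A j m) = G.A k m - ∑ j, G.A k j * G.A j m := by
    have h := congrArg (G.E k) (G.sum_X_mul_A m)
    rw [map_sum, E_X] at h
    simp only [Derivation.leibniz, E_X, smul_eq_mul, Finset.sum_add_distrib] at h
    rw [← h]
    rw [add_sub_assoc, left_eq_add, sub_eq_zero]
    exact Finset.sum_congr rfl fun j _ => mul_comm _ _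
  have h2 : ∑ j, X j * ∑ l, C (strConst e j k l) * G.A l m =
      ∑ l, (∑ i, X i * C (strConst e i k l)) * G.A l m := by
    simp only [Finset.mul_sum, Finset.sum_mul, mul_assoc]
    exact Finset.sum_comm
  simp only [w, mul_sub, Finset.sum_sub_distrib]
  rw [sum_X_mul_E_A, h1, h2]
  ring

lemma sum_X_mul_w' (k m : σ) : ∑ j, X j * G.w k j m = 0 := by
  rw [← neg_eq_zero, ← Finset.sum_neg_distrib, ← G.sum_X_mul_w k m]
  exact Finset.sum_congr rfl fun j _ => by rw [w_anti, mul_neg, neg_neg]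

lemma sum_X_mul_E_w (j k m : σ) : ∑ i, X i * G.E j (G.w k i m) = - ∑ i, G.A j i * G.w k i m := by
  have h := congrArg (G.E j) (G.sum_X_mul_w' k m)
  rw [map_sum, map_zero] at h
  simp only [Derivation.leibniz, E_X, smul_eq_mul, Finset.sum_add_distrib] at h
  rw [eq_neg_iff_add_eq_zero, ← h]
  congr 1
  exact Finset.sum_congr rfl fun i _ => mul_comm _ _

lemma sum_X_mul_curv (k : σ) (f : MvPowerSeries σ R) : ∑ i, X i * G.curv k i f = 0 := by
  simp only [curv, Finset.mul_sum]
  rw [Finset.sum_comm]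
  refine Finset.sum_eq_zero fun q _ => ?_
  simp only [← mul_assoc]
  rw [← Finset.sum_mul, sum_X_mul_w', zero_mul]

lemma sum_X_mul_curv_A (j k m : σ) :
    ∑ i, X i * G.curv j k (G.A i m) = - ∑ i, G.w j k i * G.a i m := by
  have h1 : ∀ q, ∑ i, X i * pderiv R q (G.A i m) = pderiv R q (X m) - G.A q m := by
    intro q
    have h := congrArg (pderiv R q) (G.sum_X_mul_A m)
    rw [map_sum] at h
    simp only [Derivation.leibniz, smul_eq_mul, Finset.sum_add_distrib] at h
    rw [← h]
    simp [pderiv_X, Pi.single_apply]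
  have h2 : ∀ q, pderiv R q (X m) - G.A q m = - G.a q m := by
    intro q
    rw [A, pderiv_X, Pi.single_apply]
    simp [eq_comm]
  simp only [curv, Finset.mul_sum]
  rw [Finset.sum_comm, ← Finset.sum_neg_distrib]
  refine Finset.sum_congr rfl fun q _ => ?_
  rw [← mul_neg, ← h2, ← h1, Finset.mul_sum]
  exact Finset.sum_congr rfl fun i _ => by ring

/-- The radial component of the Bianchi identity. -/
lemma euler_w (j k m : σ) :
    (∑ i, X i * pderiv R i (G.w j k m)) + ((2 : ℕ) : MvPowerSeries σ R) * G.w j k m =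
      -(∑ i, X i * anchorDer K (e i) (G.w j k m)) - (∑ i, G.w j k i * G.a i m) +
      (∑ i, G.a j i * G.w k i m) - (∑ i, G.a k i * G.w j i m) -
      ∑ i, X i * ((∑ l, C (strConst e j k l) * G.w i l m) +
        (∑ l, C (strConst e k i l) * G.w j l m) + ∑ l, C (strConst e i j l) * G.w k l m) := by
  have h0 : ∑ i, X i * ((G.E i (G.w j k m) - G.curv j k (G.A i m) +
      ∑ l, C (strConst e j k l) * G.w i l m) +
      (G.E j (G.w k i m) - G.curv k i (G.A j m) + ∑ l, C (strConst e k i l) * G.w j l m) +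
      (-G.E k (G.w j i m) + G.curv j i (G.A k m) + ∑ l, C (strConst e i j l) * G.w k l m)) = 0 := by
    refine Finset.sum_eq_zero fun i _ => ?_
    have h := G.bianchi i j k (X m)
    simp only [curv_X, E_X] at h
    have h5 : G.curv i j (G.A k m) = - G.curv j i (G.A k m) := by
      rw [curv, curv, ← Finset.sum_neg_distrib]
      exact Finset.sum_congr rfl fun q _ => by rw [w_anti, neg_mul]
    rw [w_anti G i j, map_neg, h5, sub_neg_eq_add] at h
    rw [h, mul_zero]
  simp only [mul_add, mul_sub, mul_neg, Finset.sum_add_distrib, Finset.sum_sub_distrib,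
    Finset.sum_neg_distrib] at h0 ⊢
  rw [sum_X_mul_E, sum_X_mul_E_w, sum_X_mul_E_w, sum_X_mul_curv, sum_X_mul_curv,
    sum_X_mul_curv_A, sum_A_mul, sum_A_mul, w_anti G k j] at h0
  rw [Nat.cast_ofNat]
  linear_combination h0

/-- The curvature of a radial gauge vanishes: by the radial component of the Bianchi identity, its
lowest order term is killed by the sum of the Euler derivation and of multiplication by `2`. -/
lemma w_eq_zero (j k m : σ) : G.w j k m = 0 := by
  have key : ∀ n j k m, G.w j k m ∈ ordIdeal σ R n := by
    intro n
    induction n with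
    | zero => intro j k m; exact mem_ordIdeal_zero _
    | succ n ih =>
      intro j k m
      refine mem_ordIdeal_succ_of_euler (j := 2) K (by omega) (ih j k m) ?_
      rw [euler_w, add_comm n 1]
      have hc : ∀ f : σ → R, ∀ g : σ → MvPowerSeries σ R, (∀ l, g l ∈ ordIdeal σ R n) →
          ∑ l, C (f l) * g l ∈ ordIdeal σ R n := fun f g hg =>
        sum_mem fun l _ => Ideal.mul_mem_left _ _ (hg l)
      refine sub_mem (sub_mem (add_mem (sub_mem (neg_mem (sum_mem fun i _ =>
        mul_mem_ordIdeal (X_mem_ordIdeal i) (anchorDer_mem _ (ih _ _ _))))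
        (sum_mem fun i _ => ?_)) (sum_mem fun i _ => mul_mem_ordIdeal (G.a_mem _ _) (ih _ _ _)))
        (sum_mem fun i _ => mul_mem_ordIdeal (G.a_mem _ _) (ih _ _ _)))
        (sum_mem fun i _ => mul_mem_ordIdeal (X_mem_ordIdeal i)
          (add_mem (add_mem (hc _ _ fun l => ih _ _ _) (hc _ _ fun l => ih _ _ _))
            (hc _ _ fun l => ih _ _ _)))
      rw [mul_comm]
      exact mul_mem_ordIdeal (G.a_mem _ _) (ih _ _ _)
  exact eq_zero_of_mem_ordIdeal fun n => key n j k m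

/-- The vector fields of a radial gauge satisfy the commutation relations of the basis of `L`. -/
lemma E_comm (j k : σ) (f : MvPowerSeries σ R) :
    G.E j (G.E k f) = G.E k (G.E j f) + ∑ l, C (strConst e j k l) * G.E l f := by
  rw [comm_apply]
  simp [w_eq_zero]

end RadialGauge

end Flatness

/-! ### The action of the enveloping algebra on power series -/

section VectorFields

open MvPowerSeries Module

variable {K R L σ : Type*} [Field K] [CommRing R] [Algebra K R] [LieRing L] [LieAlgebra K L]
  [Module R L] [LieRingModule L R] [LieRinehartRing R L] [LieRinehartAlgebra K R L]
  [Fintype σ] [DecidableEq σ] {e : Basis σ R L}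

namespace RadialGauge

variable (G : RadialGauge K e)

/-- The vector field `∑_i x_i E_i` attached to `x = ∑_i x_i e_i ∈ L`. -/
def field (x : L) (f : MvPowerSeries σ R) : MvPowerSeries σ R := ∑ i, e.repr x i • G.E i f

lemma field_basis (i : σ) (f : MvPowerSeries σ R) : G.field (e i) f = G.E i f := by
  simp [field, Finsupp.single_apply, ite_smul]

lemma field_add_left (x y : L) (f : MvPowerSeries σ R) :
    G.field (x + y) f = G.field x f + G.field y f := by
  simp [field, add_smul, Finset.sum_add_distrib]

lemma field_smul_left (a : R) (x : L) (f : MvPowerSeries σ R) :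
    G.field (a • x) f = a • G.field x f := by
  simp [field, mul_smul, Finset.smul_sum]

lemma field_add (x : L) (f g : MvPowerSeries σ R) :
    G.field x (f + g) = G.field x f + G.field x g := by
  simp [field, Finset.sum_add_distrib]

lemma E_smul (i : σ) (a : R) (f : MvPowerSeries σ R) :
    G.E i (a • f) = a • G.E i f + ⁅e i, a⁆ • f := by
  rw [smul_eq_C_mul, Derivation.leibniz, E_C, smul_eq_mul, smul_eq_mul, smul_eq_C_mul,
    smul_eq_C_mul, mul_comm f]

lemma field_smul (x : L) (a : R) (f : MvPowerSeries σ R) :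
    G.field x (a • f) = a • G.field x f + ⁅x, a⁆ • f := by
  have h : ⁅x, a⁆ = ∑ i, e.repr x i * ⁅e i, a⁆ := by
    conv_lhs => rw [← e.sum_repr x, sum_lie]
    exact Finset.sum_congr rfl fun i _ => LieRinehartRing.lie_smul_eq_mul _ _ _
  rw [h, field, field, Finset.smul_sum, Finset.sum_smul, ← Finset.sum_add_distrib]
  exact Finset.sum_congr rfl fun i _ => by
    rw [E_smul, smul_add, smul_smul, smul_smul, smul_smul, mul_comm a]

lemma field_sum_left {ι : Type*} (s : Finset ι) (y : ι → L) (f : MvPowerSeries σ R) :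
    G.field (∑ i ∈ s, y i) f = ∑ i ∈ s, G.field (y i) f :=
  map_sum (⟨⟨fun y => G.field y f, by simp [field]⟩, fun x y => G.field_add_left x y f⟩ :
    L →+ MvPowerSeries σ R) _ _

lemma field_sum {ι : Type*} (x : L) (s : Finset ι) (g : ι → MvPowerSeries σ R) :
    G.field x (∑ i ∈ s, g i) = ∑ i ∈ s, G.field x (g i) :=
  map_sum (⟨⟨fun f => G.field x f, by simp [field]⟩, fun f g => G.field_add x f g⟩ :
    MvPowerSeries σ R →+ MvPowerSeries σ R) _ _

lemma field_lie [CharZero K] (x y : L) (f : MvPowerSeries σ R) :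
    G.field x (G.field y f) = G.field y (G.field x f) + G.field ⁅x, y⁆ f := by
  have h1 : ∀ i j, G.field (e i) (G.field (e j) f) =
      G.field (e j) (G.field (e i) f) + G.field ⁅e i, e j⁆ f := by
    intro i j
    rw [field_basis, field_basis, field_basis, field_basis, E_comm, ← sum_strConst,
      field_sum_left]
    congr 1
    exact Finset.sum_congr rfl fun l _ => by rw [field_smul_left, field_basis, smul_eq_C_mul]
  have h2 : ∀ i y, G.field (e i) (G.field y f) =
      G.field y (G.field (e i) f) + G.field ⁅e i, y⁆ f := by
    intro i y
    rw [← e.sum_repr y, lie_sum]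
    simp only [field_sum_left, field_sum, field_smul_left, field_smul,
      LieRinehartRing.leibniz_smul_right, field_add_left, ← Finset.sum_add_distrib]
    refine Finset.sum_congr rfl fun j _ => ?_
    rw [h1, smul_add]
    abel
  rw [← e.sum_repr x, sum_lie, field_sum_left, field_sum_left, field_sum_left, field_sum,
    ← Finset.sum_add_distrib]
  refine Finset.sum_congr rfl fun i _ => ?_
  have h3 : ⁅e.repr x i • e i, y⁆ = e.repr x i • ⁅e i, y⁆ - ⁅y, e.repr x i⁆ • e i := by
    rw [← lie_skew, LieRinehartRing.leibniz_smul_right, ← lie_skew, smul_neg]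
    abel
  have h4 : G.field ⁅e.repr x i • e i, y⁆ f =
      e.repr x i • G.field ⁅e i, y⁆ f - ⁅y, e.repr x i⁆ • G.field (e i) f := by
    rw [eq_sub_iff_add_eq, ← field_smul_left, ← field_smul_left, ← field_add_left, h3,
      sub_add_cancel]
  rw [h4, field_smul_left, field_smul_left, field_smul, h2, smul_add]
  abel

lemma field_mem (x : L) {k : ℕ} {f : MvPowerSeries σ R} (hf : f ∈ ordIdeal σ R (k + 1)) :
    G.field x f ∈ ordIdeal σ R k := by
  refine sum_mem fun i _ => ?_
  rw [smul_eq_C_mul]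
  refine Ideal.mul_mem_left _ _ ?_
  rw [← sub_add_cancel (G.E i f) (pderiv R i f)]
  exact add_mem (ordIdeal_anti (Nat.le_succ k) (G.E_sub_pderiv_mem i hf)) (pderiv_mem_ordIdeal hf i)

lemma field_sub_mem (x : L) {k : ℕ} {f : MvPowerSeries σ R} (hf : f ∈ ordIdeal σ R (k + 1)) :
    G.field x f - ∑ i, e.repr x i • pderiv R i f ∈ ordIdeal σ R (k + 1) := by
  rw [field, ← Finset.sum_sub_distrib]
  refine sum_mem fun i _ => ?_
  rw [← smul_sub, smul_eq_C_mul]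
  exact Ideal.mul_mem_left _ _ (G.E_sub_pderiv_mem i hf)

variable [CharZero K]

/-- The action of `U(L, R)` on power series for which `x ∈ L` acts by its vector field. -/
def action : Env K R L →ₐ[K] Module.End K (MvPowerSeries σ R) :=
  Env.act
    { toFun := fun x =>
        { toFun := G.field x
          map_add' := G.field_add x
          map_smul' := fun k f => by
            have h : ⁅x, algebraMap K R k⁆ = 0 :=
              Derivation.map_algebraMap (LieRinehartAlgebra.anchor K R L x) k
            rw [← algebraMap_smul R k f, field_smul, h, zero_smul, add_zero,
              algebraMap_smul, RingHom.id_apply] }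
      map_add' := fun x y => by ext1 f; exact G.field_add_left x y f
      map_smul' := fun k x => by
        ext1 f
        change G.field (k • x) f = k • G.field x f
        rw [← algebraMap_smul R k x, field_smul_left, algebraMap_smul] }
    (fun r x f => G.field_smul_left r x f) (fun x r f => G.field_smul x r f)
    (fun x y f => G.field_lie x y f)

@[simp] lemma action_ofLie (x : L) (f : MvPowerSeries σ R) :
    G.action (Env.ofLie K x) f = G.field x f := Env.act_ofLie _ _ _ _ x f

lemma action_smul (r : R) (D : Env K R L) (f : MvPowerSeries σ R) :
    G.action (r • D) f = r • G.action D f := Env.act_smul _ _ _ _ r D f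

end RadialGauge

end VectorFields

/-! ### The pairing of power series with the symmetric algebra -/

section Pairing

open MvPowerSeries Module

variable {R L σ : Type*} [CommRing R] [AddCommGroup L] [Module R L] [Fintype σ] (e : Basis σ R L)

/-- The value at zero of `p(∂) f`, for a polynomial `p` and a power series `f`. -/
def polyPairing (f : MvPowerSeries σ R) : MvPolynomial σ R →ₗ[R] R :=
  (MvPolynomial.basisMonomials σ R).constr R
    fun m => ((∏ i, (m i).factorial : ℕ) : R) * coeff m f

lemma polyPairing_monomial (f : MvPowerSeries σ R) (m : σ →₀ ℕ) :
    polyPairing f (MvPolynomial.monomial m 1) =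
      ((∏ i, (m i).factorial : ℕ) : R) * coeff m f := by
  have h := congrFun (MvPolynomial.coe_basisMonomials σ R) m
  rw [← h, polyPairing, Basis.constr_basis]

lemma polyPairing_one (f : MvPowerSeries σ R) : polyPairing f 1 = constantCoeff f := by
  have h := polyPairing_monomial f 0
  simpa using h

lemma polyPairing_X_mul (f : MvPowerSeries σ R) (i : σ) (p : MvPolynomial σ R) :
    polyPairing f (MvPolynomial.X i * p) = polyPairing (pderiv R i f) p := by
  classical
  have h : polyPairing f ∘ₗ LinearMap.mulLeft R (MvPolynomial.X i) =
      polyPairing (pderiv R i f) := by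
    refine (MvPolynomial.basisMonomials σ R).ext fun m => ?_
    rw [MvPolynomial.coe_basisMonomials, LinearMap.comp_apply, LinearMap.mulLeft_apply,
      MvPolynomial.X, MvPolynomial.monomial_mul, one_mul, polyPairing_monomial,
      polyPairing_monomial, coeff_pderiv, add_comm (Finsupp.single i 1) m]
    have h1 : ∏ j, ((m + Finsupp.single i 1 : σ →₀ ℕ) j).factorial =
        (∏ j, (m j).factorial) * (m i + 1) := by
      rw [← Finset.mul_prod_erase _ _ (Finset.mem_univ i),
        ← Finset.mul_prod_erase _ (fun j => (m j).factorial) (Finset.mem_univ i)]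
      have h2 : ∏ j ∈ Finset.univ.erase i, ((m + Finsupp.single i 1 : σ →₀ ℕ) j).factorial =
          ∏ j ∈ Finset.univ.erase i, (m j).factorial :=
        Finset.prod_congr rfl fun j hj => by
          rw [Finsupp.add_apply, Finsupp.single_eq_of_ne (Finset.ne_of_mem_erase hj), add_zero]
      rw [h2, Finsupp.add_apply, Finsupp.single_eq_same, Nat.factorial_succ]
      ring
    rw [h1]
    push_cast
    ring
  exact LinearMap.congr_fun h p

/-- The pairing of a power series `f` with `s ∈ Sym L`: the value at zero of `s(∂) f`, where the
basis vector `e_i` of `L` acts by `∂_i`. -/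
def symPairing (f : MvPowerSeries σ R) : SymmetricAlgebra R L →ₗ[R] R :=
  polyPairing f ∘ₗ (SymmetricAlgebra.equivMvPolynomial e).toLinearMap

lemma symPairing_apply (f : MvPowerSeries σ R) (s : SymmetricAlgebra R L) :
    symPairing e f s = polyPairing f (SymmetricAlgebra.equivMvPolynomial e s) := rfl

lemma symPairing_one (f : MvPowerSeries σ R) : symPairing e f 1 = constantCoeff f := by
  rw [symPairing_apply, map_one, polyPairing_one]

lemma symPairing_add (f g : MvPowerSeries σ R) (s : SymmetricAlgebra R L) :
    symPairing e (f + g) s = symPairing e f s + symPairing e g s := by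
  have h : polyPairing (f + g) = polyPairing f + polyPairing g :=
    (MvPolynomial.basisMonomials σ R).ext fun m => by
      simp only [MvPolynomial.coe_basisMonomials, LinearMap.add_apply, polyPairing_monomial,
        map_add, mul_add]
  rw [symPairing_apply, h]
  rfl

lemma symPairing_smul (r : R) (f : MvPowerSeries σ R) (s : SymmetricAlgebra R L) :
    symPairing e (r • f) s = r * symPairing e f s := by
  have h : polyPairing (r • f) = r • polyPairing f :=
    (MvPolynomial.basisMonomials σ R).ext fun m => by
      simp only [MvPolynomial.coe_basisMonomials, LinearMap.smul_apply, polyPairing_monomial,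
        map_smul, smul_eq_mul]
      ring
  rw [symPairing_apply, h]
  rfl

lemma symPairing_zero (s : SymmetricAlgebra R L) : symPairing e 0 s = 0 := by
  simpa using symPairing_smul e (0 : R) 0 s

lemma symPairing_sum {ι : Type*} (t : Finset ι) (f : ι → MvPowerSeries σ R)
    (s : SymmetricAlgebra R L) :
    symPairing e (∑ i ∈ t, f i) s = ∑ i ∈ t, symPairing e (f i) s :=
  map_sum (⟨⟨fun f => symPairing e f s, symPairing_zero e s⟩,
    fun f g => symPairing_add e f g s⟩ : MvPowerSeries σ R →+ R) _ _

lemma symPairing_basis_mul (f : MvPowerSeries σ R) (i : σ) (s : SymmetricAlgebra R L) :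
    symPairing e f (SymmetricAlgebra.ι R L (e i) * s) = symPairing e (pderiv R i f) s := by
  rw [symPairing_apply, map_mul, SymmetricAlgebra.equivMvPolynomial_ι_apply, polyPairing_X_mul]
  rfl

lemma symPairing_ι_mul (f : MvPowerSeries σ R) (x : L) (s : SymmetricAlgebra R L) :
    symPairing e f (SymmetricAlgebra.ι R L x * s) =
      symPairing e (∑ i, e.repr x i • pderiv R i f) s := by
  conv_lhs => rw [← e.sum_repr x]
  rw [map_sum, Finset.sum_mul, map_sum, symPairing_sum]
  refine Finset.sum_congr rfl fun i _ => ?_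
  rw [map_smul, smul_mul_assoc, map_smul, symPairing_basis_mul, symPairing_smul, smul_eq_mul]

lemma symPairing_ι_basis (f : MvPowerSeries σ R) (i : σ) :
    symPairing e f (SymmetricAlgebra.ι R L (e i)) = coeff (Finsupp.single i 1) f := by
  rw [← mul_one (SymmetricAlgebra.ι R L (e i)), symPairing_basis_mul, symPairing_one,
    ← coeff_zero_eq_constantCoeff_apply, coeff_pderiv]
  simp

/-- The terms of degree other than `n` do not contribute to the pairing with `Sym^n L`. -/
lemma symPairing_eq_zero {n : ℕ} {f : MvPowerSeries σ R}
    (hf : ∀ m : σ →₀ ℕ, m.degree = n → coeff m f = 0) {s : SymmetricAlgebra R L}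
    (hs : s ∈ symPart R L n) : symPairing e f s = 0 := by
  revert f
  refine symPart_induction (p := fun n s => ∀ {f : MvPowerSeries σ R},
    (∀ m : σ →₀ ℕ, m.degree = n → coeff m f = 0) → symPairing e f s = 0) ?_ ?_ ?_ ?_ hs
  · intro f hf
    rw [symPairing_one]
    exact hf 0 (map_zero _)
  · intro n r a h f hf
    rw [map_smul, h hf, smul_zero]
  · intro n a b ha hb f hf
    rw [map_add, ha hf, hb hf, add_zero]
  · intro n x a _ h f hf
    rw [symPairing_ι_mul]
    refine h fun m hm => ?_
    rw [map_sum]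
    refine Finset.sum_eq_zero fun i _ => ?_
    rw [map_smul, coeff_pderiv, hf _ (by rw [map_add, Finsupp.degree_single, hm]), zero_mul,
      smul_zero]

lemma symPairing_eq_zero_of_lt {k n : ℕ} (hkn : k < n) {f : MvPowerSeries σ R}
    (hf : f ∈ ordIdeal σ R n) {s : SymmetricAlgebra R L} (hs : s ∈ symPart R L k) :
    symPairing e f s = 0 :=
  symPairing_eq_zero e (fun m hm => hf m (hm ▸ hkn)) hs

lemma isUnit_natCast_factorial (K : Type*) [Field K] [CharZero K] [Algebra K R] (m : σ →₀ ℕ) :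
    IsUnit ((∏ i, (m i).factorial : ℕ) : R) := by
  rw [← map_natCast (algebraMap K R)]
  refine (IsUnit.mk0 _ ?_).map _
  exact Nat.cast_ne_zero.mpr (Finset.prod_ne_zero_iff.mpr fun i _ => Nat.factorial_ne_zero _)

lemma symPairing_injective (K : Type*) [Field K] [CharZero K] [Algebra K R]
    {f g : MvPowerSeries σ R} (h : ∀ s, symPairing e f s = symPairing e g s) : f = g := by
  ext m
  have h1 := h ((SymmetricAlgebra.equivMvPolynomial e).symm (MvPolynomial.monomial m 1))
  rw [symPairing_apply, symPairing_apply, AlgEquiv.apply_symm_apply, polyPairing_monomial,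
    polyPairing_monomial] at h1
  exact (isUnit_natCast_factorial K m).mul_left_cancel h1

lemma exists_symPairing_eq (K : Type*) [Field K] [CharZero K] [Algebra K R]
    (φ : SymmetricAlgebra R L →ₗ[R] R) : ∃ f, symPairing e f = φ := by
  let E := SymmetricAlgebra.equivMvPolynomial e
  have hu := fun m => isUnit_natCast_factorial (R := R) (σ := σ) K m
  let f : MvPowerSeries σ R := fun m => (hu m).unit⁻¹ * φ (E.symm (MvPolynomial.monomial m 1))
  have h : polyPairing f = φ ∘ₗ E.symm.toLinearMap := by
    refine (MvPolynomial.basisMonomials σ R).ext fun m => ?_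
    rw [MvPolynomial.coe_basisMonomials, polyPairing_monomial]
    change _ * ((hu m).unit⁻¹ * φ (E.symm (MvPolynomial.monomial m 1))) = _
    rw [← mul_assoc, IsUnit.mul_val_inv, one_mul]
    rfl
  refine ⟨f, LinearMap.ext fun s => ?_⟩
  rw [symPairing_apply, h]
  exact congrArg φ (E.symm_apply_apply s)

/-- An element of `Sym^n L` is zero if it pairs to zero with power series of order at least `n`. -/
lemma eq_zero_of_symPairing (K : Type*) [Field K] [CharZero K] [Algebra K R] {n : ℕ}
    {s : SymmetricAlgebra R L} (hs : s ∈ symPart R L n)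
    (h : ∀ f ∈ ordIdeal σ R n, symPairing e f s = 0) : s = 0 := by
  classical
  rw [← map_eq_zero_iff _ (SymmetricAlgebra.equivMvPolynomial e).injective]
  ext m
  have h1 : symPairing e (monomial m (1 : R)) s = 0 := by
    by_cases hm : m.degree = n
    · refine h _ fun m' hm' => ?_
      rw [coeff_monomial_ne]
      rintro rfl
      omega
    · refine symPairing_eq_zero e (fun m' hm' => ?_) hs
      rw [coeff_monomial_ne]
      rintro rfl
      exact hm hm'
  rw [symPairing_apply] at h1
  have h2 : polyPairing (monomial m (1 : R)) = ((∏ i, (m i).factorial : ℕ) : R) •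
      MvPolynomial.lcoeff R m := by
    refine (MvPolynomial.basisMonomials σ R).ext fun m' => ?_
    rw [MvPolynomial.coe_basisMonomials, polyPairing_monomial, LinearMap.smul_apply,
      MvPolynomial.lcoeff_apply, MvPolynomial.coeff_monomial, coeff_monomial]
    by_cases h : m' = m
    · subst h; simp
    · simp [h]
  rw [h2, LinearMap.smul_apply, smul_eq_mul] at h1
  rw [MvPolynomial.coeff_zero]
  exact (isUnit_natCast_factorial K m).mul_right_eq_zero.mp h1

/-- The product of power series corresponds to the convolution product of functionals. -/
lemma symPairing_mul (f g : MvPowerSeries σ R) (s : SymmetricAlgebra R L) :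
    symPairing e (f * g) s = LinearMap.mul' R R
      (TensorProduct.map (symPairing e f) (symPairing e g) (Coalgebra.comul (R := R) s)) := by
  obtain ⟨p, rfl⟩ := (SymmetricAlgebra.equivMvPolynomial e).symm.surjective s
  induction p using MvPolynomial.induction_on generalizing f g with
  | C a =>
    have h : (SymmetricAlgebra.equivMvPolynomial e).symm (MvPolynomial.C a) =
        a • (1 : SymmetricAlgebra R L) := by
      rw [← Algebra.algebraMap_eq_smul_one]
      exact AlgEquiv.commutes _ a
    rw [h, map_smul, map_smul, map_smul, map_smul, symPairing_one, Bialgebra.comul_one,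
      Algebra.TensorProduct.one_def, TensorProduct.map_tmul, LinearMap.mul'_apply,
      symPairing_one, symPairing_one, map_mul]
  | add p q hp hq => simp only [map_add, hp, hq]
  | mul_X p i ih =>
    rw [mul_comm p, map_mul, SymmetricAlgebra.equivMvPolynomial_symm_X, symPairing_basis_mul,
      Derivation.leibniz, symPairing_add, smul_eq_mul, smul_eq_mul, mul_comm g, ih, ih,
      Bialgebra.comul_mul]
    generalize Coalgebra.comul (R := R) ((SymmetricAlgebra.equivMvPolynomial e).symm p) = t
    induction t with
    | zero => simp
    | tmul a b =>
      simp only [SymmetricAlgebra.comul_ι, add_mul, Algebra.TensorProduct.tmul_mul_tmul, one_mul,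
        map_add, TensorProduct.map_tmul, LinearMap.mul'_apply, symPairing_basis_mul]
      ring
    | add a b ha hb =>
      simp only [mul_add, map_add] at ha hb ⊢
      rw [← ha, ← hb]
      ring

end Pairing

/-! ### Injectivity of the Poincaré-Birkhoff-Witt map over a frame -/

section Injectivity

open MvPowerSeries Module

variable {K R L σ : Type*} [Field K] [CommRing R] [Algebra K R] [LieRing L] [LieAlgebra K L]
  [Module R L] [LieRingModule L R] [LieRinehartRing R L] [LieRinehartAlgebra K R L]
  [Fintype σ] [DecidableEq σ] {e : Basis σ R L} [CharZero K]

namespace RadialGauge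

variable (G : RadialGauge K e) (nab : ModuleConnection R L L)

/-- Elements of degree at most `n` of `U(L, R)` lower the order of a power series by at most `n`. -/
lemma action_mem {n k : ℕ} {D : Env K R L} (hD : D ∈ nab.pbwLE K n) {f : MvPowerSeries σ R}
    (hf : f ∈ ordIdeal σ R (n + k)) : G.action D f ∈ ordIdeal σ R k := by
  obtain ⟨s, hs, rfl⟩ := hD
  induction n generalizing s k f with
  | zero =>
    rw [SetLike.mem_coe, symLE_zero, symPart, pow_zero] at hs
    obtain ⟨r, rfl⟩ := Submodule.mem_one.mp hs
    rw [Algebra.algebraMap_eq_smul_one, map_smul, nab.pbw_one, action_smul, map_one,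
      Module.End.one_apply, smul_eq_C_mul]
    rw [zero_add] at hf
    exact Ideal.mul_mem_left _ _ hf
  | succ n ih =>
    rw [SetLike.mem_coe, symLE_succ] at hs
    obtain ⟨a, ha, b, hb, rfl⟩ := Submodule.mem_sup.mp hs
    rw [map_add, map_add, LinearMap.add_apply]
    refine add_mem (ih (ordIdeal_anti (by omega) hf) a ha) ?_
    rw [symPart, pow_succ'] at hb
    induction hb using Submodule.mul_induction_on' with
    | mem_mul_mem y hy c hc =>
      obtain ⟨x, rfl⟩ := hy
      obtain ⟨t, ht, h⟩ := nab.mul_pbw_sub_mem (K := K) hc x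
      have h2 : nab.pbw K (SymmetricAlgebra.ι R L x * c) =
          Env.ofLie K x * nab.pbw K c - nab.pbw K t := by rw [h, sub_sub_cancel]
      rw [h2, map_sub, LinearMap.sub_apply, map_mul, Module.End.mul_apply, action_ofLie]
      refine sub_mem (G.field_mem x (ih (ordIdeal_anti (by omega) hf) c
        (symPart_le_symLE le_rfl hc))) (ih (ordIdeal_anti (by omega) hf) t ht)
    | add y _ z _ hy hz =>
      have hsum : ∀ y ∈ LinearMap.range (SymmetricAlgebra.ι R L) *
          LinearMap.range (SymmetricAlgebra.ι R L) ^ n, a + y ∈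
          symLE R L n ⊔ symPart R L (n + 1) := fun y hy =>
        add_mem (Submodule.mem_sup_left ha) (Submodule.mem_sup_right (by rwa [symPart, pow_succ']))
      rw [map_add, map_add, LinearMap.add_apply]
      exact add_mem (hy (hsum _ ‹_›)) (hz (hsum _ ‹_›))

/-- The symbol of the operator by which `pbw(s)` acts is the constant coefficient operator
`s(∂)`, which is adjoint to multiplication by `s`. -/
lemma symPairing_action {n k : ℕ} {s u : SymmetricAlgebra R L} (hs : s ∈ symPart R L n)
    (hu : u ∈ symPart R L k) {f : MvPowerSeries σ R} (hf : f ∈ ordIdeal σ R (n + k)) :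
    symPairing e (G.action (nab.pbw K s) f) u = symPairing e f (s * u) := by
  revert hf
  revert hu
  revert k u f
  refine symPart_induction (p := fun n s => ∀ {k : ℕ} {u : SymmetricAlgebra R L}
    {f : MvPowerSeries σ R}, u ∈ symPart R L k → f ∈ ordIdeal σ R (n + k) →
    symPairing e (G.action (nab.pbw K s) f) u = symPairing e f (s * u)) ?_ ?_ ?_ ?_ hs
  · intro k u f _ _
    rw [nab.pbw_one, map_one, Module.End.one_apply, one_mul]
  · intro n r a h k u f hu hf
    rw [map_smul, action_smul, symPairing_smul, h hu hf, smul_mul_assoc, map_smul, smul_eq_mul]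
  · intro n a b ha hb k u f hu hf
    rw [map_add, map_add, LinearMap.add_apply, symPairing_add, ha hu hf, hb hu hf, add_mul, map_add]
  · intro n x a hm h k u f hu hf
    -- `pbw(x a)` differs from `x pbw(a)` by terms of lower degree, and `x` acts as `∂_x` up to terms
    -- which do not lower the order; neither correction contributes in degree `k`
    have hlow := nab.mul_pbw_sub_mem (K := K) hm x
    have h2 : nab.pbw K (SymmetricAlgebra.ι R L x * a) = Env.ofLie K x * nab.pbw K a -
        (Env.ofLie K x * nab.pbw K a - nab.pbw K (SymmetricAlgebra.ι R L x * a)) := by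
      rw [sub_sub_cancel]
    have hf1 : f ∈ ordIdeal σ R (n + (k + 1)) := ordIdeal_anti (by omega) hf
    have h3 := symPairing_eq_zero_of_lt e (Nat.lt_succ_self k) (G.action_mem nab hlow hf1) hu
    have h4 := symPairing_eq_zero_of_lt e (Nat.lt_succ_self k)
      (G.field_sub_mem x (G.action_mem nab (nab.pbw_mem_pbwLE le_rfl hm) hf1)) hu
    have hadd : ∀ g g' : MvPowerSeries σ R, symPairing e (g - g') u =
        symPairing e g u - symPairing e g' u := fun g g' => by
      rw [eq_sub_iff_add_eq, ← symPairing_add, sub_add_cancel]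
    rw [h2, map_sub, LinearMap.sub_apply, hadd, h3, sub_zero, map_mul, Module.End.mul_apply,
      action_ofLie]
    rw [hadd, sub_eq_zero, ← symPairing_ι_mul] at h4
    rw [h4, h (ι_mul_mem_symPart x hu) hf1]
    congr 1
    ring

end RadialGauge

/-- The injectivity part of the Poincaré-Birkhoff-Witt theorem for a Lie-Rinehart algebra which is
free of finite rank: the top degree part of an element of the kernel acts as zero on power series of
this order. -/
lemma ModuleConnection.pbw_injective (nab : ModuleConnection R L L) (e : Basis σ R L) :
    Function.Injective (nab.pbw K) := by
  rw [injective_iff_map_eq_zero]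
  intro s hs
  obtain ⟨G⟩ := exists_radialGauge (K := K) e
  -- the top degree part `b` of an element of the kernel pairs to zero with all series of order `k`
  have key : ∀ (a : SymmetricAlgebra R L) (k : ℕ), ∀ b ∈ symPart R L k,
      (∀ f ∈ ordIdeal σ R k, symPairing e (G.action (nab.pbw K a) f) 1 = 0) →
      nab.pbw K (a + b) = 0 → b = 0 := by
    intro a k b hb ha hab
    refine eq_zero_of_symPairing e K hb fun f hf => ?_
    have h := G.symPairing_action nab hb one_mem_symPart (f := f) (by rwa [add_zero])
    rw [mul_one] at h
    have h2 : symPairing e (G.action (nab.pbw K (a + b)) f) 1 = 0 := by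
      rw [hab, map_zero, LinearMap.zero_apply, symPairing_zero]
    rwa [map_add, map_add, LinearMap.add_apply, symPairing_add, ha f hf, zero_add, h] at h2
  obtain ⟨n, hn⟩ := exists_mem_symLE s
  induction n generalizing s with
  | zero =>
    rw [symLE_zero] at hn
    refine key 0 0 s hn (fun f _ => ?_) (by rwa [zero_add])
    rw [map_zero, map_zero, LinearMap.zero_apply, symPairing_zero]
  | succ n ih =>
    rw [symLE_succ] at hn
    obtain ⟨a, ha, b, hb, rfl⟩ := Submodule.mem_sup.mp hn
    have hb0 : b = 0 := key a (n + 1) b hb (fun f hf =>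
      symPairing_eq_zero_of_lt e Nat.zero_lt_one
        (G.action_mem nab (Submodule.mem_map_of_mem ha) hf) one_mem_symPart) hs
    rw [hb0, add_zero] at hs ⊢
    exact ih a hs ha

end Injectivity

/-! ### Naturality, local identities and frames -/

section Naturality

open ModuleConnection

variable {R : Type*} [CommRing R]

/-- Induction on the symmetric algebra, as the span of the products of elements of `M`. -/
lemma prod_induction_sym {M : Type*} [AddCommGroup M] [Module R M]
    {p : SymmetricAlgebra R M → Prop}
    (prod : ∀ (n : ℕ) (r : R) (x : Fin n → M), p (r • ∏ i, SymmetricAlgebra.ι R M (x i)))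
    (add : ∀ a b, p a → p b → p (a + b)) (s : SymmetricAlgebra R M) : p s := by
  suffices h : ∀ s t : SymmetricAlgebra R M,
      (∀ (n : ℕ) (r : R) (x : Fin n → M), p (r • (t * ∏ i, SymmetricAlgebra.ι R M (x i)))) →
      ∀ (n : ℕ) (r : R) (x : Fin n → M), p (r • (s * t * ∏ i, SymmetricAlgebra.ι R M (x i))) by
    simpa using h s 1 (by simpa using prod) 0 1 ![]
  intro s
  induction s using SymmetricAlgebra.induction with
  | algebraMap a =>
    intro t ht n r x
    rw [mul_assoc, ← Algebra.smul_def, smul_smul]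
    exact ht n _ x
  | ι y =>
    intro t ht n r x
    have h := ht (n + 1) r (Fin.cons y x)
    rw [Fin.prod_univ_succ, mul_left_comm, ← mul_assoc] at h
    exact h
  | add a b ha hb =>
    intro t ht n r x
    rw [add_mul, add_mul, smul_add]
    exact add _ _ (ha t ht n r x) (hb t ht n r x)
  | mul a b ha hb =>
    intro t ht n r x
    rw [mul_assoc a b t]
    exact ha _ (hb t ht) n r x

variable {L R' L' : Type*} [LieRing L] [Module R L] [LieRingModule L R] [LieRinehartRing R L]
  [CommRing R'] [LieRing L'] [Module R' L'] [LieRingModule L' R'] [LieRinehartRing R' L']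
  {M M' : Type*} [AddCommGroup M] [Module R M] [AddCommGroup M'] [Module R' M']

/-- The adapted maps commute with morphisms which are compatible with the connections. -/
lemma covIter_prod_map (nab : ModuleConnection R L L) (τ : ModuleConnection R L M)
    (nab' : ModuleConnection R' L' L') (τ' : ModuleConnection R' L' M') (f : L → L')
    (g : M →+ M') (hf : ∀ x y, f (nab.op x y) = nab'.op (f x) (f y))
    (hg : ∀ x m, g (τ.op x m) = τ'.op (f x) (g m)) (m : M) {n : ℕ} (x : Fin n → L) :
    g (nab.covIter τ m n (∏ i, SymmetricAlgebra.ι R L (x i))) =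
      nab'.covIter τ' (g m) n (∏ i, SymmetricAlgebra.ι R' L' (f (x i))) := by
  induction n with
  | zero => simp [covIter_zero_one]
  | succ n ih =>
    rw [covIter_succ_prod, covIter_succ_prod, map_sum]
    refine Finset.sum_congr rfl fun i _ => ?_
    rw [map_sub, map_sum, hg, ih]
    congr 1
    refine Finset.sum_congr rfl fun j _ => ?_
    rw [ih]
    congr 1
    refine Finset.prod_congr rfl fun k _ => ?_
    rw [← hf, Function.apply_update (fun _ => f)]

end Naturality

section Local

variable {K : Type u} [Field K] {X : TopCat.{u}} {O : TopCat.Sheaf (CommAlgCat.{u} K) X}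

/-- Sections of the structure sheaf which agree locally are equal: they may be viewed as morphisms
from the polynomial ring `K[T]`. -/
lemma sec_ext {U : Opens X} {a b : Sec O U}
    (h : ∀ p ∈ U, ∃ (V : Opens X) (hV : V ≤ U), p ∈ V ∧ res O hV a = res O hV b) : a = b := by
  let S : Sieve U :=
    { arrows := fun V f => res O f.le a = res O f.le b
      downward_closed := fun {V W f} hf g => by
        have h1 := congrArg (res O g.le) hf
        rwa [res_res, res_res] at h1 }
  have hS : S ∈ Opens.grothendieckTopology X U := fun p hp => by
    obtain ⟨V, hV, hpV, e⟩ := h p hp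
    exact ⟨V, homOfLE hV, e, hpV⟩
  let ev : Sec O U → (CommAlgCat.of K (Polynomial K) ⟶ O.presheaf.obj (op U)) :=
    fun a => CommAlgCat.ofHom (Polynomial.aeval a)
  have h1 : ev a = ev b := O.property.hom_ext ⟨S, hS⟩ (ev a) (ev b) (by
    rintro ⟨V, f, hf⟩
    refine CommAlgCat.hom_ext (Polynomial.algHom_ext ?_)
    change res O f.le (Polynomial.aeval a Polynomial.X) =
      res O f.le (Polynomial.aeval b Polynomial.X)
    rw [Polynomial.aeval_X, Polynomial.aeval_X]
    exact hf)
  have h2 : Polynomial.aeval a (Polynomial.X : Polynomial K) =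
      Polynomial.aeval b (Polynomial.X : Polynomial K) :=
    congrArg (fun g : CommAlgCat.of K (Polynomial K) ⟶ O.presheaf.obj (op U) =>
      g.hom (Polynomial.X : Polynomial K)) h1
  rwa [Polynomial.aeval_X, Polynomial.aeval_X] at h2

namespace LieAlgebroid

variable (L : LieAlgebroid O) {U V W : Opens X}

/-- Sections `e₁, …, e_r` of `L` over `U` whose restrictions to every `V ⊆ U` are a basis. -/
def IsFrame {r : ℕ} (e : Fin r → L.Obj U) : Prop :=
  ∀ (V : Opens X) (h : V ≤ U),
    LinearIndependent (Sec O V) (fun i => L.restrict h (e i)) ∧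
      Submodule.span (Sec O V) (Set.range fun i => L.restrict h (e i)) = ⊤

variable {L}

/-- The basis of `L(V)` given by a frame. -/
def IsFrame.basis {r : ℕ} {e : Fin r → L.Obj U} (he : L.IsFrame e) (h : V ≤ U) :
    Module.Basis (Fin r) (Sec O V) (L.Obj V) :=
  Module.Basis.mk (he V h).1 (he V h).2.ge

@[simp] lemma IsFrame.basis_apply {r : ℕ} {e : Fin r → L.Obj U} (he : L.IsFrame e) (h : V ≤ U)
    (i : Fin r) : he.basis h i = L.restrict h (e i) := by simp [basis]

lemma IsFrame.repr_restrict {r : ℕ} {e : Fin r → L.Obj U} (he : L.IsFrame e) (hV : V ≤ U)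
    (h : W ≤ V) (x : L.Obj V) (i : Fin r) :
    (he.basis (h.trans hV)).repr (L.restrict h x) i = res O h ((he.basis hV).repr x i) := by
  have h1 : L.restrict h x = ∑ j, res O h ((he.basis hV).repr x j) • he.basis (h.trans hV) j := by
    conv_lhs => rw [← (he.basis hV).sum_repr x]
    rw [← restrictₛₗ_apply, _root_.map_sum]
    refine Finset.sum_congr rfl fun j _ => ?_
    rw [LinearMap.map_smulₛₗ, restrictₛₗ_apply, basis_apply, basis_apply, restrict_restrict]
    rfl
  rw [h1, Module.Basis.repr_sum_self]

variable (L)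

/-- Sections of `L` which agree locally are equal. -/
lemma obj_ext {x y : L.Obj U}
    (h : ∀ p ∈ U, ∃ (V : Opens X) (hV : V ≤ U), p ∈ V ∧ L.restrict hV x = L.restrict hV y) :
    x = y := by
  choose V hV hp e using h
  refine L.sheaf.eq_of_locally_eq' (fun p : U => V p.1 p.2) U (fun p => homOfLE (hV p.1 p.2))
    (fun p hpU => Opens.mem_iSup.mpr ⟨⟨p, hpU⟩, hp p hpU⟩) x y fun p => e p.1 p.2

/-- A connection on the restriction of `L` to the open `U`. Over a frame there are such connections,
even when `L` has none. -/
structure ConnectionOn (U : Opens X) where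
  nabla : ∀ V : Opens X, V ≤ U → ModuleConnection (Sec O V) (L.Obj V) (L.Obj V)
  nabla_restrict : ∀ {V W : Opens X} (hV : V ≤ U) (h : W ≤ V) (x y : L.Obj V),
    (nabla W (h.trans hV)).op (L.restrict h x) (L.restrict h y) =
      L.restrict h ((nabla V hV).op x y)

variable {L}

/-- A connection on `L`, as a connection over the whole space. -/
def Connection.onTop (nab : L.Connection) : L.ConnectionOn ⊤ where
  nabla V _ :=
    { op :=
        { toFun := fun x => (nab.nabla V x).toAddMonoidHom
          map_add' := fun x y => by ext z; simp
          map_smul' := fun a x => by ext z; simp }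
      leibniz := fun x a y => nab.leibniz V x a y }
  nabla_restrict _ h x y := nab.nabla_restrict h x y

namespace ConnectionOn

variable [CharZero K] (c : L.ConnectionOn U)

/-- The Poincaré-Birkhoff-Witt map is compatible with restriction. -/
lemma map_pbw (hV : V ≤ U) (h : W ≤ V) (s : SymmetricAlgebra (Sec O V) (L.Obj V)) :
    L.envCoalg.map h ((c.nabla V hV).pbw K s) =
      (c.nabla W (h.trans hV)).pbw K (L.symCoalg.map h s) := by
  induction s using prod_induction_sym with
  | prod n a x =>
    have h1 : L.symCoalg.map h (∏ i, SymmetricAlgebra.ι (Sec O V) (L.Obj V) (x i)) =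
        ∏ i, SymmetricAlgebra.ι (Sec O W) (L.Obj W) (L.restrict h (x i)) := by
      change symMapRing (L.restrictₛₗ h) _ = _
      rw [map_prod]
      simp
    have h2 := covIter_prod_map (c.nabla V hV) (envConnection K (Sec O V) (L.Obj V))
      (c.nabla W (h.trans hV)) (envConnection K (Sec O W) (L.Obj W)) (L.restrict h)
      (L.envCoalg.map h).toAddMonoidHom (fun x y => (c.nabla_restrict hV h x y).symm)
      (fun x D => by
        change Env.mapAlg (L.restrict h) (Env.ofLie K x * D) =
          Env.ofLie K (L.restrict h x) * Env.mapAlg (L.restrict h) D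
        rw [map_mul, Env.mapAlg_ofLie]) 1 x
    have h3 : (L.envCoalg.map h).toAddMonoidHom 1 = 1 := map_one (Env.mapAlg (L.restrict h))
    rw [h3] at h2
    change L.envCoalg.map h _ = _ at h2
    rw [_root_.map_smul, LinearMap.map_smulₛₗ, LinearMap.map_smulₛₗ, _root_.map_smul, h1]
    congr 1
    rw [ModuleConnection.pbw, ModuleConnection.pbw,
      ModuleConnection.adaptedMap_apply _ _ _ _ (prod_ι_mem_symPart x),
      ModuleConnection.adaptedMap_apply _ _ _ _ (prod_ι_mem_symPart _), LinearMap.map_smulₛₗ, h2]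
    congr 1
    exact (res O h).commutes _
  | add a b ha hb => simp only [_root_.map_add, ha, hb]

end ConnectionOn

end LieAlgebroid

end Local

/-! ### The isomorphism defined by a connection -/

section Isomorphism

variable {K : Type u} [Field K] {X : TopCat.{u}} {O : TopCat.Sheaf (CommAlgCat.{u} K) X}

namespace CoalgPresheaf

variable {C : CoalgPresheaf O} {V W : Opens X}

lemma eval_mul (s t : C.Dual W) (h : V ≤ W) (c : C.obj V) :
    (s * t).eval h c = LinearMap.mul' (Sec O V) (Sec O V)
      (TensorProduct.map (s.eval h) (t.eval h) (Coalgebra.comul (R := Sec O V) c)) :=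
  LinearMap.convMul_apply _ _ _

lemma eval_add (s t : C.Dual W) (h : V ≤ W) (c : C.obj V) :
    (s + t).eval h c = s.eval h c + t.eval h c := rfl

lemma eval_one (h : V ≤ W) (c : C.obj V) :
    (1 : C.Dual W).eval h c = Coalgebra.counit (R := Sec O V) c := by
  change (1 : WithConv (C.obj V →ₗ[Sec O V] Sec O V)) c = _
  simp

lemma eval_zero (h : V ≤ W) (c : C.obj V) : (0 : C.Dual W).eval h c = 0 := rfl

lemma eval_sum {ι : Type*} (t : Finset ι) (s : ι → C.Dual W) (h : V ≤ W) (c : C.obj V) :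
    (∑ i ∈ t, s i).eval h c = ∑ i ∈ t, (s i).eval h c :=
  map_sum (⟨⟨fun s => s.eval h c, eval_zero h c⟩, fun s t => eval_add s t h c⟩ :
    C.Dual W →+ Sec O V) _ _

end CoalgPresheaf

open CoalgPresheaf

namespace LieAlgebroid

variable {L : LieAlgebroid O} {U V W : Opens X} [CharZero K]

namespace ConnectionOn

variable (c : L.ConnectionOn U)

/-- The Poincaré-Birkhoff-Witt map is injective over a neighbourhood of every point. -/
lemma exists_pbw_injective {r : ℕ} (hL : L.IsLocallyFreeOfRank r) (hV : V ≤ U) {p : X}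
    (hp : p ∈ V) : ∃ (W : Opens X) (h : W ≤ V), p ∈ W ∧
      Function.Injective ((c.nabla W (h.trans hV)).pbw K) := by
  obtain ⟨U', hp', e, he⟩ := hL p
  have he' : L.IsFrame e := he
  exact ⟨V ⊓ U', inf_le_left, ⟨hp, hp'⟩,
    ModuleConnection.pbw_injective _ (he'.basis inf_le_right)⟩

/-- Composition of a jet with the Poincaré-Birkhoff-Witt map `Sym L → U(L)`. -/
def toHat (hW : W ≤ U) (φ : L.Jet W) : L.SymHat W :=
  ⟨fun V => WithConv.toConv (L.jetEval φ V.2 ∘ₗ (c.nabla V.1 (V.2.trans hW)).pbw K), by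
    intro V V' hV h s
    change L.jetEval φ _ ((c.nabla V' _).pbw K (L.symCoalg.map h s)) =
      res O h (L.jetEval φ hV ((c.nabla V _).pbw K s))
    rw [← c.map_pbw (hV.trans hW) h]
    exact Dual.eval_map φ hV h _⟩

/-- The map `toHat` is a morphism of algebras because the Poincaré-Birkhoff-Witt map is a morphism
of coalgebras. -/
def toHatAlg (hW : W ≤ U) : L.Jet W →ₐ[Sec O W] L.SymHat W where
  toFun := c.toHat hW
  map_one' := by
    refine Dual.ext fun V h s => ?_
    refine (eval_one (C := L.envCoalg) h _).trans ?_
    rw [eval_one]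
    exact ModuleConnection.counit_pbw _ s
  map_mul' φ ψ := by
    refine Dual.ext fun V h s => ?_
    refine (eval_mul φ ψ h _).trans ?_
    refine Eq.trans ?_ (eval_mul _ _ h s).symm
    have h1 := (c.nabla V (h.trans hW)).comul_pbw (K := K) s
    refine (congrArg (fun t => LinearMap.mul' (Sec O V) (Sec O V)
      (TensorProduct.map (φ.eval h) (ψ.eval h) t)) h1).trans ?_
    rw [← LinearMap.comp_apply (TensorProduct.map (φ.eval h) (ψ.eval h)), ← TensorProduct.map_comp]
    rfl
  map_zero' := rfl
  map_add' _ _ := rfl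
  commutes' a := by
    refine Dual.ext fun V h s => ?_
    rw [Algebra.algebraMap_eq_smul_one, Algebra.algebraMap_eq_smul_one, eval_smul, eval_one]
    refine (eval_smul _ a (1 : L.Jet W) h _).trans ?_
    rw [eval_one]
    exact congrArg (res O h a * ·) (ModuleConnection.counit_pbw _ s)

/-- Composition with the Poincaré-Birkhoff-Witt map is bijective on functionals. The map is
surjective over every open, but known to be injective only where `L` has a frame; this suffices
because functionals take values in the sheaf `O`. -/
lemma toHat_bijective {r : ℕ} (hL : L.IsLocallyFreeOfRank r) (hW : W ≤ U) :
    Function.Bijective (c.toHatAlg hW) := by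
  constructor
  · intro φ ψ h
    refine Dual.ext fun V hV D => ?_
    obtain ⟨s, rfl⟩ := (c.nabla V (hV.trans hW)).pbw_surjective (K := K) D
    exact congrArg (fun t : L.SymHat W => L.symEval t hV s) h
  · intro t
    -- the kernel of the Poincaré-Birkhoff-Witt map is killed by `t`, because it is locally zero
    have hker : ∀ (V : Opens X) (hV : V ≤ W) (s : SymmetricAlgebra (Sec O V) (L.Obj V)),
        (c.nabla V (hV.trans hW)).pbw K s = 0 → L.symEval t hV s = 0 := by
      intro V hV s hs
      refine sec_ext fun p hp => ?_
      obtain ⟨V', h, hpV', hinj⟩ := c.exists_pbw_injective hL (hV.trans hW) hp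
      refine ⟨V', h, hpV', ?_⟩
      have h1 := c.map_pbw (hV.trans hW) h s
      rw [hs, _root_.map_zero] at h1
      have h2 : L.symCoalg.map h s = 0 := hinj (by rw [← h1, _root_.map_zero])
      have h3 := Dual.eval_map t hV h s
      rw [h2, _root_.map_zero] at h3
      rw [_root_.map_zero]
      exact h3.symm
    have hex : ∀ (V : Opens X) (hV : V ≤ W),
        ∃ g : Env K (Sec O V) (L.Obj V) →ₗ[Sec O V] Sec O V,
          ∀ s, g ((c.nabla V (hV.trans hW)).pbw K s) = L.symEval t hV s := by
      intro V hV
      let P := (c.nabla V (hV.trans hW)).pbw K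
      let Q := P.quotKerEquivOfSurjective ((c.nabla V (hV.trans hW)).pbw_surjective (K := K))
      refine ⟨(LinearMap.ker P).liftQ (L.symEval t hV) (fun s hs => hker V hV s hs) ∘ₗ
        Q.symm.toLinearMap, fun s => ?_⟩
      have h1 : Q.symm (P s) = Submodule.Quotient.mk s := by
        rw [LinearEquiv.symm_apply_eq]
        rfl
      exact congrArg ((LinearMap.ker P).liftQ (L.symEval t hV) fun s hs => hker V hV s hs) h1
    choose g hg using hex
    refine ⟨⟨fun V => WithConv.toConv (g V.1 V.2), ?_⟩, ?_⟩
    · intro V V' hV h D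
      change g V' _ (L.envCoalg.map h D) = res O h (g V hV D)
      obtain ⟨s, rfl⟩ := (c.nabla V (hV.trans hW)).pbw_surjective (K := K) D
      rw [c.map_pbw (hV.trans hW) h, hg, hg]
      exact Dual.eval_map t hV h s
    · exact Dual.ext fun V hV s => hg V hV s

/-- The isomorphism between jets and the completed symmetric algebra given by a connection. -/
def pbwIso {r : ℕ} (hL : L.IsLocallyFreeOfRank r) (hW : W ≤ U) : L.Jet W ≃ₐ[Sec O W] L.SymHat W :=
  AlgEquiv.ofBijective (c.toHatAlg hW) (c.toHat_bijective hL hW)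

lemma symEval_pbwIso {r : ℕ} (hL : L.IsLocallyFreeOfRank r) (hW : W ≤ U) (φ : L.Jet W) (h : V ≤ W)
    (s : SymmetricAlgebra (Sec O V) (L.Obj V)) :
    L.symEval (c.pbwIso hL hW φ) h s =
      L.jetEval φ h ((c.nabla V (h.trans hW)).pbw K s) := rfl

end ConnectionOn

/-- The symmetric form `D^n φ` is the composition of the jet `φ` with the recursion that defines the
Poincaré-Birkhoff-Witt map. -/
lemma jetEval_iterD (nab : L.Connection) (φ : L.Jet W) (n : ℕ) (x : Fin n → L.Obj W) (h : V ≤ W)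
    (D : Env K (Sec O V) (L.Obj V)) :
    L.jetEval (nab.iterD φ n x) h D = L.jetEval φ h
      (D * (nab.onTop.nabla V le_top).covIter (envConnection K _ _) 1 n
        (∏ i, SymmetricAlgebra.ι _ _ (L.restrict h (x i)))) := by
  induction n generalizing D with
  | zero => simp [Connection.iterD, ModuleConnection.covIter_zero_one]
  | succ n ih =>
    have hsum : ∀ {ι : Type} (t : Finset ι) (f : ι → L.Jet W),
        L.jetEval (∑ i ∈ t, f i) h D = ∑ i ∈ t, L.jetEval (f i) h D :=
      fun t f => eval_sum t f h D
    have hsub : ∀ f g : L.Jet W, L.jetEval (f - g) h D = L.jetEval f h D - L.jetEval g h D :=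
      fun _ _ => rfl
    change L.jetEval (nab.symD (nab.iterD φ n) x) h D = _
    rw [ModuleConnection.covIter_succ_prod, Finset.mul_sum, _root_.map_sum, Connection.symD, hsum]
    refine Finset.sum_congr rfl fun i _ => ?_
    rw [mul_sub, _root_.map_sub, hsub, hsum, Finset.mul_sum, _root_.map_sum]
    congr 1
    · change L.jetEval (nab.iterD φ n fun j => x (i.succAbove j)) h
        (D * Env.ofLie K (L.restrict h (x i))) = _
      rw [ih, mul_assoc]
      rfl
    · refine Finset.sum_congr rfl fun j _ => ?_
      rw [ih]
      congr 3
      refine Finset.prod_congr rfl fun k _ => ?_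
      rw [Function.apply_update (fun _ => L.restrict h)]
      congr 2
      rw [← nab.nabla_restrict h]
      rfl

/-- The isomorphism of sheaves of algebras given by a connection. -/
def Connection.pbwDualIso {r : ℕ} (hL : L.IsLocallyFreeOfRank r) (nab : L.Connection) :
    DualIso L.envCoalg L.symCoalg where
  equiv _ := nab.onTop.pbwIso hL le_top
  equiv_res _ _ := rfl

/-- The isomorphism is given by the formula `∑_n (D^n φ / n!)(1)`. -/
lemma Connection.symEval_pbwDualIso {r : ℕ} (hL : L.IsLocallyFreeOfRank r) (nab : L.Connection)
    (φ : L.Jet W) (h : V ≤ W) (n : ℕ) (x : Fin n → L.Obj V) :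
    L.symEval ((nab.pbwDualIso hL).equiv W φ) h
        (∏ i, SymmetricAlgebra.ι (Sec O V) (L.Obj V) (x i)) =
      nab.pbwCoeff (L.envCoalg.dualRes h φ) n x := by
  refine (nab.onTop.symEval_pbwIso hL le_top φ h _).trans ?_
  rw [ModuleConnection.pbw,
    ModuleConnection.adaptedMap_apply _ _ _ _ (prod_ι_mem_symPart x), _root_.map_smul,
    algebraMap_smul, Connection.pbwCoeff, jetEval_iterD, one_mul]
  simp only [restrict_refl]
  rfl

end LieAlgebroid

end Isomorphism

/-! ### The completed symmetric algebra over a frame -/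

section PairingNatural

open MvPowerSeries Module

variable {R L σ : Type*} [CommRing R] [AddCommGroup L] [Module R L] [Fintype σ] (e : Basis σ R L)

lemma sym_basis_induction {p : SymmetricAlgebra R L → Prop} (const : ∀ r, p (algebraMap R _ r))
    (add : ∀ a b, p a → p b → p (a + b))
    (mul : ∀ i a, p a → p (SymmetricAlgebra.ι R L (e i) * a)) (s : SymmetricAlgebra R L) : p s := by
  obtain ⟨q, rfl⟩ := (SymmetricAlgebra.equivMvPolynomial e).symm.surjective s
  induction q using MvPolynomial.induction_on with
  | C a =>
    have h : (SymmetricAlgebra.equivMvPolynomial e).symm (MvPolynomial.C a) =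
        algebraMap R _ a := AlgEquiv.commutes _ a
    rw [h]
    exact const a
  | add a b ha hb => rw [map_add]; exact add _ _ ha hb
  | mul_X a i ha =>
    rw [mul_comm, map_mul, SymmetricAlgebra.equivMvPolynomial_symm_X]
    exact mul _ _ ha

lemma symPairing_algebraMap (f : MvPowerSeries σ R) (r : R) :
    symPairing e f (algebraMap R _ r) = r * constantCoeff f := by
  rw [Algebra.algebraMap_eq_smul_one, map_smul, symPairing_one, smul_eq_mul]

lemma symPairing_one_left (s : SymmetricAlgebra R L) :
    symPairing e 1 s = Coalgebra.counit (R := R) s := by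
  induction s using sym_basis_induction e with
  | const r => rw [symPairing_algebraMap]; simp
  | add a b ha hb => rw [map_add, map_add, ha, hb]
  | mul i a _ =>
    rw [symPairing_basis_mul, Bialgebra.counit_mul]
    simp [symPairing_zero]

lemma symPairing_X (i : σ) (s : SymmetricAlgebra R L) :
    symPairing e (X i) s = LieAlgebroid.linExt (e.coord i) s := by
  classical
  induction s using sym_basis_induction e with
  | const r => rw [symPairing_algebraMap, LieAlgebroid.linExt_algebraMap]; simp
  | add a b ha hb => rw [map_add, map_add, ha, hb]
  | mul j a _ =>
    rw [symPairing_basis_mul, LieAlgebroid.linExt_mul, LieAlgebroid.linExt_ι, pderiv_X]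
    by_cases h : j = i
    · subst h
      simp [symPairing_one_left]
    · simp [Ne.symm h, symPairing_zero]

lemma symPairing_map {R' L' : Type*} [CommRing R'] [AddCommGroup L'] [Module R' L']
    (e' : Basis σ R' L') (ρ : R →+* R') (g : L →ₛₗ[ρ] L') (h : ∀ i, g (e i) = e' i)
    (f : MvPowerSeries σ R) (s : SymmetricAlgebra R L) :
    symPairing e' (MvPowerSeries.map ρ f) (symMapRing g s) = ρ (symPairing e f s) := by
  induction s using sym_basis_induction e generalizing f with
  | const r =>
    rw [symMapRing_algebraMap, symPairing_algebraMap, symPairing_algebraMap, map_mul,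
      MvPowerSeries.constantCoeff_map]
  | add a b ha hb => simp only [map_add, ha, hb]
  | mul i a ha =>
    rw [map_mul, symMapRing_ι, h, symPairing_basis_mul, symPairing_basis_mul, ← ha]
    congr 2
    ext m
    simp [coeff_pderiv]

lemma equivMvPolynomial_symm_monomial (m : σ →₀ ℕ) :
    (SymmetricAlgebra.equivMvPolynomial e).symm (MvPolynomial.monomial m 1) =
      ∏ i, SymmetricAlgebra.ι R L (e i) ^ m i := by
  rw [MvPolynomial.monomial_eq, map_one, one_mul, Finsupp.prod_fintype _ _ (by simp), map_prod]
  simp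

lemma prod_pow_mem_symPart {M : Type*} [AddCommGroup M] [Module R M] (x : σ → M) (m : σ → ℕ) :
    ∏ i, SymmetricAlgebra.ι R M (x i) ^ m i ∈ symPart R M (∑ i, m i) := by
  classical
  have h : ∀ t : Finset σ,
      ∏ i ∈ t, SymmetricAlgebra.ι R M (x i) ^ m i ∈ symPart R M (∑ i ∈ t, m i) := by
    intro t
    induction t using Finset.induction_on with
    | empty => exact one_mem_symPart
    | insert a t ha ih =>
      rw [Finset.prod_insert ha, Finset.sum_insert ha]
      exact mul_mem_symPart (Submodule.pow_mem_pow _ (LinearMap.mem_range_self _ (x a)) _) ih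
  exact h _

lemma sym_ringHom_ext {M A : Type*} [AddCommGroup M] [Module R M] [CommRing A]
    {f g : SymmetricAlgebra R M →+* A} (h : ∀ r, f (algebraMap R _ r) = g (algebraMap R _ r))
    (h' : ∀ x, f (SymmetricAlgebra.ι R M x) = g (SymmetricAlgebra.ι R M x)) : f = g := by
  refine RingHom.ext fun s => ?_
  induction s using SymmetricAlgebra.induction with
  | algebraMap r => exact h r
  | ι x => exact h' x
  | add a b ha hb => rw [map_add, map_add, ha, hb]
  | mul a b ha hb => rw [map_mul, map_mul, ha, hb]

lemma symPart_le_symDegree {M : Type*} [AddCommGroup M] [Module R M] {n : ℕ}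
    {s : SymmetricAlgebra R M} (hs : s ∈ symPart R M n) : s ∈ LieAlgebroid.symDegree R M n := by
  refine symPart_induction (p := fun n s => s ∈ LieAlgebroid.symDegree R M n) ?_ ?_ ?_ ?_ hs
  · exact Submodule.subset_span ⟨![], by simp⟩
  · exact fun n r a h => Submodule.smul_mem _ _ h
  · exact fun n a b ha hb => add_mem ha hb
  · intro n x a ha h
    clear ha
    induction h using Submodule.span_induction with
    | mem y hy =>
      obtain ⟨z, rfl⟩ := hy
      exact Submodule.subset_span ⟨Fin.cons x z, by simp [Fin.prod_univ_succ]⟩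
    | zero => rw [mul_zero]; exact zero_mem _
    | add y z _ _ hy hz => rw [mul_add]; exact add_mem hy hz
    | smul r y _ hy => rw [mul_smul_comm]; exact Submodule.smul_mem _ _ hy

end PairingNatural

section Series

open MvPowerSeries CoalgPresheaf

variable {K : Type u} [Field K] {X : TopCat.{u}} {O : TopCat.Sheaf (CommAlgCat.{u} K) X}

namespace LieAlgebroid.IsFrame

variable {L : LieAlgebroid O} {U V W : Opens X} {r : ℕ} {e : Fin r → L.Obj U} (he : L.IsFrame e)

/-- The section of `Ŝym(L^∨)` given by a power series in the linear forms dual to a frame. -/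
def ofSeries (hW : W ≤ U) (f : MvPowerSeries (Fin r) (Sec O W)) : L.SymHat W :=
  ⟨fun V => WithConv.toConv (symPairing (he.basis (V.2.trans hW))
    (MvPowerSeries.map (resRing O V.2) f)), by
    intro V V' hV h s
    change symPairing _ _ (symMapRing (L.restrictₛₗ h) s) = res O h (symPairing _ _ s)
    have h1 := symPairing_map (he.basis (hV.trans hW)) (he.basis ((h.trans hV).trans hW))
      (resRing O h) (L.restrictₛₗ h) (by simp) (MvPowerSeries.map (resRing O hV) f) s
    refine Eq.trans ?_ h1
    congr 2
    ext m
    simp⟩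

lemma symEval_ofSeries (hW : W ≤ U) (f : MvPowerSeries (Fin r) (Sec O W)) (h : V ≤ W) :
    L.symEval (he.ofSeries hW f) h =
      symPairing (he.basis (h.trans hW)) (MvPowerSeries.map (resRing O h) f) := rfl

lemma symEval_ofSeries_self (hW : W ≤ U) (f : MvPowerSeries (Fin r) (Sec O W)) :
    L.symEval (he.ofSeries hW f) le_rfl = symPairing (he.basis hW) f := by
  rw [symEval_ofSeries]
  congr 1
  ext m
  simp

/-- Over a frame, a section of `Ŝym(L^∨)` over `W` is determined by its values on `Sym L(W)`, as the
monomials in the frame generate the symmetric algebras over all smaller opens. -/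
lemma symHat_ext (he : L.IsFrame e) (hW : W ≤ U) {s t : L.SymHat W}
    (h : L.symEval s le_rfl = L.symEval t le_rfl) : s = t := by
  refine Dual.ext fun V hV c => ?_
  refine LinearMap.congr_fun (f := L.symEval s hV) (g := L.symEval t hV) ?_ c
  refine (he.basis (hV.trans hW)).symmetricAlgebra.ext fun m => ?_
  have h1 : (he.basis (hV.trans hW)).symmetricAlgebra m =
      L.symCoalg.map hV ((he.basis hW).symmetricAlgebra m) := by
    change (SymmetricAlgebra.equivMvPolynomial _).symm (MvPolynomial.monomial m 1) =
      symMapRing (L.restrictₛₗ hV)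
        ((SymmetricAlgebra.equivMvPolynomial _).symm (MvPolynomial.monomial m 1))
    rw [equivMvPolynomial_symm_monomial, equivMvPolynomial_symm_monomial, map_prod]
    simp
  rw [h1]
  refine (Dual.eval_map s le_rfl hV _).trans (Eq.trans ?_ (Dual.eval_map t le_rfl hV _).symm)
  exact congrArg (res O hV) (LinearMap.congr_fun h _)

/-- The morphism of algebras from power series in the linear forms dual to a frame. -/
def ofSeriesAlg (hW : W ≤ U) : MvPowerSeries (Fin r) (Sec O W) →ₐ[Sec O W] L.SymHat W where
  toFun := he.ofSeries hW
  map_one' := by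
    refine he.symHat_ext hW (LinearMap.ext fun s => ?_)
    rw [symEval_ofSeries_self, symPairing_one_left]
    exact (eval_one (C := L.symCoalg) le_rfl s).symm
  map_mul' f g := by
    refine he.symHat_ext hW (LinearMap.ext fun s => ?_)
    rw [symEval_ofSeries_self, symPairing_mul]
    refine Eq.trans ?_ (eval_mul (C := L.symCoalg) _ _ le_rfl s).symm
    rw [← symEval_ofSeries_self, ← symEval_ofSeries_self]
    rfl
  map_zero' := by
    refine he.symHat_ext hW (LinearMap.ext fun s => ?_)
    rw [symEval_ofSeries_self, symPairing_zero]
    rfl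
  map_add' f g := by
    refine he.symHat_ext hW (LinearMap.ext fun s => ?_)
    rw [symEval_ofSeries_self, symPairing_add, ← symEval_ofSeries_self, ← symEval_ofSeries_self]
    rfl
  commutes' a := by
    refine he.symHat_ext hW (LinearMap.ext fun s => ?_)
    rw [symEval_ofSeries_self, Algebra.algebraMap_eq_smul_one, Algebra.algebraMap_eq_smul_one,
      symPairing_smul, symPairing_one_left]
    refine Eq.trans ?_ (eval_smul _ a (1 : L.SymHat W) le_rfl s).symm
    rw [res_refl, eval_one]

lemma ofSeries_bijective [CharZero K] (hW : W ≤ U) : Function.Bijective (he.ofSeriesAlg hW) := by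
  constructor
  · intro f g h
    refine symPairing_injective (he.basis hW) K fun s => ?_
    rw [← symEval_ofSeries_self, ← symEval_ofSeries_self]
    exact congrArg (fun t : L.SymHat W => L.symEval t le_rfl s) h
  · intro t
    obtain ⟨f, hf⟩ := exists_symPairing_eq (he.basis hW) K (L.symEval t le_rfl)
    exact ⟨f, he.symHat_ext hW ((he.symEval_ofSeries_self hW f).trans hf)⟩

/-- Over a frame, `Ŝym(L^∨)` is the algebra of power series in the dual linear forms. -/
def seriesEquiv [CharZero K] (hW : W ≤ U) :
    MvPowerSeries (Fin r) (Sec O W) ≃ₐ[Sec O W] L.SymHat W :=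
  AlgEquiv.ofBijective (he.ofSeriesAlg hW) (he.ofSeries_bijective hW)

/-- The linear forms dual to a frame. -/
def coform (hW : W ≤ U) (i : Fin r) : L.Form W :=
  ⟨fun V => (he.basis (V.2.trans hW)).coord i, fun _ _ hV h x =>
    he.repr_restrict (hV.trans hW) h x i⟩

lemma linear_coform (hW : W ≤ U) (i : Fin r) :
    L.linear W (he.coform hW i) = he.ofSeriesAlg hW (MvPowerSeries.X i) := by
  refine he.symHat_ext hW (LinearMap.ext fun s => ?_)
  exact ((congrArg (fun g => g s) (he.symEval_ofSeries_self hW (MvPowerSeries.X i))).trans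
    (symPairing_X (he.basis hW) i s)).symm

lemma form_apply (hW : W ≤ U) (α : L.Form W) (h : V ≤ W) (x : L.Obj V) :
    α.1 ⟨V, h⟩ x = ∑ i, (he.basis (h.trans hW)).repr x i * res O h
      (α.1 ⟨W, le_rfl⟩ (he.basis hW i)) := by
  conv_lhs => rw [← (he.basis (h.trans hW)).sum_repr x, _root_.map_sum]
  refine Finset.sum_congr rfl fun i _ => ?_
  rw [_root_.map_smul, smul_eq_mul, ← α.2 W V le_rfl h, basis_apply, basis_apply, restrict_restrict]

lemma form_eval_sum {ι : Type*} (t : Finset ι) (α : ι → L.Form W) (h : V ≤ W) (x : L.Obj V) :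
    (∑ i ∈ t, α i).1 ⟨V, h⟩ x = ∑ i ∈ t, (α i).1 ⟨V, h⟩ x :=
  map_sum (⟨⟨fun β => β.1 ⟨V, h⟩ x, rfl⟩, fun _ _ => rfl⟩ : L.Form W →+ Sec O V) _ _

lemma sum_coform (hW : W ≤ U) (α : L.Form W) :
    ∑ i, α.1 ⟨W, le_rfl⟩ (he.basis hW i) • he.coform hW i = α := by
  refine Subtype.ext (funext fun V => LinearMap.ext fun x => ?_)
  rw [form_eval_sum, he.form_apply hW α V.2 x]
  exact Finset.sum_congr rfl fun i _ => mul_comm _ _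

/-- The basis of `L^∨(W)` dual to a frame. -/
def formBasis (hW : W ≤ U) : Module.Basis (Fin r) (Sec O W) (L.Form W) :=
  Module.Basis.ofEquivFun
    { toFun := fun α i => α.1 ⟨W, le_rfl⟩ (he.basis hW i)
      map_add' := fun _ _ => rfl
      map_smul' := fun a α => by
        funext i
        change res O le_rfl a * α.1 ⟨W, le_rfl⟩ (he.basis hW i) = _
        rw [res_refl]
        rfl
      invFun := fun a => ∑ i, a i • he.coform hW i
      left_inv := fun α => he.sum_coform hW α
      right_inv := fun a => by
        funext i
        refine (form_eval_sum _ _ _ _).trans ?_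
        change ∑ j, res O le_rfl (a j) * (he.basis hW).repr (he.basis hW i) j = _
        simp only [res_refl, Module.Basis.repr_self]
        simp [Finsupp.single_apply] }

lemma formBasis_apply (hW : W ≤ U) (i : Fin r) : he.formBasis hW i = he.coform hW i := by
  rw [formBasis, Module.Basis.coe_ofEquivFun]
  change ∑ j, (Function.update 0 i 1 : Fin r → Sec O W) j • he.coform hW j = _
  rw [Finset.sum_eq_single i]
  · rw [Function.update_self, one_smul]
  · intro j _ hj
    rw [Function.update_of_ne hj]
    exact zero_smul (Sec O W) (he.coform hW j)
  · exact fun h => absurd (Finset.mem_univ i) h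

/-- Over a frame, the canonical morphism is the inclusion of polynomials into power series. -/
lemma symToHat_eq (hW : W ≤ U) (q : SymmetricAlgebra (Sec O W) (L.Form W)) :
    L.symToHat W q = he.ofSeriesAlg hW
      (SymmetricAlgebra.equivMvPolynomial (he.formBasis hW) q : MvPolynomial _ _) := by
  have h : L.symToHat W = ((he.ofSeriesAlg hW).comp
      (MvPolynomial.coeToMvPowerSeries.algHom (Sec O W))).comp
        (SymmetricAlgebra.equivMvPolynomial (he.formBasis hW)).toAlgHom := by
    refine SymmetricAlgebra.algHom_ext ((he.formBasis hW).ext fun i => ?_)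
    rw [formBasis_apply]
    refine (SymmetricAlgebra.lift_ι_apply _ _).trans ?_
    rw [linear_coform]
    change _ = he.ofSeriesAlg hW (MvPolynomial.coeToMvPowerSeries.algHom (Sec O W)
      (SymmetricAlgebra.equivMvPolynomial (he.formBasis hW) (SymmetricAlgebra.ι _ _
        (he.coform hW i))))
    rw [← formBasis_apply, SymmetricAlgebra.equivMvPolynomial_ι_apply]
    simp
  rw [h]
  simp

lemma symToHat_injective [CharZero K] (he : L.IsFrame e) (hW : W ≤ U) :
    Function.Injective (L.symToHat W) := by
  intro a b h
  rw [he.symToHat_eq hW, he.symToHat_eq hW] at h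
  exact (SymmetricAlgebra.equivMvPolynomial (he.formBasis hW)).injective
    (MvPolynomial.coe_injective _ _ ((he.ofSeries_bijective hW).1 h))

/-- Over a frame, the restriction to `Sym^n L` of a section of `Ŝym(L^∨)` is given by the
homogeneous part of degree `n` of the corresponding power series. -/
lemma exists_symDegree [CharZero K] (he : L.IsFrame e) (hW : W ≤ U) (s : L.SymHat W) (n : ℕ) :
    ∃ q ∈ symDegree (Sec O W) (L.Form W) n, ∀ c ∈ symPart (Sec O W) (L.Obj W) n,
      L.symEval (L.symToHat W q) le_rfl c = L.symEval s le_rfl c := by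
  obtain ⟨f, rfl⟩ := (he.ofSeries_bijective hW).2 s
  -- the homogeneous part of degree `n` of `f`
  let p : MvPolynomial (Fin r) (Sec O W) :=
    ∑ m ∈ Finset.univ.finsuppAntidiag n, coeff m f • MvPolynomial.monomial m 1
  have hp : ∀ m : Fin r →₀ ℕ, m.degree = n → MvPolynomial.coeff m p = coeff m f := by
    intro m hm
    have hm' : m ∈ Finset.univ.finsuppAntidiag n := by
      rw [Finset.mem_finsuppAntidiag]
      exact ⟨by rw [← hm, Finsupp.degree_eq_sum], Finset.subset_univ _⟩
    rw [MvPolynomial.coeff_sum, Finset.sum_eq_single m]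
    · simp
    · intro m' _ h
      simp [MvPolynomial.coeff_monomial, h]
    · exact fun h => absurd hm' h
  refine ⟨(SymmetricAlgebra.equivMvPolynomial (he.formBasis hW)).symm p, ?_, fun c hc => ?_⟩
  · rw [_root_.map_sum]
    refine sum_mem fun m hm => ?_
    rw [_root_.map_smul, equivMvPolynomial_symm_monomial]
    refine Submodule.smul_mem _ _ (symPart_le_symDegree ?_)
    rw [Finset.mem_finsuppAntidiag] at hm
    rw [← hm.1]
    exact prod_pow_mem_symPart _ _
  · rw [he.symToHat_eq hW, AlgEquiv.apply_symm_apply]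
    refine (LinearMap.congr_fun (he.symEval_ofSeries_self hW _) c).trans
      (Eq.trans ?_ (LinearMap.congr_fun (he.symEval_ofSeries_self hW f) c).symm)
    rw [← sub_add_cancel f (p : MvPowerSeries (Fin r) (Sec O W)), symPairing_add, right_eq_add]
    refine symPairing_eq_zero _ (fun m hm => ?_) hc
    rw [_root_.map_sub, MvPolynomial.coeff_coe, hp m hm, sub_self]

end LieAlgebroid.IsFrame

namespace LieAlgebroid

variable {L : LieAlgebroid O} {U V W : Opens X}

lemma symToHat_formRes (h : V ≤ W) (q : SymmetricAlgebra (Sec O W) (L.Form W)) :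
    L.symToHat V (symMapRing (L.formRes h) q) = L.symCoalg.dualRes h (L.symToHat W q) := by
  refine RingHom.congr_fun (f := (L.symToHat V).toRingHom.comp (symMapRing (L.formRes h)))
    (g := (L.symCoalg.dualRes h).comp (L.symToHat W).toRingHom)
    (sym_ringHom_ext (fun a => ?_) fun α => ?_) q
  · refine ((congrArg (L.symToHat V) (symMapRing_algebraMap _ a)).trans
      ((L.symToHat V).commutes _)).trans ?_
    refine Eq.trans ?_ (congrArg (L.symCoalg.dualRes h) ((L.symToHat W).commutes a)).symm
    refine Subtype.ext (funext fun V' => ?_)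
    change algebraMap _ (WithConv _) (res O V'.2 (res O h a)) =
      algebraMap _ (WithConv _) (res O _ a)
    rw [res_res]
  · refine (congrArg (L.symToHat V) (symMapRing_ι _ α)).trans
      ((SymmetricAlgebra.lift_ι_apply _ _).trans ?_)
    exact (congrArg (L.symCoalg.dualRes h) (SymmetricAlgebra.lift_ι_apply (L.linear W) α)).symm

/-- `Ŝym(L^∨)` is the degree completion of the symmetric algebras of `L^∨`: both conditions are
local, and over a frame they hold for polynomials and power series. -/
lemma symHatIsCompletion [CharZero K] {r : ℕ} (hL : L.IsLocallyFreeOfRank r) :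
    L.SymHatIsCompletion := by
  refine ⟨fun W q hq p hp => ?_, fun W s n p hp => ?_⟩
  · obtain ⟨U, hpU, e, he⟩ := hL p
    have he' : L.IsFrame e := he
    refine ⟨W ⊓ U, inf_le_left, ⟨hp, hpU⟩, he'.symToHat_injective inf_le_right ?_⟩
    rw [symToHat_formRes, hq, _root_.map_zero, _root_.map_zero]
  · obtain ⟨U, hpU, e, he⟩ := hL p
    have he' : L.IsFrame e := he
    obtain ⟨q, hq, h⟩ := he'.exists_symDegree (W := W ⊓ U) inf_le_right
      (L.symCoalg.dualRes inf_le_left s) n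
    exact ⟨W ⊓ U, inf_le_left, ⟨hp, hpU⟩, q, hq, fun x => h _ (prod_ι_mem_symPart x)⟩

end LieAlgebroid

end Series

/-! ### Coordinates on algebras of power series -/

section Jacobian

open MvPowerSeries

variable {R B σ : Type*} [CommRing R] [CommRing B] [Algebra R B] [Fintype σ]

/-- A power series of order at least `k + 1` is a combination of the variables with coefficients of
order at least `k`, by Euler's formula. -/
lemma exists_eq_sum_X_mul (K : Type*) [Field K] [CharZero K] [Algebra K R] {k : ℕ}
    {f : MvPowerSeries σ R} (hf : f ∈ ordIdeal σ R (k + 1)) :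
    ∃ h : σ → MvPowerSeries σ R, (∀ i, h i ∈ ordIdeal σ R k) ∧ f = ∑ i, X i * h i := by
  let F : MvPowerSeries σ R := fun m => algebraMap K R ((m.degree : K)⁻¹) * coeff m f
  have hF : ∀ m, coeff m F = algebraMap K R ((m.degree : K)⁻¹) * coeff m f := fun _ => rfl
  refine ⟨fun i => pderiv R i F, fun i => pderiv_mem_ordIdeal (fun m hm => ?_) i, ?_⟩
  · rw [hF, hf m hm, mul_zero]
  · ext m
    rw [coeff_sum_X_mul_pderiv, hF]
    by_cases hm : m.degree = 0
    · rw [hf m (by omega)]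
      simp
    · rw [← mul_assoc, ← map_natCast (algebraMap K R), ← map_mul,
        mul_inv_cancel₀ (Nat.cast_ne_zero.mpr hm), map_one, one_mul]

variable (Ψ : MvPowerSeries σ R ≃ₐ[R] B) (ε : B →ₐ[R] R)

/-- Any morphism to `R` from an algebra isomorphic to power series sends power series without
constant term to the Jacobson radical, as `1 + u f` is invertible for such a series `f`. -/
lemma map_mem_jacobson {f : MvPowerSeries σ R} (hf : f ∈ ordIdeal σ R 1) :
    ε (Ψ f) ∈ Ideal.jacobson (⊥ : Ideal R) := by
  rw [Ideal.mem_jacobson_bot]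
  intro y
  have h : IsUnit (f * C y + 1) := by
    rw [MvPowerSeries.isUnit_iff_constantCoeff, map_add, map_mul]
    have h0 : constantCoeff f = 0 := hf 0 (by simp)
    rw [h0, zero_mul, zero_add, map_one]
    exact isUnit_one
  have h2 := (h.map Ψ).map ε
  rw [map_add, map_add, map_mul, map_mul, map_one, map_one] at h2
  have h3 : ε (Ψ (C y)) = y := by
    have h4 := ((ε.comp Ψ.toAlgHom).commutes y)
    exact h4
  rwa [h3] at h2

variable [DecidableEq σ]

/-- A power series agrees with its constant and linear terms to second order. -/
lemma sub_linear_mem_ordIdeal (f : MvPowerSeries σ R) :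
    f - C (constantCoeff f) - ∑ i, coeff (Finsupp.single i 1) f • X i ∈ ordIdeal σ R 2 := by
  intro m hm
  rw [map_sub, map_sub, map_sum, coeff_C]
  by_cases h0 : m = 0
  · subst h0
    simp
  · have h1 : m.degree = 1 := by
      have : m.degree ≠ 0 := fun h => h0 ((Finsupp.degree_eq_zero_iff m).mp h)
      omega
    obtain ⟨j, rfl⟩ : ∃ j, m = Finsupp.single j 1 := by
      obtain ⟨j, hj⟩ := Finsupp.ne_iff.mp h0
      have hle : Finsupp.single j 1 ≤ m := by
        simpa [Finsupp.single_le_iff] using Nat.one_le_iff_ne_zero.mpr hj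
      have hs := add_tsub_cancel_of_le hle
      have hd := congrArg Finsupp.degree hs
      rw [map_add, Finsupp.degree_single, h1, add_eq_left, Finsupp.degree_eq_zero_iff] at hd
      exact ⟨j, by rw [← hs, hd, add_zero]⟩
    rw [Finset.sum_eq_single j]
    · simp [h0]
    · intro i _ hi
      rw [map_smul, coeff_X, if_neg, smul_zero]
      intro h
      exact hi (Finsupp.single_left_injective one_ne_zero h).symm
    · simp

/-- A system of parameters of an algebra isomorphic to power series has an invertible Jacobian
matrix with respect to `ε`-derivations `D_k`, provided that some elements `η_i` satisfy
`D_k η_i = δ_{ik}`: modulo the Jacobson radical, a left inverse is given by the linear parts of the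
power series of the `η_i`. -/
lemma isUnit_jacobian (K : Type*) [Field K] [CharZero K] [Algebra K R] (D : σ → B →ₗ[R] R)
    (hD : ∀ k a b, D k (a * b) = ε a * D k b + ε b * D k a) (η : σ → B)
    (hη : ∀ i k, D k (η i) = if i = k then 1 else 0) :
    IsUnit (Matrix.of fun i k => D k (Ψ (X i))).det := by
  let J := Ideal.jacobson (⊥ : Ideal R)
  let M : Matrix σ σ R := Matrix.of fun i k => D k (Ψ (X i))
  let M' : Matrix σ σ R := Matrix.of fun i l => coeff (Finsupp.single l 1) (Ψ.symm (η i))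
  have hD1 : ∀ k, D k 1 = 0 := fun k => by
    have h := hD k 1 1
    rwa [mul_one, map_one ε, one_mul, left_eq_add] at h
  -- series without constant and linear terms contribute only elements of the Jacobson radical
  have hquad : ∀ k, ∀ f ∈ ordIdeal σ R 2, D k (Ψ f) ∈ J := by
    intro k f hf
    obtain ⟨h, hh, rfl⟩ := exists_eq_sum_X_mul K hf
    rw [map_sum, map_sum]
    refine sum_mem fun i _ => ?_
    rw [map_mul, hD]
    exact add_mem (Ideal.mul_mem_right _ _ (map_mem_jacobson Ψ ε (X_mem_ordIdeal i)))
      (Ideal.mul_mem_right _ _ (map_mem_jacobson Ψ ε (hh i)))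
  have hprod : (Ideal.Quotient.mk J).mapMatrix (M' * M) = 1 := by
    ext i k
    rw [RingHom.mapMatrix_apply, Matrix.map_apply]
    have h1 := hquad k _ (sub_linear_mem_ordIdeal (Ψ.symm (η i)))
    have h2 : ∀ a : R, Ψ (C a) = a • 1 := fun a => by
      rw [← Algebra.algebraMap_eq_smul_one]
      exact Ψ.commutes a
    rw [map_sub, map_sub, map_sub, map_sub, AlgEquiv.apply_symm_apply, h2, map_smul, hD1,
      smul_zero, sub_zero, map_sum, map_sum, hη] at h1
    have h3 : ∑ l, D k (Ψ (coeff (Finsupp.single l 1) (Ψ.symm (η i)) • X l)) = (M' * M) i k := by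
      rw [Matrix.mul_apply]
      exact Finset.sum_congr rfl fun l _ => by rw [map_smul, map_smul]; rfl
    rw [h3, ← Ideal.Quotient.eq_zero_iff_mem, map_sub, sub_eq_zero] at h1
    rw [← h1, Matrix.one_apply]
    split <;> simp
  rw [map_mul] at hprod
  have h4 := Matrix.isUnit_det_of_left_inverse hprod
  rw [← RingHom.map_det] at h4
  have : IsLocalHom (Ideal.Quotient.mk J) := isLocalHom_of_le_jacobson_bot J le_rfl
  exact isUnit_of_map_unit _ _ h4

end Jacobian

/-! ### The connection defined by an isomorphism -/

section DegreeOne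

variable {K R L : Type*} [Field K] [CommRing R] [Algebra K R] [LieRing L] [LieAlgebra K L]
  [Module R L] [LieRingModule L R] [LieRinehartRing R L] [LieRinehartAlgebra K R L] [CharZero K]

lemma ModuleConnection.pbw_ι (nab : ModuleConnection R L L) (x : L) :
    nab.pbw K (SymmetricAlgebra.ι R L x) = Env.ofLie K x := by
  have h1 : SymmetricAlgebra.ι R L x = ∏ i : Fin 1, SymmetricAlgebra.ι R L ((fun _ => x) i) := by
    simp
  have h2 := nab.covIter_succ_prod (envConnection K R L) 1 (fun _ : Fin 1 => x)
  rw [pbw, h1, adaptedMap_apply _ _ _ _ (prod_ι_mem_symPart _), h2]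
  simp [covIter_zero_one]

end DegreeOne

section Converse

open CoalgPresheaf

variable {K : Type u} [Field K] {X : TopCat.{u}} {O : TopCat.Sheaf (CommAlgCat.{u} K) X}

namespace LieAlgebroid

variable {L : LieAlgebroid O} {U V W : Opens X}

/-- The connection on the domain of a frame for which the frame is flat. -/
def IsFrame.flat {r : ℕ} {e : Fin r → L.Obj U} (he : L.IsFrame e) : L.ConnectionOn U where
  nabla V hV :=
    { op :=
        { toFun := fun x =>
            { toFun := fun y => ∑ i, ⁅x, (he.basis hV).repr y i⁆ • he.basis hV i
              map_zero' := by simp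
              map_add' := fun y z => by simp [add_smul, Finset.sum_add_distrib] }
          map_add' := fun x x' => by
            ext y
            simp [add_smul, Finset.sum_add_distrib]
          map_smul' := fun a x => by
            ext y
            simp only [AddMonoidHom.coe_mk, ZeroHom.coe_mk, LieRinehartRing.lie_smul_eq_mul,
              mul_smul, RingHom.id_apply, ← Finset.smul_sum]
            rfl }
      leibniz := fun x a y => by
        have h : ⁅x, a⁆ • y = ∑ i, ⁅x, a⁆ • (he.basis hV).repr y i • he.basis hV i := by
          rw [← Finset.smul_sum, (he.basis hV).sum_repr]
        change ∑ i, ⁅x, (he.basis hV).repr (a • y) i⁆ • he.basis hV i =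
          a • ∑ i, ⁅x, (he.basis hV).repr y i⁆ • he.basis hV i + ⁅x, a⁆ • y
        rw [h, Finset.smul_sum, ← Finset.sum_add_distrib]
        refine Finset.sum_congr rfl fun i _ => ?_
        rw [_root_.map_smul, Finsupp.smul_apply, smul_eq_mul, LieRinehartRing.leibniz_mul_right,
          add_smul]
        simp only [smul_smul, smul_eq_mul] }
  nabla_restrict {V V'} hV h x y := by
    change ∑ i, ⁅L.restrict h x, (he.basis (h.trans hV)).repr (L.restrict h y) i⁆ •
      he.basis (h.trans hV) i = L.restrict h (∑ i, ⁅x, (he.basis hV).repr y i⁆ • he.basis hV i)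
    rw [← restrictₛₗ_apply L h (∑ i, _), _root_.map_sum]
    refine Finset.sum_congr rfl fun i _ => ?_
    rw [LinearMap.map_smulₛₗ, he.repr_restrict hV h, restrictₛₗ_apply, IsFrame.basis_apply,
      IsFrame.basis_apply, restrict_restrict]
    congr 1
    exact (L.map_anchor h x _).symm

/-- Evaluation of jets at `1`. -/
def jetOne (W : Opens X) : L.Jet W →ₐ[Sec O W] Sec O W where
  toFun φ := L.jetEval φ le_rfl 1
  map_one' := (eval_one (C := L.envCoalg) le_rfl _).trans Env.counit_one
  map_mul' φ ψ := by
    refine (eval_mul (C := L.envCoalg) φ ψ le_rfl 1).trans ?_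
    rw [Env.coalgebra_comul, Env.comul_one, TensorProduct.map_tmul, LinearMap.mul'_apply]
    rfl
  map_zero' := rfl
  map_add' _ _ := rfl
  commutes' a := by
    rw [Algebra.algebraMap_eq_smul_one]
    refine (eval_smul _ a (1 : L.Jet W) le_rfl _).trans ?_
    rw [res_refl, eval_one]
    exact (congrArg (a * ·) Env.counit_one).trans (mul_one a)

/-- Evaluation of jets at `x ∈ L`. -/
def jetLie (x : L.Obj W) : L.Jet W →ₗ[Sec O W] Sec O W where
  toFun φ := L.jetEval φ le_rfl (Env.ofLie K x)
  map_add' _ _ := rfl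
  map_smul' a φ := (eval_smul _ a φ le_rfl _).trans (by rw [res_refl]; rfl)

/-- Evaluation at `x ∈ L` is a derivation over evaluation at `1`, because `x` is primitive. -/
lemma jetLie_mul (x : L.Obj W) (φ ψ : L.Jet W) :
    jetLie x (φ * ψ) = jetOne W φ * jetLie x ψ + jetOne W ψ * jetLie x φ := by
  refine (eval_mul (C := L.envCoalg) φ ψ le_rfl _).trans ?_
  rw [Env.coalgebra_comul, Env.comul_ofLie, _root_.map_add, _root_.map_add, TensorProduct.map_tmul,
    TensorProduct.map_tmul, LinearMap.mul'_apply, LinearMap.mul'_apply, add_comm]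
  exact congrArg₂ _ rfl (mul_comm _ _)

lemma jetLie_sum_smul {ι : Type*} (t : Finset ι) (a : ι → Sec O W) (x : ι → L.Obj W) (φ : L.Jet W) :
    jetLie (∑ i ∈ t, a i • x i) φ = ∑ i ∈ t, a i * jetLie (x i) φ := by
  change L.jetEval φ le_rfl (Env.ofLie K (∑ i ∈ t, a i • x i)) = _
  rw [_root_.map_sum, _root_.map_sum]
  refine Finset.sum_congr rfl fun i _ => ?_
  rw [← Env.smul_ofLie, _root_.map_smul]
  rfl

section

variable (j : DualIso L.envCoalg L.symCoalg)

lemma symm_dualRes (h : V ≤ W) (s : L.SymHat W) :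
    (j.equiv V).symm (L.symCoalg.dualRes h s) = L.envCoalg.dualRes h ((j.equiv W).symm s) := by
  rw [AlgEquiv.symm_apply_eq, j.equiv_res, AlgEquiv.apply_symm_apply]

/-- The jet corresponding to a linear form under an isomorphism from jets to the completed symmetric
algebra. -/
def formJet (W : Opens X) : L.Form W →ₗ[Sec O W] L.Jet W :=
  (j.equiv W).symm.toLinearMap ∘ₗ L.linear W

lemma formJet_apply (α : L.Form W) : formJet j W α = (j.equiv W).symm (L.linear W α) := rfl

lemma formJet_formRes (h : V ≤ W) (α : L.Form W) :
    formJet j V (L.formRes h α) = L.envCoalg.dualRes h (formJet j W α) :=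
  symm_dualRes j h (L.linear W α)

lemma jetEval_formRes (h : V ≤ W) (α : L.Form W) (D : Env K (Sec O W) (L.Obj W)) :
    L.jetEval (formJet j V (L.formRes h α)) le_rfl (L.envCoalg.map h D) =
      res O h (L.jetEval (formJet j W α) le_rfl D) := by
  rw [formJet_formRes]
  exact Dual.eval_map (formJet j W α) le_rfl h D

variable [CharZero K]

/-- The linear forms dual to a frame correspond, under an arbitrary isomorphism `j`, to jets whose
values on `L` are again coordinates: a section `z` of `L` is determined by these values, and they may
be prescribed. -/
lemma IsFrame.existsUnique_jetLie {r : ℕ} (hL : L.IsLocallyFreeOfRank r) {e : Fin r → L.Obj U}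
    (he : L.IsFrame e) (hW : W ≤ U) (v : Fin r → Sec O W) :
    ∃! z : L.Obj W, ∀ i, jetLie z (formJet j W (he.coform hW i)) = v i := by
  let M : Matrix (Fin r) (Fin r) (Sec O W) :=
    Matrix.of fun i k => jetLie (he.basis hW k) (formJet j W (he.coform hW i))
  -- the jets which the flat connection of the frame assigns to the variables are dual to the frame
  have hM : IsUnit M.det := by
    have h := isUnit_jacobian ((he.seriesEquiv hW).trans (j.equiv W).symm) (jetOne W) K
      (fun k => jetLie (he.basis hW k)) (fun k => jetLie_mul _)
      (fun i => (he.flat.pbwIso hL hW).symm (he.ofSeriesAlg hW (MvPowerSeries.X i))) (by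
        intro i k
        have h1 := he.flat.symEval_pbwIso hL hW
          ((he.flat.pbwIso hL hW).symm (he.ofSeriesAlg hW (MvPowerSeries.X i))) le_rfl
          (SymmetricAlgebra.ι _ _ (he.basis hW k))
        rw [AlgEquiv.apply_symm_apply, ModuleConnection.pbw_ι] at h1
        refine h1.symm.trans ((LinearMap.congr_fun (he.symEval_ofSeries_self hW _) _).trans ?_)
        rw [symPairing_ι_basis, MvPowerSeries.coeff_X]
        simp [Finsupp.single_left_inj, eq_comm])
    have hM' : M = Matrix.of fun i k => jetLie (he.basis hW k)
        (((he.seriesEquiv hW).trans (j.equiv W).symm) (MvPowerSeries.X i)) := by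
      ext i k
      change jetLie (he.basis hW k) (formJet j W (he.coform hW i)) = _
      rw [formJet_apply, linear_coform]
      rfl
    rwa [hM']
  have hz : ∀ z : L.Obj W, (fun i => jetLie z (formJet j W (he.coform hW i))) =
      M.mulVec ((he.basis hW).repr z) := by
    intro z
    funext i
    conv_lhs => rw [← (he.basis hW).sum_repr z, jetLie_sum_smul]
    exact Finset.sum_congr rfl fun k _ => mul_comm _ _
  refine ⟨∑ k, M⁻¹.mulVec v k • he.basis hW k, ?_, fun z hzv => ?_⟩
  · refine congrFun ((hz _).trans ?_)
    have h : (⇑((he.basis hW).repr (∑ k, M⁻¹.mulVec v k • he.basis hW k)) : Fin r → Sec O W) =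
        M⁻¹.mulVec v := (he.basis hW).repr_sum_self _
    rw [h, Matrix.mulVec_mulVec, Matrix.mul_nonsing_inv _ hM, Matrix.one_mulVec]
  · have h : M.mulVec ((he.basis hW).repr z) = v := (hz z).symm.trans (funext hzv)
    rw [← h, Matrix.mulVec_mulVec, Matrix.nonsing_inv_mul _ hM, Matrix.one_mulVec]
    exact ((he.basis hW).sum_repr z).symm

/-- The section `z` is the value `∇_x y` of the connection defined by the isomorphism `j`. The
condition is imposed over all smaller open sets, as `L^∨` may have few sections over `W`. -/
def IsNabla (x y z : L.Obj W) : Prop :=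
  ∀ (V : Opens X) (h : V ≤ W) (α : L.Form V),
    L.jetEval (formJet j V α) le_rfl
        (Env.ofLie K (L.restrict h x) * Env.ofLie K (L.restrict h y)) =
      L.jetEval (formJet j V α) le_rfl (Env.ofLie K (L.restrict h z))

variable {j}

lemma IsNabla.restrict {x y z : L.Obj W} (H : IsNabla j x y z) (h : V ≤ W) :
    IsNabla j (L.restrict h x) (L.restrict h y) (L.restrict h z) := by
  intro V' h' α
  simp only [restrict_restrict]
  exact H V' (h'.trans h) α

lemma IsNabla.eval {x y z : L.Obj W} (H : IsNabla j x y z) (α : L.Form W) :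
    L.jetEval (formJet j W α) le_rfl (Env.ofLie K x * Env.ofLie K y) =
      L.jetEval (formJet j W α) le_rfl (Env.ofLie K z) := by
  have h := H W le_rfl α
  simpa only [restrict_refl] using h

lemma map_ofLie (h : V ≤ W) (x : L.Obj W) :
    L.envCoalg.map h (Env.ofLie K x) = Env.ofLie K (L.restrict h x) :=
  Env.mapAlg_ofLie _ x

lemma map_ofLie_mul (h : V ≤ W) (x y : L.Obj W) :
    L.envCoalg.map h (Env.ofLie K x * Env.ofLie K y) =
      Env.ofLie K (L.restrict h x) * Env.ofLie K (L.restrict h y) :=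
  (map_mul (Env.mapAlg (L.restrict h)) _ _).trans
    (congrArg₂ (· * ·) (map_ofLie h x) (map_ofLie h y))

/-- Over a frame it is enough to test on the dual linear forms. -/
lemma isNabla_of_frame {r : ℕ} {e : Fin r → L.Obj U} (he : L.IsFrame e) (hW : W ≤ U)
    {x y z : L.Obj W}
    (H : ∀ i, L.jetEval (formJet j W (he.coform hW i)) le_rfl (Env.ofLie K x * Env.ofLie K y) =
      L.jetEval (formJet j W (he.coform hW i)) le_rfl (Env.ofLie K z)) : IsNabla j x y z := by
  intro V h α
  have h1 : ∀ D : Env K (Sec O V) (L.Obj V), L.jetEval (formJet j V α) le_rfl D =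
      ∑ i, α.1 ⟨V, le_rfl⟩ (he.basis (h.trans hW) i) *
        L.jetEval (formJet j V (he.coform (h.trans hW) i)) le_rfl D := by
    intro D
    conv_lhs => rw [← he.sum_coform (h.trans hW) α, _root_.map_sum]
    refine (eval_sum (C := L.envCoalg) _ _ le_rfl D).trans (Finset.sum_congr rfl fun i _ => ?_)
    rw [_root_.map_smul]
    exact (eval_smul L.envCoalg _ _ le_rfl D).trans (by rw [res_refl]; rfl)
  rw [h1, h1]
  refine Finset.sum_congr rfl fun i _ => congrArg _ ?_
  rw [← map_ofLie_mul, ← map_ofLie]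
  have h2 := congrArg (res O h) (H i)
  rw [← jetEval_formRes, ← jetEval_formRes] at h2
  exact h2

lemma IsNabla.unique {r : ℕ} (hL : L.IsLocallyFreeOfRank r) {x y z z' : L.Obj W}
    (H : IsNabla j x y z) (H' : IsNabla j x y z') : z = z' := by
  refine L.obj_ext fun p hp => ?_
  obtain ⟨U, hpU, e, he⟩ := hL p
  have he' : L.IsFrame e := he
  refine ⟨W ⊓ U, inf_le_left, ⟨hp, hpU⟩, ?_⟩
  refine (he'.existsUnique_jetLie j hL (W := W ⊓ U) inf_le_right fun i => jetLie
    (L.restrict inf_le_left z) (formJet j _ (he'.coform inf_le_right i))).unique (fun _ => rfl)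
    fun i => ?_
  exact ((H' _ inf_le_left _).symm.trans (H _ inf_le_left _))

/-- The value `∇_x y` exists locally over frames, and glues by uniqueness. -/
lemma exists_isNabla {r : ℕ} (hL : L.IsLocallyFreeOfRank r) (j : DualIso L.envCoalg L.symCoalg)
    (x y : L.Obj W) : ∃ z, IsNabla j x y z := by
  have hloc : ∀ p : W, ∃ (V : Opens X) (h : V ≤ W) (z : L.Obj V), p.1 ∈ V ∧
      IsNabla j (L.restrict h x) (L.restrict h y) z := by
    intro p
    obtain ⟨U, hpU, e, he⟩ := hL p.1
    have he' : L.IsFrame e := he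
    obtain ⟨z, hz, -⟩ := he'.existsUnique_jetLie j hL (W := W ⊓ U) inf_le_right fun i =>
      L.jetEval (formJet j _ (he'.coform inf_le_right i)) le_rfl
        (Env.ofLie K (L.restrict inf_le_left x) * Env.ofLie K (L.restrict inf_le_left y))
    exact ⟨W ⊓ U, inf_le_left, z, ⟨p.2, hpU⟩,
      isNabla_of_frame he' inf_le_right fun i => (hz i).symm⟩
  choose V hV z hp hz using hloc
  obtain ⟨s, hs, -⟩ := L.sheaf.existsUnique_gluing' V W (fun p => homOfLE (hV p))
    (fun p hpW => Opens.mem_iSup.mpr ⟨⟨p, hpW⟩, hp ⟨p, hpW⟩⟩) z (by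
      intro p q
      have h1 := (hz p).restrict (V := V p ⊓ V q) inf_le_left
      have h2 := (hz q).restrict (V := V p ⊓ V q) inf_le_right
      simp only [restrict_restrict] at h1 h2
      exact h1.unique hL h2)
  have hs' : ∀ p, L.restrict (hV p) s = z p := hs
  refine ⟨s, fun V' h α => sec_ext fun p hpV => ?_⟩
  let q : W := ⟨p, h hpV⟩
  refine ⟨V' ⊓ V q, inf_le_left, ⟨hpV, hp q⟩, ?_⟩
  have h1 := (hz q) (V' ⊓ V q) inf_le_right (L.formRes inf_le_left α)
  rw [← hs' q] at h1
  simp only [restrict_restrict] at h1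
  rw [← jetEval_formRes, ← jetEval_formRes, map_ofLie_mul, map_ofLie]
  simp only [restrict_restrict]
  exact h1

lemma IsNabla.add_left {x x' y z z' : L.Obj W} (H : IsNabla j x y z) (H' : IsNabla j x' y z') :
    IsNabla j (x + x') y (z + z') := by
  intro V h α
  simp only [_root_.map_add, add_mul, H V h α, H' V h α]

lemma IsNabla.add_right {x y y' z z' : L.Obj W} (H : IsNabla j x y z) (H' : IsNabla j x y' z') :
    IsNabla j x (y + y') (z + z') := by
  intro V h α
  simp only [_root_.map_add, mul_add, H V h α, H' V h α]

lemma restrict_smul (h : V ≤ W) (a : Sec O W) (x : L.Obj W) :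
    L.restrict h (a • x) = res O h a • L.restrict h x := L.map_smul h a x

lemma IsNabla.smul_left {x y z : L.Obj W} (H : IsNabla j x y z) (a : Sec O W) :
    IsNabla j (a • x) y (a • z) := by
  intro V h α
  rw [restrict_smul, restrict_smul, ← Env.smul_ofLie, ← Env.smul_ofLie, smul_mul_assoc,
    _root_.map_smul, _root_.map_smul, H V h α]

/-- The Leibniz identity, a consequence of `x a = a x + x(a)` in `U(L)`. -/
lemma IsNabla.smul_right {x y z : L.Obj W} (H : IsNabla j x y z) (a : Sec O W) :
    IsNabla j x (a • y) (a • z + ⁅x, a⁆ • y) := by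
  intro V h α
  rw [_root_.map_add, restrict_smul, restrict_smul, restrict_smul, _root_.map_add,
    ← Env.smul_ofLie, ← Env.smul_ofLie, ← Env.smul_ofLie, Env.ofLie_mul_smul, _root_.map_add,
    _root_.map_add, _root_.map_smul, _root_.map_smul, _root_.map_smul, _root_.map_smul, H V h α]
  congr 2
  exact (L.map_anchor h x a).symm

lemma IsNabla.smul_const {x y z : L.Obj W} (H : IsNabla j x y z) (k : K) :
    IsNabla j x (k • y) (k • z) := by
  have h := H.smul_right (algebraMap K (Sec O W) k)
  have h0 : ⁅x, algebraMap K (Sec O W) k⁆ = 0 :=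
    Derivation.map_algebraMap (LieRinehartAlgebra.anchor K (Sec O W) (L.Obj W) x) k
  rwa [h0, zero_smul, add_zero, algebraMap_smul, algebraMap_smul] at h

/-- The connection defined by an isomorphism from jets to the completed symmetric algebra. -/
def connectionOfIso {r : ℕ} (hL : L.IsLocallyFreeOfRank r) (j : DualIso L.envCoalg L.symCoalg) :
    L.Connection where
  nabla _ :=
    { toFun := fun x =>
        { toFun := fun y => (exists_isNabla hL j x y).choose
          map_add' := fun y y' => (exists_isNabla hL j x (y + y')).choose_spec.unique hL
            ((exists_isNabla hL j x y).choose_spec.add_right (exists_isNabla hL j x y').choose_spec)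
          map_smul' := fun k y => (exists_isNabla hL j x (k • y)).choose_spec.unique hL
            ((exists_isNabla hL j x y).choose_spec.smul_const k) }
      map_add' := fun x x' => LinearMap.ext fun y =>
        (exists_isNabla hL j (x + x') y).choose_spec.unique hL
          ((exists_isNabla hL j x y).choose_spec.add_left (exists_isNabla hL j x' y).choose_spec)
      map_smul' := fun a x => LinearMap.ext fun y =>
        (exists_isNabla hL j (a • x) y).choose_spec.unique hL
          ((exists_isNabla hL j x y).choose_spec.smul_left a) }
  leibniz _ x a y := (exists_isNabla hL j x (a • y)).choose_spec.unique hL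
    ((exists_isNabla hL j x y).choose_spec.smul_right a)
  nabla_restrict h x y := (exists_isNabla hL j _ _).choose_spec.unique hL
    ((exists_isNabla hL j x y).choose_spec.restrict h)

lemma isNabla_connectionOfIso {r : ℕ} (hL : L.IsLocallyFreeOfRank r)
    (j : DualIso L.envCoalg L.symCoalg) (x y : L.Obj W) :
    IsNabla j x y ((connectionOfIso hL j).nabla W x y) :=
  (exists_isNabla hL j x y).choose_spec

/-- An isomorphism from jets to the completed symmetric algebra defines a unique connection. -/
lemma existsUnique_connection {r : ℕ} (hL : L.IsLocallyFreeOfRank r)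
    (j : DualIso L.envCoalg L.symCoalg) :
    ∃! nab : L.Connection, ∀ (W : Opens X) (α : L.Form W) (x y : L.Obj W),
      L.jetEval ((j.equiv W).symm (L.linear W α)) le_rfl (Env.ofLie K x * Env.ofLie K y) =
        L.jetEval ((j.equiv W).symm (L.linear W α)) le_rfl
          (Env.ofLie K (nab.nabla W x y)) := by
  refine ⟨connectionOfIso hL j,
    fun W α x y => (isNabla_connectionOfIso hL j x y).eval α, fun nab H => ?_⟩
  refine Connection.ext (funext fun W => LinearMap.ext fun x => LinearMap.ext fun y => ?_)
  refine IsNabla.unique hL (fun V h α => ?_) (isNabla_connectionOfIso hL j x y)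
  rw [← nab.nabla_restrict h]
  exact H V α _ _

end

end LieAlgebroid

end Converse

end LieAlgebroidPBW

end

theorem mainTheorem4 {K : Type u} [Field K] [CharZero K] {X : TopCat.{u}}
    (O : TopCat.Sheaf (CommAlgCat.{u} K) X) (L : LieAlgebroidPBW.LieAlgebroid O)
    (r : ℕ) (hL : L.IsLocallyFreeOfRank r) :
    L.SymHatIsCompletion ∧
    (∀ nab : L.Connection,
      ∃ j : LieAlgebroidPBW.DualIso L.envCoalg L.symCoalg,
        ∀ (W : Opens X) (φ : L.Jet W) (V : Opens X) (h : V ≤ W) (n : ℕ) (x : Fin n → L.Obj V),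
          L.symEval (j.equiv W φ) h
              (∏ i, SymmetricAlgebra.ι (LieAlgebroidPBW.Sec O V) (L.Obj V) (x i)) =
            nab.pbwCoeff (L.envCoalg.dualRes h φ) n x) ∧
    (∀ j : LieAlgebroidPBW.DualIso L.envCoalg L.symCoalg,
      ∃! nab : L.Connection,
        ∀ (W : Opens X) (α : L.Form W) (x y : L.Obj W),
          L.jetEval ((j.equiv W).symm (L.linear W α)) le_rfl
              (LieAlgebroidPBW.Env.ofLie K x * LieAlgebroidPBW.Env.ofLie K y) =
            L.jetEval ((j.equiv W).symm (L.linear W α)) le_rfl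
              (LieAlgebroidPBW.Env.ofLie K (nab.nabla W x y))) := by
  exact ⟨LieAlgebroidPBW.LieAlgebroid.symHatIsCompletion hL,
    fun nab => ⟨nab.pbwDualIso hL, fun _ φ _ h n x => nab.symEval_pbwDualIso hL
      φ h n x⟩,
    fun j => LieAlgebroidPBW.LieAlgebroid.existsUnique_connection hL j⟩
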